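/- Let $n\ge 1$, let $\Theta_{n-1}$ be Joyal's cell category ($\Theta_0$ is the terminal category and $\Theta_{j+1}=\Delta\wr\Theta_j$), and let $\mathcal V=\mathrm{Set}^{(\Theta_{n-1}\times\Delta)^{op}}$ be the cartesian closed category of $\Theta_{n-1}$-spaces. Let $\mathcal V^{\Delta^{op}}=\mathrm{Set}^{(\Delta\times\Theta_{n-1}\times\Delta)^{op}}$, write $F[m,\theta,k]$ for its representables, and let $\mathrm{PCat}(\mathcal V)\subset\mathcal V^{\Delta^{op}}$ be the full subcategory of those $W$ such that $W_0$ is discrete (constant on a set), with $L$ the left adjoint of the inclusion. For $W\in\mathrm{PCat}(\mathcal V)$, let $\mathfrak C W$ be the $\mathcal V$-enriched category with object set $W_0$ and $\mathrm{Hom}_{\mathfrak C W}(a,b)_{\theta,k}=\mathrm{Hom}_{c^hW_{-,\theta,k}}(a,b)_k$, where $c^h$ is the left adjoint of the homotopy coherent nerve. Let $[\mathfrak C W^{op},\mathcal V]$ be the category of $\mathcal V$-enriched functors and $\mathcal V$-enriched natural transformations. For a map $\sigma\colon F[m,\theta,k]\to W$, with transpose $\sigma\colon LF[m,\theta,k]\to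 W$, let $W_\sigma$ be the pushout in $\mathrm{PCat}(\mathcal V)$ of $LF[m+1,\theta,k]\xleftarrow{d^{m+1}}LF[m,\theta,k]\xrightarrow{\sigma}W$, let $\iota_\sigma\colon W\to W_\sigma$ be the canonical map, and let $\top$ be the image in $W_\sigma$ of the vertex $m+1$. Put $\mathrm{St}_W(\sigma)=\mathrm{Hom}_{\mathfrak C W_\sigma}((\mathfrak C\iota_\sigma)(-),\top)$. The functor $\mathrm{St}_W\colon \mathcal V^{\Delta^{op}}_{/W}\to[\mathfrak C W^{op},\mathcal V]$ is the left Kan extension of $\sigma\mapsto\mathrm{St}_W(\sigma)$ along the Yoneda embedding, under the equivalence between the slice category over $W$ and presheaves on the category of elements of $W$; it has a right adjoint $\mathrm{Un}_W$. Both categories are tensored over $\mathcal V$: for $p\colon P\to W$ and $X\in\mathcal V$, $p\otimes X$ is the composite $P\times X\to P\xrightarrow{p}W$, where $X$ is regarded as constant in the first variable, and for $F\colon\mathfrak C W^{op}\to\mathcal V$, $F\otimes X$ is $F(-)\times X$. They are $\mathcal V$-enriched by $\mathrm{Map}(A,B)_{\theta,k}=\mathrm{Hom}(A\otimes F[\theta,k],B)$,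 where $F[\theta,k]$ denotes the representable $\Theta_{n-1}$-space. Then, for every $W\in\mathrm{PCat}(\mathcal V)$, there are isomorphisms in $[\mathfrak C W^{op},\mathcal V]$ $$\mathrm{St}_W(p\otimes X)\cong\mathrm{St}_W(p)\otimes X,$$ natural in $p\in\mathcal V^{\Delta^{op}}_{/W}$ and $X\in\mathcal V$. Moreover, the adjunction $\mathrm{St}_W\dashv\mathrm{Un}_W$ is enriched over $\mathcal V$: $\mathrm{St}_W$ and $\mathrm{Un}_W$ extend to $\mathcal V$-enriched functors, and there are $\mathcal V$-natural isomorphisms $\mathrm{Map}(\mathrm{St}_W p,F)\cong\mathrm{Map}(p,\mathrm{Un}_W F)$ whose underlying bijections of hom sets are those of the adjunction. -/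

import Mathlib

open CategoryTheory Opposite MonoidalCategory Limits

noncomputable section

namespace Straightening

/-! ## Joyal's cell categories -/

/-- Objects of the wreath product `Δ ≀ C`: a number `len = ℓ` together with objects
`c₁, …, c_ℓ` of `C`, written `[ℓ](c₁, …, c_ℓ)`. -/
structure Wreath (C : Type) where
  len : ℕ
  fam : Fin len → C

namespace Wreath

variable {C : Type} [SmallCategory C]

/-- A morphism `[ℓ](c₁, …, c_ℓ) ⟶ [m](d₁, …, d_m)` of `Δ ≀ C`: a monotone map `φ : [ℓ] → [m]`
together with a morphism `c_i ⟶ d_j` of `C` whenever `φ(i-1) < j ≤ φ(i)`.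
(With indices starting at `0`, the condition reads `φ(i) ≤ j` and `j+1 ≤ φ(i+1)`.) -/
@[ext]
structure Hom (X Y : Wreath C) where
  base : Fin (X.len + 1) →o Fin (Y.len + 1)
  comp : ∀ (i : Fin X.len) (j : Fin Y.len), base i.castSucc ≤ j.castSucc →
    j.succ ≤ base i.succ → (X.fam i ⟶ Y.fam j)

lemma exists_between {n p : ℕ} (ψ : Fin (n + 1) →o Fin (p + 1)) (l : Fin p) (a b : Fin (n + 1))
    (ha : ψ a ≤ l.castSucc) (hb : l.succ ≤ ψ b) :
    ∃ j : Fin n, a ≤ j.castSucc ∧ j.succ ≤ b ∧ ψ j.castSucc ≤ l.castSucc ∧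
      l.succ ≤ ψ j.succ := by
  induction b using Fin.induction with
  | zero =>
    exfalso
    have h1 : ψ 0 ≤ ψ a := ψ.monotone (Fin.zero_le a)
    have h2 := hb.trans (h1.trans ha)
    simp [Fin.le_def] at h2
  | succ b ih =>
    by_cases h : l.succ ≤ ψ b.castSucc
    · obtain ⟨j, h1, h2, h3⟩ := ih h
      exact ⟨j, h1, h2.trans b.castSucc_lt_succ.le, h3⟩
    · have h' : ψ b.castSucc ≤ l.castSucc := by
        simp only [Fin.le_def, Fin.val_succ, Fin.val_castSucc, not_le] at h ⊢
        omega
      refine ⟨b, ?_, le_rfl, h', hb⟩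
      by_contra hab
      have hba : b.succ ≤ a := by
        simp only [Fin.le_def, Fin.val_succ, Fin.val_castSucc, not_le] at hab ⊢
        omega
      have h2 := hb.trans ((ψ.monotone hba).trans ha)
      simp [Fin.le_def] at h2

lemma between_unique {n p : ℕ} (ψ : Fin (n + 1) →o Fin (p + 1)) (l : Fin p) (j j' : Fin n)
    (h₁ : ψ j.castSucc ≤ l.castSucc) (h₂ : l.succ ≤ ψ j.succ)
    (h₁' : ψ j'.castSucc ≤ l.castSucc) (h₂' : l.succ ≤ ψ j'.succ) : j = j' := by
  rcases lt_trichotomy j j' with h | h | h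
  · have h3 : j.succ ≤ j'.castSucc := by
      simp only [Fin.le_def, Fin.lt_def, Fin.val_succ, Fin.val_castSucc] at h ⊢; omega
    have h4 := h₂.trans ((ψ.monotone h3).trans h₁')
    simp [Fin.le_def] at h4
  · exact h
  · have h3 : j'.succ ≤ j.castSucc := by
      simp only [Fin.le_def, Fin.lt_def, Fin.val_succ, Fin.val_castSucc] at h ⊢; omega
    have h4 := h₂'.trans ((ψ.monotone h3).trans h₁)
    simp [Fin.le_def] at h4

/-- The identity: for `φ = id` the condition forces `i = j`. -/
def Hom.id (X : Wreath C) : Hom X X where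
  base := OrderHom.id
  comp i j h₁ h₂ := eqToHom (by
    have h₃ : i.castSucc ≤ j.castSucc := h₁
    have h₄ : j.succ ≤ i.succ := h₂
    rw [le_antisymm (Fin.castSucc_le_castSucc_iff.1 h₃) (Fin.succ_le_succ_iff.1 h₄)])

/-- Composition: the component of `g ∘ f` at `(i, l)` is the composite of the components at
`(i, j)` and `(j, l)`, where `j` is the unique index for which both are defined. -/
def Hom.trans {X Y Z : Wreath C} (f : Hom X Y) (g : Hom Y Z) : Hom X Z where
  base := g.base.comp f.base
  comp i l h₁ h₂ :=
    let h := exists_between g.base l (f.base i.castSucc) (f.base i.succ) h₁ h₂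
    f.comp i h.choose h.choose_spec.1 h.choose_spec.2.1 ≫
      g.comp h.choose l h.choose_spec.2.2.1 h.choose_spec.2.2.2

lemma Hom.trans_comp {X Y Z : Wreath C} (f : Hom X Y) (g : Hom Y Z)
    (i : Fin X.len) (j : Fin Y.len) (l : Fin Z.len)
    (h₁ : f.base i.castSucc ≤ j.castSucc) (h₂ : j.succ ≤ f.base i.succ)
    (h₃ : g.base j.castSucc ≤ l.castSucc) (h₄ : l.succ ≤ g.base j.succ)
    (h₅ : (f.trans g).base i.castSucc ≤ l.castSucc) (h₆ : l.succ ≤ (f.trans g).base i.succ) :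
    (f.trans g).comp i l h₅ h₆ = f.comp i j h₁ h₂ ≫ g.comp j l h₃ h₄ := by
  have h := exists_between g.base l (f.base i.castSucc) (f.base i.succ) h₅ h₆
  have e : h.choose = j := between_unique g.base l _ _ h.choose_spec.2.2.1
    h.choose_spec.2.2.2 h₃ h₄
  subst e
  rfl

lemma Hom.ext' {X Y : Wreath C} {f g : Hom X Y} (h : f.base = g.base)
    (h' : ∀ i j h₁ h₂ h₃ h₄, f.comp i j h₁ h₂ = g.comp i j h₃ h₄) : f = g := by
  obtain ⟨fb, fc⟩ := f
  obtain ⟨gb, gc⟩ := g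
  obtain rfl : fb = gb := h
  congr
  funext i j h₁ h₂
  exact h' i j h₁ h₂ h₁ h₂

instance : SmallCategory (Wreath C) where
  Hom := Hom
  id := Hom.id
  comp := Hom.trans
  id_comp {X Y} f := Hom.ext' rfl fun i j h₁ h₂ h₃ h₄ => by
    rw [Hom.trans_comp (Hom.id X) f i i j le_rfl le_rfl h₃ h₄]
    simp [Hom.id]
  comp_id {X Y} f := Hom.ext' rfl fun i j h₁ h₂ h₃ h₄ => by
    rw [Hom.trans_comp f (Hom.id Y) i j j h₃ h₄ le_rfl le_rfl]
    simp [Hom.id]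
  assoc {X Y Z W} f g h := Hom.ext' rfl fun i l h₁ h₂ h₃ h₄ => by
    obtain ⟨k, a₁, a₂, a₃, a₄⟩ := exists_between h.base l ((f.trans g).base i.castSucc)
      ((f.trans g).base i.succ) h₁ h₂
    obtain ⟨j, b₁, b₂, b₃, b₄⟩ := exists_between g.base k (f.base i.castSucc)
      (f.base i.succ) a₁ a₂
    have c₁ : (g.trans h).base j.castSucc ≤ l.castSucc := (h.base.monotone b₃).trans a₃
    have c₂ : l.succ ≤ (g.trans h).base j.succ := a₄.trans (h.base.monotone b₄)
    have e₁ := Hom.trans_comp (f.trans g) h i k l a₁ a₂ a₃ a₄ h₁ h₂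
    have e₂ := Hom.trans_comp f g i j k b₁ b₂ b₃ b₄ a₁ a₂
    have e₃ := Hom.trans_comp f (g.trans h) i j l b₁ b₂ c₁ c₂ h₃ h₄
    have e₄ := Hom.trans_comp g h j k l b₃ b₄ a₃ a₄ c₁ c₂
    exact e₁.trans (by rw [e₂, Category.assoc, ← e₄]; exact e₃.symm)

/-- `[0]()` is a terminal object of `Δ ≀ C`. -/
def isTerminalZero : IsTerminal (⟨0, Fin.elim0⟩ : Wreath C) :=
  IsTerminal.ofUniqueHom
    (fun _ => Hom.mk ⟨fun _ => 0, fun _ _ _ => le_rfl⟩ (fun _ j _ _ => j.elim0))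
    (fun _ _ => Hom.ext' (OrderHom.ext _ _ (funext fun _ => Subsingleton.elim (α := Fin 1) _ _))
      (fun _ j _ _ _ _ => Fin.elim0 j))

end Wreath

/-- Joyal's cell category `Θ_n`: `Θ_0` is the terminal category, and `Θ_{n+1} = Δ ≀ Θ_n`. -/
def Theta (n : ℕ) : Cat.{0, 0} :=
  match n with
  | 0 => Cat.of (Discrete PUnit)
  | n + 1 => Cat.of (Wreath (Theta n))

instance (n : ℕ) : HasTerminal (Theta n) := by
  cases n with
  | zero => exact (IsTerminal.ofUniqueHom (Y := (⟨⟨⟩⟩ : Discrete PUnit)) (fun _ => eqToHom rfl)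
      (fun _ _ => Subsingleton.elim _ _)).hasTerminal
  | succ n => exact (Wreath.isTerminalZero (C := Theta n)).hasTerminal

section Spaces

variable (T : Type) [SmallCategory T]

/-- `T`-spaces, i.e. presheaves of simplicial sets on `T`, written as presheaves of sets on
`T × Δ`. -/
abbrev Space := (T × SimplexCategory)ᵒᵖ ⥤ Type

/-- `(Δ × T)`-spaces, written as presheaves of sets on `Δ × (T × Δ)`. -/
abbrev SimplicialSpace := (SimplexCategory × (T × SimplexCategory))ᵒᵖ ⥤ Type

/-- `W ↦ W_m`, the `T`-space of `m`-simplices. -/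
def atLevel (m : SimplexCategory) : SimplicialSpace T ⥤ Space T :=
  (Functor.whiskeringLeft _ _ _).obj (Prod.sectR m (T × SimplexCategory)).op

/-- `W ↦ W_{-,θ,k}`, the simplicial set obtained by fixing the last two variables. -/
def row (d : (T × SimplexCategory)ᵒᵖ) : SimplicialSpace T ⥤ SSet.{0} :=
  (Functor.whiskeringLeft _ _ _).obj (Prod.sectL SimplexCategory d.unop).op

/-- The inclusion of `T`-spaces into `(Δ × T)`-spaces, constant in the first variable. -/
def constSpace : Space T ⥤ SimplicialSpace T :=
  (Functor.whiskeringLeft _ _ _).obj (CategoryTheory.Prod.snd SimplexCategory (T × SimplexCategory)).op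

/-- `W` is a precategory if `W_0` is discrete, i.e. in the (essential) image of the inclusion of
sets into `T`-spaces as constant presheaves. -/
def isPrecat : ObjectProperty (SimplicialSpace T) := fun W =>
  (Functor.const (T × SimplexCategory)ᵒᵖ).essImage ((atLevel T (SimplexCategory.mk 0)).obj W)

/-- The full subcategory of those `(Δ × T)`-spaces `W` such that `W_0` is discrete. -/
abbrev PCat := (isPrecat T).FullSubcategory

variable [HasTerminal T]

/-- The terminal object of `T × Δ`. -/
def pt : T × SimplexCategory := (⊤_ T, (SimplexCategory.mk 0))

/-- The unique map to the terminal object of `T × Δ`. -/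
def toPt (d : T × SimplexCategory) : d ⟶ pt T :=
  Prod.mkHom (terminal.from d.1) (SimplexCategory.isTerminalZero.from d.2)

variable {T} in
lemma toPt_unique {d : T × SimplexCategory} (f g : d ⟶ pt T) : f = g :=
  Prod.hom_ext (terminal.hom_ext _ _) (SimplexCategory.isTerminalZero.hom_ext _ _)

variable {T} in
lemma isPrecat_iff (W : SimplicialSpace T) :
    isPrecat T W ↔ ∀ (d d' : (T × SimplexCategory)ᵒᵖ) (f : d ⟶ d'),
      Function.Bijective (((atLevel T (SimplexCategory.mk 0)).obj W).map f) := by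
  constructor
  · rintro ⟨A, ⟨e⟩⟩ d d' f
    have h := e.hom.naturality f
    have : IsIso (((atLevel T (SimplexCategory.mk 0)).obj W).map f) := by
      have h' : ((atLevel T (SimplexCategory.mk 0)).obj W).map f = e.inv.app d ≫ e.hom.app d' := by
        rw [← cancel_epi (e.hom.app d), ← h]
        simp
      rw [h']
      infer_instance
    exact (isIso_iff_bijective _).1 this
  · intro H
    refine ⟨((atLevel T (SimplexCategory.mk 0)).obj W).obj (op (pt T)), ⟨?_⟩⟩
    have (d : (T × SimplexCategory)ᵒᵖ) :
        IsIso (((atLevel T (SimplexCategory.mk 0)).obj W).map (toPt T d.unop).op) :=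
      (isIso_iff_bijective _).2 (H _ _ _)
    refine NatIso.ofComponents
      (fun d => asIso (((atLevel T (SimplexCategory.mk 0)).obj W).map (toPt T d.unop).op)) ?_
    intro d d' f
    have : (toPt T d'.unop).op = (toPt T d.unop).op ≫ f :=
      Quiver.Hom.unop_inj (toPt_unique _ _)
    simp [this]

/-- The maps of representables `F[0, θ, k] ⟶ F[0, θ', k']`. -/
def discreteMaps : MorphismProperty (SimplicialSpace T) :=
  MorphismProperty.ofHoms
    (fun (p : Σ (d d' : T × SimplexCategory), d ⟶ d') =>
      uliftYoneda.{0}.map ((Prod.sectR (SimplexCategory.mk 0) (T × SimplexCategory)).map p.2.2))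

lemma isPrecat_eq_isLocal : isPrecat T = (discreteMaps T).isLocal := by
  ext W
  rw [isPrecat_iff]
  have key (d d' : T × SimplexCategory) (f : d ⟶ d') :
      Function.Bijective (((atLevel T (SimplexCategory.mk 0)).obj W).map f.op) ↔
      Function.Bijective (fun (g : _ ⟶ W) =>
        uliftYoneda.{0}.map ((Prod.sectR (SimplexCategory.mk 0) (T × SimplexCategory)).map f) ≫ g) := by
    rw [← uliftYonedaEquiv.symm.bijective.of_comp_iff, ← uliftYonedaEquiv.bijective.of_comp_iff']
    apply iff_of_eq
    congr 1
    funext x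
    have h := uliftYonedaEquiv_symm_map.{0}
      ((Prod.sectR (SimplexCategory.mk 0) (T × SimplexCategory)).map f).op (F := W) x
    exact (Equiv.symm_apply_eq _).1 h
  constructor
  · rintro H _ _ _ ⟨p⟩
    exact (key _ _ _).1 (H _ _ _)
  · intro H d d' f
    exact (key _ _ f.unop).2
      (H _ (MorphismProperty.ofHoms.mk (⟨_, _, f.unop⟩ : Σ (d d' : T × SimplexCategory), d ⟶ d')))

instance : (isPrecat T).ι.IsRightAdjoint := by
  have := Cardinal.fact_isRegular_aleph0.{0}
  have : MorphismProperty.IsSmall.{0} (discreteMaps T) := by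
    unfold discreteMaps
    infer_instance
  rw [isPrecat_eq_isLocal]
  refine MorphismProperty.isRightAdjoint_ι_isLocal _ Cardinal.aleph0.{0} ?_
  rintro _ _ _ ⟨p⟩
  constructor <;> infer_instance

/-- The left adjoint `L` of the inclusion of precategories into `(Δ × T)`-spaces. -/
def toPCat : SimplicialSpace T ⥤ PCat T := (isPrecat T).ι.leftAdjoint

/-- The adjunction `L ⊣ I`. -/
def toPCatAdj : toPCat T ⊣ (isPrecat T).ι := Adjunction.ofIsRightAdjoint _

instance : HasColimits (PCat T) := by
  have : Reflective (isPrecat T).ι := { L := toPCat T, adj := toPCatAdj T }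
  exact hasColimits_of_reflective (isPrecat T).ι

end Spaces

/-! ## Homotopy coherent categorification -/

section Categorification

/-- The set of `k`-simplices of the hom simplicial set from `i` to `j` of the simplicial category
`c^h Δ[m]`, i.e. of the nerve of the poset of subsets of `{i, …, j}` containing `i` and `j`. -/
abbrev PathSimplex (m k : SimplexCategory) (i j : Fin (m.len + 1)) : Type :=
  ((SimplicialThickening.mk i) ⟶[SSet.{0}] (SimplicialThickening.mk j)).obj (op k)

/-- Composition in the category of `k`-simplices of `c^h Δ[m]`. -/
abbrev PathSimplex.comp {m k : SimplexCategory} {i j l : Fin (m.len + 1)}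
    (p : PathSimplex m k i j) (q : PathSimplex m k j l) : PathSimplex m k i l :=
  (eComp SSet.{0} (SimplicialThickening.mk i) (SimplicialThickening.mk j)
    (SimplicialThickening.mk l)).app (op k) (p, q)

/-- Identities in the category of `k`-simplices of `c^h Δ[m]`. -/
abbrev PathSimplex.id {m : SimplexCategory} (k : SimplexCategory) (i : Fin (m.len + 1)) :
    PathSimplex m k i i :=
  (eId SSet.{0} (SimplicialThickening.mk i)).app (op k) PUnit.unit

/-- The action of the simplicial functor `c^h α : c^h Δ[m] ⟶ c^h Δ[m']` on `k`-simplices. -/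
abbrev PathSimplex.push {m m' k : SimplexCategory} (α : m ⟶ m') {i j : Fin (m.len + 1)}
    (p : PathSimplex m k i j) : PathSimplex m' k (α.toOrderHom i) (α.toOrderHom j) :=
  ((SimplicialThickening.functor α.toOrderHom).map (SimplicialThickening.mk i)
    (SimplicialThickening.mk j)).app (op k) p

/-- Restriction along a map of simplicial degrees. -/
abbrev PathSimplex.restrict {m k k' : SimplexCategory} (κ : k' ⟶ k) {i j : Fin (m.len + 1)}
    (p : PathSimplex m k i j) : PathSimplex m k' i j :=
  ((SimplicialThickening.mk i) ⟶[SSet.{0}] (SimplicialThickening.mk j)).map κ.op p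

variable {A A' A'' : Type}

/-- The `i`-th vertex of an `m`-simplex. -/
abbrev vertex (K : SSet.{0}) {m : SimplexCategory} (σ : K.obj (op m)) (i : Fin (m.len + 1)) :
    K.obj (op (SimplexCategory.mk 0)) :=
  K.map (SimplexCategory.const (SimplexCategory.mk 0) m i).op σ

/-- Let `K` be a simplicial set whose vertices are labelled through `ℓ : A → K_0`. A generator
`a → b` in simplicial degree `k` is an `m`-simplex `σ` of `K` together with a `k`-simplex of
`Hom_{c^h Δ[m]}(i, j)`, where the `i`-th and `j`-th vertices of `σ` are `a` and `b`. -/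
structure Gen (K : SSet.{0}) (ℓ : A → K.obj (op (SimplexCategory.mk 0))) (k : SimplexCategory)
    (a b : A) where
  m : SimplexCategory
  simplex : K.obj (op m)
  i : Fin (m.len + 1)
  j : Fin (m.len + 1)
  path : PathSimplex m k i j
  src : vertex K simplex i = ℓ a
  tgt : vertex K simplex j = ℓ b

/-- Formal composites of generators. -/
inductive Word (K : SSet.{0}) (ℓ : A → K.obj (op (SimplexCategory.mk 0))) (k : SimplexCategory) :
    A → A → Type
  | of {a b : A} (g : Gen K ℓ k a b) : Word K ℓ k a b
  | id (a : A) : Word K ℓ k a a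
  | comp {a b c : A} (v : Word K ℓ k a b) (w : Word K ℓ k b c) : Word K ℓ k a c

/-- The relations between formal composites, besides those of a category: for every simplex `σ`
of `K`, composition and identities are those of `c^h Δ[m]`; and for `α : [m] → [m']` and an
`m'`-simplex `σ`, the generator of `σ` at the image under `c^h α` of an arrow of `c^h Δ[m]` is the
generator of `α^* σ` at that arrow. -/
inductive Word.Rel (K : SSet.{0}) (ℓ : A → K.obj (op (SimplexCategory.mk 0)))
    (k : SimplexCategory) : ∀ {a b : A}, Word K ℓ k a b → Word K ℓ k a b → Prop
  | id_comp {a b : A} (w : Word K ℓ k a b) : Rel K ℓ k (.comp (.id a) w) w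
  | comp_id {a b : A} (w : Word K ℓ k a b) : Rel K ℓ k (.comp w (.id b)) w
  | assoc {a b c d : A} (u : Word K ℓ k a b) (v : Word K ℓ k b c) (w : Word K ℓ k c d) :
      Rel K ℓ k (.comp (.comp u v) w) (.comp u (.comp v w))
  | comp_left {a b c : A} (u : Word K ℓ k a b) {v w : Word K ℓ k b c} (h : Rel K ℓ k v w) :
      Rel K ℓ k (.comp u v) (.comp u w)
  | comp_right {a b c : A} {u v : Word K ℓ k a b} (w : Word K ℓ k b c) (h : Rel K ℓ k u v) :
      Rel K ℓ k (.comp u w) (.comp v w)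
  | gen_comp {a b c : A} (m : SimplexCategory) (σ : K.obj (op m)) (i j l : Fin (m.len + 1))
      (p : PathSimplex m k i j) (q : PathSimplex m k j l)
      (ha : vertex K σ i = ℓ a) (hb : vertex K σ j = ℓ b) (hc : vertex K σ l = ℓ c) :
      Rel K ℓ k (.comp (.of ⟨m, σ, i, j, p, ha, hb⟩) (.of ⟨m, σ, j, l, q, hb, hc⟩))
        (.of ⟨m, σ, i, l, p.comp q, ha, hc⟩)
  | gen_id {a : A} (m : SimplexCategory) (σ : K.obj (op m)) (i : Fin (m.len + 1))
      (ha : vertex K σ i = ℓ a) :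
      Rel K ℓ k (.of ⟨m, σ, i, i, PathSimplex.id k i, ha, ha⟩) (.id a)
  | gen_push {a b : A} (m m' : SimplexCategory) (α : m ⟶ m') (σ : K.obj (op m'))
      (i j : Fin (m.len + 1)) (p : PathSimplex m k i j)
      (ha : vertex K (K.map α.op σ) i = ℓ a) (hb : vertex K (K.map α.op σ) j = ℓ b)
      (ha' : vertex K σ (α.toOrderHom i) = ℓ a) (hb' : vertex K σ (α.toOrderHom j) = ℓ b) :
      Rel K ℓ k (.of ⟨m', σ, α.toOrderHom i, α.toOrderHom j, p.push α, ha', hb'⟩)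
        (.of ⟨m, K.map α.op σ, i, j, p, ha, hb⟩)

/-- When `ℓ : A → K_0` is a bijection, this is the set of `k`-simplices of the hom simplicial set
from `a` to `b` of the simplicial category `c^h K`, whose objects are identified with `A`. Since
`c^h` is the colimit-preserving extension of `[m] ↦ c^h Δ[m]`, and colimits of simplicial
categories are computed in each simplicial degree, the category of `k`-simplices of `c^h K` is the
colimit of the categories of `k`-simplices of `c^h Δ[m]` over all `m` and all `σ ∈ K_m`. This
colimit of categories is described here by generators and relations. -/
def CohHom (K : SSet.{0}) (ℓ : A → K.obj (op (SimplexCategory.mk 0))) (k : SimplexCategory)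
    (a b : A) : Type :=
  Quot (Word.Rel K ℓ k (a := a) (b := b))

variable {K : SSet.{0}} {ℓ : A → K.obj (op (SimplexCategory.mk 0))} {k : SimplexCategory}

/-- Identities of `c^h K` in degree `k`. -/
def CohHom.id (a : A) : CohHom K ℓ k a a := Quot.mk _ (.id a)

/-- Composition of `c^h K` in degree `k`. -/
def CohHom.comp {a b c : A} (f : CohHom K ℓ k a b) (g : CohHom K ℓ k b c) : CohHom K ℓ k a c :=
  Quot.map₂ Word.comp (fun u _ _ h => .comp_left u h) (fun _ _ w h => .comp_right w h) f g

lemma CohHom.id_comp {a b : A} (f : CohHom K ℓ k a b) : (CohHom.id a).comp f = f := by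
  induction f using Quot.ind
  exact Quot.sound (.id_comp _)

lemma CohHom.comp_id {a b : A} (f : CohHom K ℓ k a b) : f.comp (CohHom.id b) = f := by
  induction f using Quot.ind
  exact Quot.sound (.comp_id _)

lemma CohHom.assoc {a b c d : A} (f : CohHom K ℓ k a b) (g : CohHom K ℓ k b c)
    (h : CohHom K ℓ k c d) : (f.comp g).comp h = f.comp (g.comp h) := by
  induction f using Quot.ind
  induction g using Quot.ind
  induction h using Quot.ind
  exact Quot.sound (.assoc _ _ _)

variable {K' K'' : SSet.{0}} {ℓ' : A' → K'.obj (op (SimplexCategory.mk 0))}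
  {ℓ'' : A'' → K''.obj (op (SimplexCategory.mk 0))} {k' k'' : SimplexCategory}

lemma vertex_app (φ : K ⟶ K') {m : SimplexCategory} (σ : K.obj (op m)) (i : Fin (m.len + 1)) :
    vertex K' (φ.app (op m) σ) i = φ.app (op (SimplexCategory.mk 0)) (vertex K σ i) :=
  (NatTrans.naturality_apply φ _ _).symm

/-- Functoriality of generators in the simplicial set and in the simplicial degree. -/
def Gen.map (φ : K ⟶ K') (ρ : A → A')
    (hρ : ∀ x, φ.app (op (SimplexCategory.mk 0)) (ℓ x) = ℓ' (ρ x)) (κ : k' ⟶ k)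
    {a b : A} (g : Gen K ℓ k a b) : Gen K' ℓ' k' (ρ a) (ρ b) where
  m := g.m
  simplex := φ.app (op g.m) g.simplex
  i := g.i
  j := g.j
  path := g.path.restrict κ
  src := by rw [vertex_app, g.src, hρ]
  tgt := by rw [vertex_app, g.tgt, hρ]

/-- Functoriality of formal composites in the simplicial set and in the simplicial degree. -/
def Word.map (φ : K ⟶ K') (ρ : A → A')
    (hρ : ∀ x, φ.app (op (SimplexCategory.mk 0)) (ℓ x) = ℓ' (ρ x)) (κ : k' ⟶ k) :
    ∀ {a b : A}, Word K ℓ k a b → Word K' ℓ' k' (ρ a) (ρ b)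
  | _, _, .of g => .of (g.map φ ρ hρ κ)
  | _, _, .id a => .id (ρ a)
  | _, _, .comp v w => .comp (v.map φ ρ hρ κ) (w.map φ ρ hρ κ)

lemma PathSimplex.restrict_comp {m : SimplexCategory} (κ : k' ⟶ k) {i j l : Fin (m.len + 1)}
    (p : PathSimplex m k i j) (q : PathSimplex m k j l) :
    (p.comp q).restrict κ = (p.restrict κ).comp (q.restrict κ) :=
  (ConcreteCategory.congr_hom ((eComp SSet.{0} (SimplicialThickening.mk i)
    (SimplicialThickening.mk j) (SimplicialThickening.mk l)).naturality κ.op)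
      ((p, q) : PathSimplex m k i j × PathSimplex m k j l)).symm

lemma PathSimplex.restrict_id {m : SimplexCategory} (κ : k' ⟶ k) (i : Fin (m.len + 1)) :
    (PathSimplex.id k i).restrict κ = PathSimplex.id k' i :=
  (NatTrans.naturality_apply (eId SSet.{0} (SimplicialThickening.mk i)) κ.op PUnit.unit).symm

lemma PathSimplex.restrict_push {m m' : SimplexCategory} (α : m ⟶ m') (κ : k' ⟶ k)
    {i j : Fin (m.len + 1)} (p : PathSimplex m k i j) :
    (p.push α).restrict κ = (p.restrict κ).push α :=
  (NatTrans.naturality_apply ((SimplicialThickening.functor α.toOrderHom).map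
    (SimplicialThickening.mk i) (SimplicialThickening.mk j)) κ.op p).symm

lemma Word.map_rel (φ : K ⟶ K') (ρ : A → A')
    (hρ : ∀ x, φ.app (op (SimplexCategory.mk 0)) (ℓ x) = ℓ' (ρ x)) (κ : k' ⟶ k)
    {a b : A} {v w : Word K ℓ k a b} (h : Word.Rel K ℓ k v w) :
    Word.Rel K' ℓ' k' (v.map φ ρ hρ κ) (w.map φ ρ hρ κ) := by
  induction h with
  | id_comp w => exact .id_comp _
  | comp_id w => exact .comp_id _
  | assoc u v w => exact .assoc _ _ _
  | comp_left u h ih => exact .comp_left _ ih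
  | comp_right w h ih => exact .comp_right _ ih
  | gen_comp m σ i j l p q ha hb hc =>
    simp only [Word.map, Gen.map, PathSimplex.restrict_comp]
    exact .gen_comp _ _ _ _ _ _ _ _ _ _
  | gen_id m σ i ha =>
    simp only [Word.map, Gen.map, PathSimplex.restrict_id]
    exact .gen_id _ _ _ _
  | gen_push m m' α σ i j p ha hb ha' hb' =>
    have e : φ.app (op m) (K.map α.op σ) = K'.map α.op (φ.app (op m') σ) :=
      NatTrans.naturality_apply φ α.op σ
    simp only [Word.map, Gen.map, PathSimplex.restrict_push, e]
    exact .gen_push _ _ _ _ _ _ _ _ _ _ _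

/-- Functoriality of `c^h K` in `K` and in the simplicial degree. -/
def CohHom.map (φ : K ⟶ K') (ρ : A → A')
    (hρ : ∀ x, φ.app (op (SimplexCategory.mk 0)) (ℓ x) = ℓ' (ρ x)) (κ : k' ⟶ k)
    {a b : A} (f : CohHom K ℓ k a b) : CohHom K' ℓ' k' (ρ a) (ρ b) :=
  Quot.map (Word.map φ ρ hρ κ) (fun _ _ h => Word.map_rel φ ρ hρ κ h) f

lemma CohHom.map_comp (φ : K ⟶ K') (ρ : A → A')
    (hρ : ∀ x, φ.app (op (SimplexCategory.mk 0)) (ℓ x) = ℓ' (ρ x)) (κ : k' ⟶ k)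
    {a b c : A} (f : CohHom K ℓ k a b) (g : CohHom K ℓ k b c) :
    (f.comp g).map φ ρ hρ κ = (f.map φ ρ hρ κ).comp (g.map φ ρ hρ κ) := by
  induction f using Quot.ind
  induction g using Quot.ind
  rfl

lemma CohHom.map_id (φ : K ⟶ K') (ρ : A → A')
    (hρ : ∀ x, φ.app (op (SimplexCategory.mk 0)) (ℓ x) = ℓ' (ρ x)) (κ : k' ⟶ k) (a : A) :
    (CohHom.id a : CohHom K ℓ k a a).map φ ρ hρ κ = CohHom.id (ρ a) := rfl

lemma CohHom.map_map (φ : K ⟶ K') (ρ : A → A')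
    (hρ : ∀ x, φ.app (op (SimplexCategory.mk 0)) (ℓ x) = ℓ' (ρ x)) (κ : k' ⟶ k)
    (φ' : K' ⟶ K'') (ρ' : A' → A'')
    (hρ' : ∀ x, φ'.app (op (SimplexCategory.mk 0)) (ℓ' x) = ℓ'' (ρ' x)) (κ' : k'' ⟶ k')
    {a b : A} (f : CohHom K ℓ k a b) :
    (f.map φ ρ hρ κ).map φ' ρ' hρ' κ' =
      f.map (ℓ' := ℓ'') (φ ≫ φ') (ρ' ∘ ρ) (fun x => by simp [hρ, hρ']) (κ' ≫ κ) := by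
  induction f using Quot.ind with
  | mk w =>
    refine congrArg (Quot.mk _) ?_
    induction w with
    | of g =>
      simp only [Word.map, Gen.map]
      congr 2
    | id a => rfl
    | comp v w hv hw => simp only [Word.map, hv, hw]

lemma CohHom.map_self {a b : A} (h) (f : CohHom K ℓ k a b) :
    f.map (ℓ' := ℓ) (𝟙 K) (fun x => x) h (𝟙 k) = f := by
  induction f using Quot.ind with
  | mk w =>
    refine congrArg (Quot.mk _) ?_
    induction w with
    | of g =>
      simp only [Word.map, Gen.map]
      congr 2
    | id a => rfl
    | comp v w hv hw => simp only [Word.map, hv, hw]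

lemma CohHom.map_congr {φ φ' : K ⟶ K'} {ρ : A → A'}
    {hρ : ∀ x, φ.app (op (SimplexCategory.mk 0)) (ℓ x) = ℓ' (ρ x)}
    {hρ' : ∀ x, φ'.app (op (SimplexCategory.mk 0)) (ℓ x) = ℓ' (ρ x)} {κ κ' : k' ⟶ k}
    (hφ : φ = φ') (hκ : κ = κ') {a b : A} (f : CohHom K ℓ k a b) :
    f.map φ ρ hρ κ = f.map φ' ρ hρ' κ' := by
  subst hφ hκ
  rfl

end Categorification

section CoherentCategory

variable {T : Type} [SmallCategory T]

/-- The map of simplicial sets `W_{-,θ,k} ⟶ W_{-,θ',k'}` induced by `(θ', k') ⟶ (θ, k)`. -/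
def rowMap (W : SimplicialSpace T) {d d' : (T × SimplexCategory)ᵒᵖ} (f : d ⟶ d') :
    (row T d).obj W ⟶ (row T d').obj W where
  app m := W.map (Prod.mkHom (𝟙 m.unop) f.unop).op
  naturality m m' g := by
    have h : (Prod.mkHom g.unop (𝟙 d.unop)).op ≫ (Prod.mkHom (𝟙 m'.unop) f.unop).op =
        (Prod.mkHom (𝟙 m.unop) f.unop).op ≫ (Prod.mkHom g.unop (𝟙 d'.unop)).op :=
      Quiver.Hom.unop_inj (Prod.hom_ext
        ((Category.id_comp g.unop).trans (Category.comp_id g.unop).symm)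
        ((Category.comp_id f.unop).trans (Category.id_comp f.unop).symm))
    exact (W.map_comp _ _).symm.trans ((congrArg W.map h).trans (W.map_comp _ _))

lemma rowMap_id (W : SimplicialSpace T) (d : (T × SimplexCategory)ᵒᵖ) :
    rowMap W (𝟙 d) = 𝟙 _ :=
  NatTrans.ext (funext fun _ => W.map_id _)

lemma rowMap_comp (W : SimplicialSpace T) {d d' d'' : (T × SimplexCategory)ᵒᵖ} (f : d ⟶ d')
    (g : d' ⟶ d'') : rowMap W (f ≫ g) = rowMap W f ≫ rowMap W g := by
  refine NatTrans.ext (funext fun m => ?_)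
  have h : (Prod.mkHom (𝟙 m.unop) (f ≫ g).unop).op =
      (Prod.mkHom (𝟙 m.unop) f.unop).op ≫ (Prod.mkHom (𝟙 m.unop) g.unop).op :=
    Quiver.Hom.unop_inj (Prod.hom_ext (Category.id_comp _).symm rfl)
  exact (congrArg W.map h).trans (W.map_comp _ _)

lemma rowMap_naturality {W Z : SimplicialSpace T} (u : W ⟶ Z) {d d' : (T × SimplexCategory)ᵒᵖ}
    (f : d ⟶ d') : rowMap W f ≫ (row T d').map u = (row T d).map u ≫ rowMap Z f :=
  NatTrans.ext (funext fun _ => u.naturality _)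

variable [HasTerminal T]

/-- The type of objects of `𝔠 W`, for a precategory `W`: the set `W_0`, i.e. the value of the
constant presheaf `W_0` at the terminal object of `T × Δ`. -/
def Coh (W : PCat T) : Type := W.obj.obj (op (SimplexCategory.mk 0, pt T))

namespace Coh

/-- The identification of `W_0` with the set of vertices of the simplicial set `W_{-,θ,k}`. -/
def label (W : PCat T) (d : (T × SimplexCategory)ᵒᵖ) (a : Coh W) :
    ((row T d).obj W.obj).obj (op (SimplexCategory.mk 0)) :=
  W.obj.map (Prod.mkHom (𝟙 (SimplexCategory.mk 0)) (toPt T d.unop)).op a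

lemma label_bijective (W : PCat T) (d : (T × SimplexCategory)ᵒᵖ) :
    Function.Bijective (label W d) :=
  (isPrecat_iff W.obj).1 W.property _ _ (toPt T d.unop).op

lemma rowMap_label (W : PCat T) {d d' : (T × SimplexCategory)ᵒᵖ} (f : d ⟶ d') (a : Coh W) :
    (rowMap W.obj f).app (op (SimplexCategory.mk 0)) (label W d a) = label W d' a := by
  have h := W.obj.map_comp (Prod.mkHom (𝟙 (SimplexCategory.mk 0)) (toPt T d.unop)).op
    (Prod.mkHom (𝟙 (SimplexCategory.mk 0)) f.unop).op
  have e : (Prod.mkHom (𝟙 (SimplexCategory.mk 0)) (toPt T d.unop)).op ≫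
      (Prod.mkHom (𝟙 (SimplexCategory.mk 0)) f.unop).op =
        (Prod.mkHom (𝟙 (SimplexCategory.mk 0)) (toPt T d'.unop)).op :=
    Quiver.Hom.unop_inj (Prod.hom_ext (Category.id_comp _) (toPt_unique _ _))
  exact (ConcreteCategory.congr_hom h a).symm.trans
    (congrArg (fun e => W.obj.map e a) e)

/-- The hom `T`-space `Hom_{𝔠 W}(a, b)`. It is the diagonal of `c^h` applied levelwise: its value at
`(θ, k)` is the set of `k`-simplices of the hom simplicial set from `a` to `b` in
`c^h W_{-,θ,k}`. -/
def hom (W : PCat T) (a b : Coh W) : Space T where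
  obj d := CohHom ((row T d).obj W.obj) (label W d) d.unop.2 a b
  map {d d'} f := ↾fun x => x.map (rowMap W.obj f) (fun x => x) (rowMap_label W f) f.unop.2
  map_id d := by
    ext x
    exact (CohHom.map_congr (rowMap_id W.obj d) rfl x).trans
      (CohHom.map_self (a := a) (b := b) (fun _ => rfl) x)
  map_comp f g := by
    ext x
    exact (CohHom.map_congr (rowMap_comp W.obj f g) rfl x).trans
      (CohHom.map_map _ _ (rowMap_label W f) _ _ _ (rowMap_label W g) _ x).symm

/-- The `T`-space-enriched category `𝔠 W`. -/
instance (W : PCat T) : EnrichedCategory (Space T) (Coh W) where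
  Hom := hom W
  id a := { app d := ↾fun _ => CohHom.id a }
  comp a b c :=
    { app d := ↾fun x => CohHom.comp x.1 x.2
      naturality d d' f := by
        ext x
        exact (CohHom.map_comp (rowMap W.obj f) (fun x => x) (rowMap_label W f) f.unop.2
          x.1 x.2).symm }
  id_comp a b := by
    ext d x
    exact CohHom.id_comp _
  comp_id a b := by
    ext d x
    exact CohHom.comp_id _
  assoc a b c e := by
    ext d x
    exact CohHom.assoc _ _ _

/-- The map on objects `W_0 ⟶ Z_0`. -/
def onObj {W Z : PCat T} (u : W ⟶ Z) (a : Coh W) : Coh Z := u.hom.app _ a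

lemma label_onObj {W Z : PCat T} (u : W ⟶ Z) (d : (T × SimplexCategory)ᵒᵖ) (a : Coh W) :
    ((row T d).map u.hom).app (op (SimplexCategory.mk 0)) (label W d a) =
      label Z d (onObj u a) :=
  NatTrans.naturality_apply u.hom _ a

/-- The map `Hom_{𝔠 W}(a, b) ⟶ Hom_{𝔠 Z}(a', b')` induced by a map of precategories sending `a` to
`a'` and `b` to `b'`. -/
def mapHom {W Z : PCat T} (u : W ⟶ Z) {a b : Coh W} {a' b' : Coh Z} (ha : onObj u a = a')
    (hb : onObj u b = b') : (a ⟶[Space T] b) ⟶ (a' ⟶[Space T] b') where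
  app d := ↾fun x => cast (by subst ha hb; rfl)
    (CohHom.map ((row T d).map u.hom) (onObj u) (label_onObj u d) (𝟙 _) x)
  naturality d d' f := by
    subst ha hb
    ext x
    have e₁ := CohHom.map_map _ _ (rowMap_label W f) f.unop.2 _ _ (label_onObj u d') (𝟙 _) x
    have e₂ := CohHom.map_map _ _ (label_onObj u d) (𝟙 _) _ _ (rowMap_label Z f) f.unop.2 x
    refine e₁.trans (Eq.trans ?_ e₂.symm)
    exact CohHom.map_congr (rowMap_naturality u.hom f) (by simp) x

lemma mapHom_id {W : PCat T} {a b : Coh W} (ha : onObj (𝟙 W) a = a) (hb : onObj (𝟙 W) b = b) :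
    mapHom (𝟙 W) ha hb = 𝟙 _ := by
  ext d x
  exact CohHom.map_self _ x

lemma mapHom_comp {W Z Y : PCat T} (u : W ⟶ Z) (v : Z ⟶ Y) {a b : Coh W} {a' b' : Coh Z}
    {a'' b'' : Coh Y} (ha : onObj u a = a') (hb : onObj u b = b') (ha' : onObj v a' = a'')
    (hb' : onObj v b' = b'') (ha'' : onObj (u ≫ v) a = a'') (hb'' : onObj (u ≫ v) b = b'') :
    mapHom (u ≫ v) ha'' hb'' = mapHom u ha hb ≫ mapHom v ha' hb' := by
  subst ha hb ha' hb'
  ext d x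
  exact (CohHom.map_map _ _ (label_onObj u d) (𝟙 _) _ _ (label_onObj v d) (𝟙 _) x).symm

lemma mapHom_eComp {W Z : PCat T} (u : W ⟶ Z) {a b c : Coh W} {a' b' c' : Coh Z}
    (ha : onObj u a = a') (hb : onObj u b = b') (hc : onObj u c = c') :
    eComp (Space T) a b c ≫ mapHom u ha hc =
      (mapHom u ha hb ⊗ₘ mapHom u hb hc) ≫ eComp (Space T) a' b' c' := by
  subst ha hb hc
  ext d x
  exact CohHom.map_comp _ _ _ _ x.1 x.2

/-- The enriched functor `𝔠 u : 𝔠 W ⟶ 𝔠 Z` induced by a map of precategories. -/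
def functor {W Z : PCat T} (u : W ⟶ Z) : EnrichedFunctor (Space T) (Coh W) (Coh Z) where
  obj := onObj u
  map a b := mapHom u rfl rfl
  map_id a := by
    ext d x
    rfl
  map_comp a b c := mapHom_eComp u rfl rfl rfl

end Coh

end CoherentCategory
/-! ## Enriched presheaves -/

section EnrichedPresheaves

universe v u w

/-- Enriched functors `Cᵒᵖ ⟶ V`, for a category `C` enriched over the closed symmetric monoidal
category `V`: the maps `Hom_C(a, b) ⟶ [F b, F a]` are given by their transposes
`Hom_C(a, b) ⊗ F b ⟶ F a`. -/
structure EPresheaf (V : Type u) [Category.{v} V] [MonoidalCategory V] (C : Type w)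
    [EnrichedCategory V C] where
  obj : C → V
  act (a b : C) : (a ⟶[V] b) ⊗ obj b ⟶ obj a
  id_act (a : C) : (λ_ (obj a)).inv ≫ eId V a ▷ obj a ≫ act a a = 𝟙 (obj a)
  comp_act (a b c : C) :
    (α_ (a ⟶[V] b) (b ⟶[V] c) (obj c)).inv ≫ eComp V a b c ▷ obj c ≫ act a c =
      (a ⟶[V] b) ◁ act b c ≫ act a b

namespace EPresheaf

variable {V : Type u} [Category.{v} V] [MonoidalCategory V] {C : Type w} [EnrichedCategory V C]

/-- Enriched natural transformations. -/
@[ext]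
structure Hom (F G : EPresheaf V C) where
  app (a : C) : F.obj a ⟶ G.obj a
  naturality (a b : C) : (a ⟶[V] b) ◁ app b ≫ G.act a b = F.act a b ≫ app a

instance : Category (EPresheaf V C) where
  Hom := Hom
  id F := { app a := 𝟙 _, naturality a b := by simp }
  comp f g :=
    { app a := f.app a ≫ g.app a
      naturality a b := by
        rw [MonoidalCategory.whiskerLeft_comp, Category.assoc, g.naturality, ← Category.assoc,
          f.naturality, Category.assoc] }
  id_comp _ := Hom.ext (funext fun _ => Category.id_comp _)
  comp_id _ := Hom.ext (funext fun _ => Category.comp_id _)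
  assoc _ _ _ := Hom.ext (funext fun _ => Category.assoc _ _ _)

@[ext]
lemma hom_ext {F G : EPresheaf V C} {f g : F ⟶ G} (h : ∀ a, Hom.app f a = Hom.app g a) : f = g :=
  Hom.ext (funext h)

@[simp]
lemma id_app (F : EPresheaf V C) (a : C) : Hom.app (𝟙 F) a = 𝟙 (F.obj a) := rfl

@[simp]
lemma comp_app {F G H : EPresheaf V C} (f : F ⟶ G) (g : G ⟶ H) (a : C) :
    Hom.app (f ≫ g) a = Hom.app f a ≫ Hom.app g a := rfl

lemma naturality {F G : EPresheaf V C} (f : F ⟶ G) (a b : C) :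
    (a ⟶[V] b) ◁ Hom.app f b ≫ G.act a b = F.act a b ≫ Hom.app f a :=
  Hom.naturality f a b

/-- Evaluation at an object. -/
def eval (a : C) : EPresheaf V C ⥤ V where
  obj F := F.obj a
  map f := Hom.app f a

/-- Isomorphisms from componentwise isomorphisms. -/
def isoMk {F G : EPresheaf V C} (e : ∀ a, F.obj a ≅ G.obj a)
    (he : ∀ a b, (a ⟶[V] b) ◁ (e b).hom ≫ G.act a b = F.act a b ≫ (e a).hom) : F ≅ G where
  hom := Hom.mk (fun a => (e a).hom) he
  inv := Hom.mk (fun a => (e a).inv) (fun a b => by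
    rw [← cancel_mono (e a).hom, Category.assoc, Category.assoc, ← he,
      ← MonoidalCategory.whiskerLeft_comp_assoc]
    simp)
  hom_inv_id := by ext a; simp
  inv_hom_id := by ext a; simp

/-- The representable enriched presheaf `Hom_C(-, c)`. -/
def representable (V : Type u) [Category.{v} V] [MonoidalCategory V] {C : Type w}
    [EnrichedCategory V C] (c : C) : EPresheaf V C where
  obj a := a ⟶[V] c
  act a b := eComp V a b c
  id_act a := e_id_comp V a c
  comp_act a b c' := e_assoc V a b c' c

/-- Precomposition with the opposite of an enriched functor. -/
def comap {D : Type w} [EnrichedCategory V D] (Φ : EnrichedFunctor V C D) (F : EPresheaf V D) :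
    EPresheaf V C where
  obj a := F.obj (Φ.obj a)
  act a b := Φ.map a b ▷ F.obj (Φ.obj b) ≫ F.act (Φ.obj a) (Φ.obj b)
  id_act a := by
    rw [← MonoidalCategory.comp_whiskerRight_assoc, Φ.map_id]
    exact F.id_act _
  comp_act a b c := by
    rw [← MonoidalCategory.comp_whiskerRight_assoc, Φ.map_comp]
    have h := F.comp_act (Φ.obj a) (Φ.obj b) (Φ.obj c)
    rw [MonoidalCategory.whiskerLeft_comp, Category.assoc, whisker_exchange_assoc, ← h,
      MonoidalCategory.tensorHom_def']
    simp

/-- The tensor `F ⊗ X` of an enriched presheaf with an object of `V`, namely `a ↦ F a ⊗ X`. -/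
def tensor (F : EPresheaf V C) (X : V) : EPresheaf V C where
  obj a := F.obj a ⊗ X
  act a b := (α_ _ _ _).inv ≫ F.act a b ▷ X
  id_act a := by
    have h := congrArg (· ▷ X) (F.id_act a)
    simp only [MonoidalCategory.comp_whiskerRight, MonoidalCategory.id_whiskerRight] at h
    rw [← h]
    simp
  comp_act a b c := by
    have h := congrArg (· ▷ X) (F.comp_act a b c)
    simp only [MonoidalCategory.comp_whiskerRight] at h
    have p := MonoidalCategory.pentagon_inv (W := a ⟶[V] b) (X := b ⟶[V] c) (Y := F.obj c) (Z := X)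
    calc _ = (α_ (a ⟶[V] b) (b ⟶[V] c) (F.obj c ⊗ X)).inv ≫
          (α_ ((a ⟶[V] b) ⊗ (b ⟶[V] c)) (F.obj c) X).inv ≫
            (eComp V a b c ▷ F.obj c) ▷ X ≫ F.act a c ▷ X := by simp
      _ = (a ⟶[V] b) ◁ (α_ (b ⟶[V] c) (F.obj c) X).inv ≫
          (α_ (a ⟶[V] b) ((b ⟶[V] c) ⊗ F.obj c) X).inv ≫
            (α_ (a ⟶[V] b) (b ⟶[V] c) (F.obj c)).inv ▷ X ≫
              (eComp V a b c ▷ F.obj c) ▷ X ≫ F.act a c ▷ X := by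
        rw [← reassoc_of% p]
      _ = _ := by
        rw [h]
        simp

section Colimits

variable [HasColimits V] {J : Type v} [SmallCategory J] (F : J ⥤ EPresheaf V C)

/-- The colimit of the `F_j(a)`. -/
def colimitObj (a : C) : V := colimit (F ⋙ eval a)

/-- The coprojections into the colimit of the `F_j(a)`. -/
def colimitIncl (j : J) (a : C) : (F.obj j).obj a ⟶ colimitObj F a := colimit.ι (F ⋙ eval a) j

lemma colimitIncl_w {i j : J} (f : i ⟶ j) (a : C) :
    Hom.app (F.map f) a ≫ colimitIncl F j a = colimitIncl F i a :=
  colimit.w (F ⋙ eval a) f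

lemma colimitObj_hom_ext {b : C} {Z : V} {f g : colimitObj F b ⟶ Z}
    (h : ∀ j, colimitIncl F j b ≫ f = colimitIncl F j b ≫ g) : f = g :=
  colimit.hom_ext h

/-- The maps out of the pointwise colimit. -/
def colimitDesc (s : Cocone F) (a : C) : colimitObj F a ⟶ s.pt.obj a :=
  colimit.desc (F ⋙ eval a) ((eval a).mapCocone s)

lemma incl_colimitDesc (s : Cocone F) (a : C) (j : J) :
    colimitIncl F j a ≫ colimitDesc F s a = Hom.app (s.ι.app j) a :=
  colimit.ι_desc ((eval a).mapCocone s) j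

variable [∀ X : V, PreservesColimits (tensorLeft X)]

/-- `H ⊗ colim_j F_j(b)` is the colimit of the `H ⊗ F_j(b)`. -/
def isColimitTensor (H : V) (b : C) :
    IsColimit ((tensorLeft H).mapCocone (colimit.cocone (F ⋙ eval b))) :=
  isColimitOfPreserves (tensorLeft H) (colimit.isColimit (F ⋙ eval b))

lemma tensor_colimitObj_hom_ext {H : V} {b : C} {Z : V} {f g : H ⊗ colimitObj F b ⟶ Z}
    (h : ∀ j, H ◁ colimitIncl F j b ≫ f = H ◁ colimitIncl F j b ≫ g) : f = g :=
  (isColimitTensor F H b).hom_ext h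

/-- The action of `C` on the pointwise colimit. -/
def colimitAct (a b : C) : (a ⟶[V] b) ⊗ colimitObj F b ⟶ colimitObj F a :=
  (isColimitTensor F (a ⟶[V] b) b).desc
    { pt := colimitObj F a
      ι :=
        { app j := (F.obj j).act a b ≫ colimitIncl F j a
          naturality i j f := by
            have h : (a ⟶[V] b) ◁ Hom.app (F.map f) b ≫ (F.obj j).act a b ≫ colimitIncl F j a =
                (F.obj i).act a b ≫ colimitIncl F i a := by
              rw [reassoc_of% naturality (F.map f) a b, colimitIncl_w]
            exact h.trans (Category.comp_id _).symm } }

lemma incl_colimitAct (a b : C) (j : J) :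
    (a ⟶[V] b) ◁ colimitIncl F j b ≫ colimitAct F a b =
      (F.obj j).act a b ≫ colimitIncl F j a :=
  (isColimitTensor F (a ⟶[V] b) b).fac _ j

/-- Colimits of enriched presheaves are computed pointwise. -/
def colimitPresheaf : EPresheaf V C where
  obj a := colimitObj F a
  act := colimitAct F
  id_act a := by
    refine colimitObj_hom_ext F fun j => ?_
    have h := (F.obj j).id_act a
    have n := MonoidalCategory.leftUnitor_inv_naturality (colimitIncl F j a)
    rw [reassoc_of% n, whisker_exchange_assoc, incl_colimitAct, Category.comp_id]
    exact (by simpa using h =≫ colimitIncl F j a)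
  comp_act a b c := by
    have e : ∀ {Z : V} {f g : (a ⟶[V] b) ⊗ (b ⟶[V] c) ⊗ colimitObj F c ⟶ Z},
        (∀ j, (a ⟶[V] b) ◁ (b ⟶[V] c) ◁ colimitIncl F j c ≫ f =
          (a ⟶[V] b) ◁ (b ⟶[V] c) ◁ colimitIncl F j c ≫ g) → f = g := by
      intro Z f g h
      rw [← cancel_epi (α_ (a ⟶[V] b) (b ⟶[V] c) (colimitObj F c)).hom]
      refine tensor_colimitObj_hom_ext F fun j => ?_
      have h' := h j
      rw [← cancel_epi (α_ _ _ _).hom] at h'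
      simpa using h'
    refine e fun j => ?_
    rw [← MonoidalCategory.whiskerLeft_comp_assoc, incl_colimitAct,
      MonoidalCategory.whiskerLeft_comp_assoc, incl_colimitAct]
    have h := (F.obj j).comp_act a b c
    rw [← reassoc_of% h, ← incl_colimitAct, ← whisker_exchange_assoc]
    simp

/-- The colimit cocone. -/
def colimitCocone : Cocone F where
  pt := colimitPresheaf F
  ι :=
    { app j := Hom.mk (fun a => colimitIncl F j a) (fun a b => incl_colimitAct F a b j)
      naturality i j f := by
        ext a
        exact (colimitIncl_w F f a).trans (Category.comp_id _).symm }

/-- The colimit cocone is a colimit. -/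
def isColimitColimitCocone : IsColimit (colimitCocone F) where
  desc s := Hom.mk (colimitDesc F s) (fun a b => by
    refine tensor_colimitObj_hom_ext F fun j => ?_
    have h : (a ⟶[V] b) ◁ Hom.app (s.ι.app j) b ≫ s.pt.act a b =
        (F.obj j).act a b ≫ Hom.app (s.ι.app j) a := naturality (s.ι.app j) a b
    change (a ⟶[V] b) ◁ colimitIncl F j b ≫ (a ⟶[V] b) ◁ colimitDesc F s b ≫ s.pt.act a b =
      (a ⟶[V] b) ◁ colimitIncl F j b ≫ colimitAct F a b ≫ colimitDesc F s a
    rw [reassoc_of% incl_colimitAct F a b j, incl_colimitDesc, ← h, ← incl_colimitDesc,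
      MonoidalCategory.whiskerLeft_comp_assoc])
  fac s j := by
    ext a
    exact incl_colimitDesc F s a j
  uniq s m hm := by
    ext a
    refine colimitObj_hom_ext F fun j => ?_
    refine Eq.trans ?_ (incl_colimitDesc F s a j).symm
    exact congrArg (fun f => Hom.app f a) (hm j)

instance : HasColimitsOfSize.{v, v} (EPresheaf V C) :=
  ⟨fun _ _ => ⟨fun F => ⟨⟨colimitCocone F, isColimitColimitCocone F⟩⟩⟩⟩

end Colimits

end EPresheaf

end EnrichedPresheaves
/-! ## Categories tensored over `T`-spaces and their enrichment -/

section Tensored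

open MonoidalRightAction CartesianMonoidalCategory

variable {T : Type} [SmallCategory T]

/-- The representable `T`-space `F[θ, k]`, for `d = (θ, k)`. -/
abbrev rep (d : T × SimplexCategory) : Space T := yoneda.obj d

universe u

variable {M : Type u} [Category.{0} M] [MonoidalRightAction (Space T) M]

/-- In a category `M` tensored over `T`-spaces, the `T`-space of maps from `A` to `B`: at `(θ, k)`
it consists of the maps `A ⊗ F[θ, k] ⟶ B`. -/
def mapSpace (A B : M) : Space T where
  obj d := A ⊙ᵣ rep d.unop ⟶ B
  map f := ↾fun g => A ⊴ᵣ yoneda.map f.unop ≫ g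
  map_id d := by
    ext g
    simp
  map_comp f g := by
    ext h
    have e : yoneda.map (f ≫ g).unop = yoneda.map g.unop ≫ yoneda.map f.unop :=
      yoneda.map_comp g.unop f.unop
    exact (congrArg (fun k => A ⊴ᵣ k ≫ h) e).trans (by simp)

/-- Composition of elements of mapping spaces. -/
def mapSpaceComp {A B C : M} {d : T × SimplexCategory} (f : A ⊙ᵣ rep d ⟶ B) (g : B ⊙ᵣ rep d ⟶ C) :
    A ⊙ᵣ rep d ⟶ C :=
  A ⊴ᵣ lift (𝟙 (rep d)) (𝟙 (rep d)) ≫ (αᵣ A (rep d) (rep d)).hom ≫ f ⊵ᵣ rep d ≫ g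

/-- A map regarded as an element of the mapping space in any degree. -/
def constMap {A B : M} (d : T × SimplexCategory) (f : A ⟶ B) : A ⊙ᵣ rep d ⟶ B :=
  A ⊴ᵣ toUnit (rep d) ≫ (ρᵣ A).hom ≫ f

lemma diag_left (X : Space T) : lift (𝟙 X) (𝟙 X) ≫ toUnit X ▷ X ≫ (λ_ X).hom = 𝟙 X := by
  simp

lemma diag_right (X : Space T) : lift (𝟙 X) (𝟙 X) ≫ X ◁ toUnit X ≫ (ρ_ X).hom = 𝟙 X := by
  simp

lemma diag_assoc (X : Space T) :
    lift (𝟙 X) (𝟙 X) ≫ lift (𝟙 X) (𝟙 X) ▷ X =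
      lift (𝟙 X) (𝟙 X) ≫ X ◁ lift (𝟙 X) (𝟙 X) ≫ (α_ X X X).inv := by
  ext : 1
  · ext : 1 <;> simp
  · simp

lemma diag_naturality {X Y : Space T} (f : X ⟶ Y) :
    f ≫ lift (𝟙 Y) (𝟙 Y) = lift (𝟙 X) (𝟙 X) ≫ f ▷ X ≫ Y ◁ f := by
  ext : 1 <;> simp

lemma constMap_comp_left {A B C : M} (d : T × SimplexCategory) (f : A ⟶ B)
    (g : B ⊙ᵣ rep d ⟶ C) : mapSpaceComp (constMap d f) g = f ⊵ᵣ rep d ≫ g := by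
  have h := congrArg (fun k => A ⊴ᵣ k) (diag_left (rep d))
  simp only [actionHomRight_comp, actionHomRight_whiskerRight, actionHom_leftUnitor,
    actionHomRight_id, Category.assoc, Iso.inv_hom_id_assoc] at h
  simp only [mapSpaceComp, constMap, comp_actionHomLeft, Category.assoc]
  rw [reassoc_of% h]

lemma constMap_comp_right {A B C : M} (d : T × SimplexCategory) (f : A ⊙ᵣ rep d ⟶ B)
    (g : B ⟶ C) : mapSpaceComp f (constMap d g) = f ≫ g := by
  have h := congrArg (fun k => A ⊴ᵣ k) (diag_right (rep d))
  simp only [actionHomRight_comp, whiskerRight_actionHomLeft, actionHom_rightUnitor,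
    actionHomRight_id, Category.assoc, Iso.inv_hom_id_assoc] at h
  simp only [mapSpaceComp, constMap]
  rw [← action_exchange_assoc, ← actionUnitIso_hom_naturality_assoc, reassoc_of% h]

lemma mapSpaceComp_assoc {A B C D : M} (d : T × SimplexCategory) (f : A ⊙ᵣ rep d ⟶ B)
    (g : B ⊙ᵣ rep d ⟶ C) (h : C ⊙ᵣ rep d ⟶ D) :
    mapSpaceComp (mapSpaceComp f g) h = mapSpaceComp f (mapSpaceComp g h) := by
  have e := congrArg (fun k => A ⊴ᵣ k) (diag_assoc (rep d))
  have p := actionHom_associator (rep d) (rep d) (rep d) A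
  simp only [actionHomRight_comp] at e
  have r : A ⊴ᵣ lift (𝟙 (rep d)) (𝟙 (rep d)) ≫ (αᵣ A (rep d) (rep d)).hom ≫
      (A ⊴ᵣ lift (𝟙 (rep d)) (𝟙 (rep d))) ⊵ᵣ rep d ≫ (αᵣ A (rep d) (rep d)).hom ⊵ᵣ rep d =
      A ⊴ᵣ lift (𝟙 (rep d)) (𝟙 (rep d)) ≫ (αᵣ A (rep d) (rep d)).hom ≫
        (A ⊙ᵣ rep d) ⊴ᵣ lift (𝟙 (rep d)) (𝟙 (rep d)) ≫
          (αᵣ (A ⊙ᵣ rep d) (rep d) (rep d)).hom := by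
    have q : (αᵣ A (rep d) (rep d)).hom ≫ (A ⊴ᵣ lift (𝟙 (rep d)) (𝟙 (rep d))) ⊵ᵣ rep d =
        A ⊴ᵣ (lift (𝟙 (rep d)) (𝟙 (rep d)) ▷ rep d) ≫ (αᵣ A (rep d ⊗ rep d) (rep d)).hom := by
      simp
    rw [reassoc_of% q, reassoc_of% e, ← p, ← actionHomRight_comp_assoc A (α_ _ _ _).inv]
    simp
  simp only [mapSpaceComp, comp_actionHomLeft, Category.assoc]
  rw [← action_exchange_assoc, actionHomLeft_tensor, reassoc_of% r]
  simp only [Category.assoc, Iso.inv_hom_id_assoc]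

lemma mapSpaceComp_naturality {A B C : M} {d d' : T × SimplexCategory} (κ : d' ⟶ d)
    (f : A ⊙ᵣ rep d ⟶ B) (g : B ⊙ᵣ rep d ⟶ C) :
    A ⊴ᵣ yoneda.map κ ≫ mapSpaceComp f g =
      mapSpaceComp (A ⊴ᵣ yoneda.map κ ≫ f) (B ⊴ᵣ yoneda.map κ ≫ g) := by
  have e := congrArg (fun k => A ⊴ᵣ k) (diag_naturality (yoneda.map κ))
  simp only [actionHomRight_comp, actionHomRight_whiskerRight, whiskerRight_actionHomLeft,
    Category.assoc, Iso.inv_hom_id_assoc] at e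
  simp only [mapSpaceComp, comp_actionHomLeft, Category.assoc]
  rw [reassoc_of% e, Iso.inv_hom_id_assoc, action_exchange_assoc f (yoneda.map κ)]

lemma constMap_naturality {A B : M} {d d' : T × SimplexCategory} (κ : d' ⟶ d) (f : A ⟶ B) :
    A ⊴ᵣ yoneda.map κ ≫ constMap d f = constMap d' f := by
  simp only [constMap]
  rw [← actionHomRight_comp_assoc, toUnit_unique (yoneda.map κ ≫ toUnit (rep d)) (toUnit _)]

variable [HasTerminal T]

/-- The identification of `F[θ, k]` with the unit when `(θ, k)` is terminal. -/
def unitToRepPt : 𝟙_ (Space T) ⟶ rep (pt T) where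
  app d := ↾fun _ => toPt T d.unop
  naturality d d' f := by
    ext x
    exact toPt_unique _ _

/-- A category tensored over `T`-spaces is enriched over `T`-spaces through its mapping spaces. -/
abbrev enrichment (M : Type u) [Category.{0} M] [MonoidalRightAction (Space T) M] :
    EnrichedOrdinaryCategory (Space T) M where
  Hom := mapSpace
  id A :=
    { app d := ↾fun _ => constMap d.unop (𝟙 A)
      naturality d d' f := by
        ext x
        exact (constMap_naturality f.unop (𝟙 A)).symm }
  comp A B C :=
    { app d := ↾fun x => mapSpaceComp (d := d.unop) x.1 x.2
      naturality d d' f := by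
        ext x
        exact (mapSpaceComp_naturality f.unop x.1 x.2).symm }
  id_comp A B := by
    ext d x
    exact (constMap_comp_left d.unop (𝟙 A) x).trans
      ((congrArg (· ≫ x) (id_actionHomLeft _ _)).trans (Category.id_comp x))
  comp_id A B := by
    ext d x
    exact (constMap_comp_right d.unop x (𝟙 B)).trans (Category.comp_id x)
  assoc A B C D := by
    ext d x
    exact mapSpaceComp_assoc _ _ _ _
  homEquiv {A B} :=
    { toFun f :=
        { app d := ↾fun _ => constMap d.unop f
          naturality d d' κ := by
            ext x
            exact (constMap_naturality κ.unop f).symm }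
      invFun g := (ρᵣ[Space T] A).inv ≫ A ⊴ᵣ unitToRepPt ≫ g.app (op (pt T)) PUnit.unit
      left_inv f := by
        have h : unitToRepPt ≫ toUnit (rep (pt T)) = 𝟙 _ := toUnit_unique _ _
        change (ρᵣ[Space T] A).inv ≫ A ⊴ᵣ unitToRepPt ≫ A ⊴ᵣ toUnit (rep (pt T)) ≫
          (ρᵣ A).hom ≫ f = f
        rw [← actionHomRight_comp_assoc, h]
        simp
      right_inv g := by
        ext d x
        have h : toUnit (rep d.unop) ≫ unitToRepPt = yoneda.map (toPt T d.unop) := by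
          ext d' y
          exact toPt_unique _ _
        have n : A ⊴ᵣ yoneda.map (toPt T d.unop) ≫ g.app (op (pt T)) PUnit.unit = g.app d x :=
          (NatTrans.naturality_apply g (toPt T d.unop).op PUnit.unit).symm
        refine Eq.trans ?_ n
        have w (q : A ⊙ᵣ rep (pt T) ⟶ B) : A ⊴ᵣ toUnit (rep d.unop) ≫ (ρᵣ A).hom ≫
            (ρᵣ[Space T] A).inv ≫ A ⊴ᵣ unitToRepPt ≫ q = A ⊴ᵣ yoneda.map (toPt T d.unop) ≫ q := by
          rw [Iso.hom_inv_id_assoc, ← actionHomRight_comp_assoc, h]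
        exact w _ }
  homEquiv_id A := rfl
  homEquiv_comp f g := by
    ext d x
    have h : constMap d.unop (f ≫ g) = mapSpaceComp (constMap d.unop f) (constMap d.unop g) := by
      rw [constMap_comp_right]
      simp only [constMap, Category.assoc]
    exact h

end Tensored
section Actions

open MonoidalRightAction CartesianMonoidalCategory

namespace EPresheaf

universe v u w

variable {V : Type u} [Category.{v} V] [MonoidalCategory V] {C : Type w} [EnrichedCategory V C]

/-- Functoriality of `F ⊗ X` in `X`. -/
def tensorMapRight (F : EPresheaf V C) {X X' : V} (g : X ⟶ X') : F.tensor X ⟶ F.tensor X' :=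
  Hom.mk (fun a => F.obj a ◁ g) (fun a b => by
    simp only [tensor, Category.assoc, ← whisker_exchange]
    simp)

/-- Functoriality of `F ⊗ X` in `F`. -/
def tensorMapLeft {F G : EPresheaf V C} (f : F ⟶ G) (X : V) : F.tensor X ⟶ G.tensor X :=
  Hom.mk (fun a => Hom.app f a ▷ X) (fun a b => by
    have h := congrArg (· ▷ X) (naturality f a b)
    simp only [MonoidalCategory.comp_whiskerRight] at h
    simp only [tensor, Category.assoc, ← h]
    simp)

/-- `F ⊗ (X × Y) ≅ (F ⊗ X) ⊗ Y`. -/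
def tensorAssoc (F : EPresheaf V C) (X Y : V) : F.tensor (X ⊗ Y) ≅ (F.tensor X).tensor Y :=
  isoMk (fun a => (α_ (F.obj a) X Y).symm) (fun a b => by simp [tensor])

/-- `F ⊗ 1 ≅ F`. -/
def tensorUnit (F : EPresheaf V C) : F.tensor (𝟙_ V) ≅ F :=
  isoMk (fun a => ρ_ (F.obj a)) (fun a b => by simp [tensor])

/-- The tensor `F ⊗ X` of an enriched presheaf `F` with an object `X` makes the category of enriched
presheaves tensored over `V`. -/
instance : MonoidalRightAction V (EPresheaf V C) where
  actionObj F X := F.tensor X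
  actionHomRight F X X' g := F.tensorMapRight g
  actionHomLeft f X := tensorMapLeft f X
  actionAssocIso := tensorAssoc
  actionUnitIso := tensorUnit
  actionHom_def f g := rfl
  actionHomRight_id X F := by
    ext a
    exact MonoidalCategory.whiskerLeft_id (F.obj a) X
  id_actionHomLeft X F := by
    ext a
    exact MonoidalCategory.id_whiskerRight (F.obj a) X
  actionHom_comp f₁ f₂ g₁ g₂ := by
    ext a
    have h := MonoidalCategory.tensorHom_comp_tensorHom (Hom.app f₁ a) g₁ (Hom.app f₂ a) g₂
    simp only [MonoidalCategory.tensorHom_def] at h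
    exact h.symm
  actionAssocIso_hom_naturality {F G X Y Z W} f g h := by
    ext a
    have e := MonoidalCategory.associator_inv_naturality (Hom.app f a) g h
    simp only [MonoidalCategory.tensorHom_def] at e ⊢
    exact e
  actionUnitIso_hom_naturality f := by
    ext a
    exact (MonoidalCategory.rightUnitor_naturality (Hom.app f a)).symm
  actionHomRight_whiskerRight {X X'} f Y F := by
    ext a
    change F.obj a ◁ f ▷ Y = (α_ (F.obj a) X Y).inv ≫ (F.obj a ◁ f) ▷ Y ≫ (α_ (F.obj a) X' Y).hom
    simp
  whiskerRight_actionHomLeft X {Y Y'} f F := by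
    ext a
    change F.obj a ◁ X ◁ f = (α_ (F.obj a) X Y).inv ≫ (F.obj a ⊗ X) ◁ f ≫ (α_ (F.obj a) X Y').hom
    simp
  actionHom_associator X Y Z F := by
    ext a
    change F.obj a ◁ (α_ X Y Z).hom ≫ (α_ (F.obj a) X (Y ⊗ Z)).inv ≫ (α_ (F.obj a ⊗ X) Y Z).inv =
      (α_ (F.obj a) (X ⊗ Y) Z).inv ≫ (α_ (F.obj a) X Y).inv ▷ Z
    simp
  actionHom_leftUnitor X F := by
    ext a
    change F.obj a ◁ (λ_ X).hom = (α_ (F.obj a) (𝟙_ V) X).inv ≫ (ρ_ (F.obj a)).hom ▷ X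
    simp
  actionHom_rightUnitor X F := by
    ext a
    change F.obj a ◁ (ρ_ X).hom = (α_ (F.obj a) X (𝟙_ V)).inv ≫ (ρ_ (F.obj a ⊗ X)).hom
    simp

end EPresheaf

variable {T : Type} [SmallCategory T]

/-- The tensor `p ⊗ X : P × X ⟶ P ⟶ S` of an object `p : P ⟶ S` of the slice category with a
`T`-space `X`. -/
abbrev sliceTensor {S : SimplicialSpace T} (p : Over S) (X : Space T) : Over S :=
  Over.mk (fst p.left ((constSpace T).obj X) ≫ p.hom)

/-- Equality of maps in the slice category can be checked on elements. -/
lemma over_ext {S : SimplicialSpace T} {p q : Over S} {f g : p ⟶ q}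
    (h : ∀ d (x : p.left.obj d), f.left.app d x = g.left.app d x) : f = g := by
  ext d x
  exact h d x

/-- The tensor `p ⊗ X` makes the slice category tensored over `T`-spaces. -/
instance {S : SimplicialSpace T} : MonoidalRightAction (Space T) (Over S) where
  actionObj := sliceTensor
  actionHomRight p X X' g := Over.homMk (p.left ◁ (constSpace T).map g) (by simp)
  actionHomLeft {p q} f X := Over.homMk (f.left ▷ (constSpace T).obj X) (by simp)
  actionAssocIso p X Y := Over.isoMk (α_ p.left ((constSpace T).obj X) ((constSpace T).obj Y)).symm
    (by
      ext d x
      rfl)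
  actionUnitIso p := Over.isoMk (ρ_ p.left) (by
      ext d x
      rfl)
  actionHom_def f g := rfl
  actionHomRight_id X F := over_ext fun _ _ => rfl
  id_actionHomLeft X F := over_ext fun _ _ => rfl
  actionHom_comp f₁ f₂ g₁ g₂ := over_ext fun _ _ => rfl
  actionAssocIso_hom_naturality f g h := over_ext fun _ _ => rfl
  actionUnitIso_hom_naturality f := over_ext fun _ _ => rfl
  actionHomRight_whiskerRight f X F := over_ext fun _ _ => rfl
  whiskerRight_actionHomLeft X {X' X''} f F := over_ext fun _ _ => rfl
  actionHom_associator X Y Z F := over_ext fun _ _ => rfl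
  actionHom_leftUnitor X F := over_ext fun _ _ => rfl
  actionHom_rightUnitor X F := over_ext fun _ _ => rfl

end Actions
/-! ## Straightening and unstraightening -/

section Straightening

/-- The map `[m+1] ⟶ [m'+1]` extending `α : [m] ⟶ [m']` by `m+1 ↦ m'+1`. -/
def coneMap {m m' : SimplexCategory} (α : m ⟶ m') :
    SimplexCategory.mk (m.len + 1) ⟶ SimplexCategory.mk (m'.len + 1) :=
  SimplexCategory.Hom.mk
    { toFun := Fin.lastCases (Fin.last _) (fun i => (α.toOrderHom i).castSucc)
      monotone' := by
        intro i j h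
        induction j using Fin.lastCases with
        | last => simpa using Fin.le_last _
        | cast j =>
          induction i using Fin.lastCases with
          | last => exact absurd (lt_of_lt_of_le (Fin.castSucc_lt_last j) h) (lt_irrefl _)
          | cast i => simpa using α.toOrderHom.monotone (Fin.castSucc_le_castSucc_iff.1 h) }

/-- The face map `d^{m+1} : [m] ⟶ [m+1]`, i.e. the inclusion of the first `m+1` elements. -/
def coneIncl (m : SimplexCategory) : m ⟶ SimplexCategory.mk (m.len + 1) :=
  SimplexCategory.Hom.mk Fin.castSuccOrderEmb.toOrderHom

lemma coneMap_last {m m' : SimplexCategory} (α : m ⟶ m') :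
    (coneMap α).toOrderHom (Fin.last (m.len + 1)) = Fin.last (m'.len + 1) :=
  Fin.lastCases_last (motive := fun _ => Fin (m'.len + 1 + 1))
    (cast := fun i => (α.toOrderHom i).castSucc)

lemma coneMap_castSucc {m m' : SimplexCategory} (α : m ⟶ m') (i : Fin (m.len + 1)) :
    (coneMap α).toOrderHom i.castSucc = (α.toOrderHom i).castSucc :=
  Fin.lastCases_castSucc (motive := fun _ => Fin (m'.len + 1 + 1)) (last := Fin.last _)
    (cast := fun i => (α.toOrderHom i).castSucc) i

lemma coneMap_ext {m n : SimplexCategory} {f g : SimplexCategory.mk (m.len + 1) ⟶ n}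
    (h : f.toOrderHom (Fin.last (m.len + 1)) = g.toOrderHom (Fin.last (m.len + 1)))
    (h' : ∀ i : Fin (m.len + 1), f.toOrderHom i.castSucc = g.toOrderHom i.castSucc) : f = g := by
  apply SimplexCategory.Hom.ext
  refine OrderHom.ext _ _ (funext fun i => ?_)
  induction i using Fin.lastCases with
  | last => exact h
  | cast i => exact h' i

lemma coneMap_id (m : SimplexCategory) : coneMap (𝟙 m) = 𝟙 _ :=
  coneMap_ext (coneMap_last _) (coneMap_castSucc _)

lemma coneMap_comp {m m' m'' : SimplexCategory} (α : m ⟶ m') (β : m' ⟶ m'') :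
    coneMap (α ≫ β) = coneMap α ≫ coneMap β := by
  refine coneMap_ext ?_ fun i => ?_
  · exact (coneMap_last _).trans ((coneMap_last β).symm.trans
      (congrArg (coneMap β).toOrderHom (coneMap_last α).symm))
  · exact (coneMap_castSucc _ _).trans ((coneMap_castSucc β _).symm.trans
      (congrArg (coneMap β).toOrderHom (coneMap_castSucc α i).symm))

lemma coneIncl_naturality {m m' : SimplexCategory} (α : m ⟶ m') :
    coneIncl m ≫ coneMap α = α ≫ coneIncl m' := by
  apply SimplexCategory.Hom.ext
  exact OrderHom.ext _ _ (funext fun i => coneMap_castSucc α i)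

variable {T : Type} [SmallCategory T]

/-- `(m, θ, k) ↦ (m+1, θ, k)`. -/
def coneFunctor :
    SimplexCategory × (T × SimplexCategory) ⥤ SimplexCategory × (T × SimplexCategory) where
  obj c := (SimplexCategory.mk (c.1.len + 1), c.2)
  map f := Prod.mkHom (coneMap f.1) f.2
  map_id _ := Prod.hom_ext (coneMap_id _) rfl
  map_comp _ _ := Prod.hom_ext (coneMap_comp _ _) rfl

/-- The natural map `(m, θ, k) ⟶ (m+1, θ, k)` given by `d^{m+1}`. -/
def toCone : 𝟭 (SimplexCategory × (T × SimplexCategory)) ⟶ coneFunctor where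
  app c := Prod.mkHom (coneIncl c.1) (𝟙 c.2)
  naturality _ _ _ := Prod.hom_ext (coneIncl_naturality _).symm
    ((Category.comp_id _).trans (Category.id_comp _).symm)

variable [HasTerminal T]

namespace Coh

lemma onObj_id {W : PCat T} (a : Coh W) : onObj (𝟙 W) a = a := rfl

lemma mapHom_congr {W Z : PCat T} {u v : W ⟶ Z} (h : u = v) {a b : Coh W} {a' b' : Coh Z}
    (ha : onObj u a = a') (hb : onObj u b = b') (ha' : onObj v a = a') (hb' : onObj v b = b') :
    mapHom u ha hb = mapHom v ha' hb' := by
  subst h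
  rfl

lemma onObj_comp {W Z Y : PCat T} (u : W ⟶ Z) (v : Z ⟶ Y) (a : Coh W) :
    onObj (u ≫ v) a = onObj v (onObj u a) := rfl

/-- The object of `𝔠 W` corresponding to a vertex of `W_{-,θ,k}`. -/
def ofVertex (W : PCat T) (d : (T × SimplexCategory)ᵒᵖ)
    (x : ((row T d).obj W.obj).obj (op (SimplexCategory.mk 0))) : Coh W :=
  (Equiv.ofBijective _ (label_bijective W d)).symm x

lemma label_ofVertex (W : PCat T) (d : (T × SimplexCategory)ᵒᵖ)
    (x : ((row T d).obj W.obj).obj (op (SimplexCategory.mk 0))) :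
    label W d (ofVertex W d x) = x :=
  (Equiv.ofBijective _ (label_bijective W d)).apply_symm_apply x

end Coh

/-- `L F[m, θ, k]`, for `c = (m, θ, k)`. -/
abbrev cell : SimplexCategory × (T × SimplexCategory) ⥤ PCat T := yoneda ⋙ toPCat T

/-- The `i`-th vertex of `F[m, θ, k]`, in degree `(θ, k)`. -/
def repVertex (c : SimplexCategory × (T × SimplexCategory)) (i : Fin (c.1.len + 1)) :
    (yoneda.obj c).obj (op (SimplexCategory.mk 0, c.2)) :=
  Prod.mkHom (SimplexCategory.const (SimplexCategory.mk 0) c.1 i) (𝟙 c.2)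

/-- The object `i` of `𝔠 (L F[m, θ, k])`, for `0 ≤ i ≤ m`. -/
def cellVertex (c : SimplexCategory × (T × SimplexCategory)) (i : Fin (c.1.len + 1)) :
    Coh (cell.obj c) :=
  Coh.ofVertex _ (op c.2) (((toPCatAdj T).unit.app (yoneda.obj c)).app
    (op (SimplexCategory.mk 0, c.2)) (repVertex c i))

lemma onObj_cellVertex {c c' : SimplexCategory × (T × SimplexCategory)} (f : c ⟶ c')
    (i : Fin (c.1.len + 1)) :
    Coh.onObj (cell.map f) (cellVertex c i) = cellVertex c' (f.1.toOrderHom i) := by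
  apply (Coh.label_bijective _ (op c.2)).1
  refine (Coh.label_onObj _ _ _).symm.trans (Eq.trans ?_ (Coh.rowMap_label _
    (show op c'.2 ⟶ op c.2 from f.2.op) _))
  refine (congrArg _ (Coh.label_ofVertex _ _ _)).trans (Eq.trans ?_
    (congrArg _ (Coh.label_ofVertex _ _ _)).symm)
  have e : yoneda.map f ≫ (toPCatAdj T).unit.app (yoneda.obj c') =
      (toPCatAdj T).unit.app (yoneda.obj c) ≫ (cell.map f).hom :=
    (toPCatAdj T).unit.naturality (yoneda.map f)
  have h₁ := congrArg (fun (t : yoneda.obj c ⟶ (cell.obj c').obj) =>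
    t.app (op (SimplexCategory.mk 0, c.2)) (repVertex c i)) e
  have h₂ := NatTrans.naturality_apply ((toPCatAdj T).unit.app (yoneda.obj c'))
    (Prod.mkHom (𝟙 (SimplexCategory.mk 0)) f.2).op (repVertex c' (f.1.toOrderHom i))
  have k : (yoneda.map f).app (op (SimplexCategory.mk 0, c.2)) (repVertex c i) =
      (yoneda.obj c').map (Prod.mkHom (𝟙 (SimplexCategory.mk 0)) f.2).op
        (repVertex c' (f.1.toOrderHom i)) :=
    Prod.hom_ext (SimplexCategory.Hom.ext _ _ (OrderHom.ext _ _ (funext fun _ => rfl)))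
      ((Category.id_comp f.2).trans (Category.comp_id f.2).symm)
  exact h₁.symm.trans ((congrArg (((toPCatAdj T).unit.app (yoneda.obj c')).app
    (op (SimplexCategory.mk 0, c.2))) k).trans h₂)

variable (W : PCat T)

/-- The category of elements of `W`. Its objects are given by an object `c = σ.left = (m, θ, k)` and
a map `σ.hom : F[m, θ, k] ⟶ W`. -/
abbrev Elements := CostructuredArrow yoneda W.obj

variable {W}

/-- The map `σ : L F[m, θ, k] ⟶ W` of precategories corresponding to `σ : F[m, θ, k] ⟶ W`. -/
def transpose (σ : Elements W) : cell.obj σ.left ⟶ W :=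
  ((toPCatAdj T).homEquiv _ _).symm σ.hom

lemma transpose_naturality {σ τ : Elements W} (f : σ ⟶ τ) :
    cell.map f.left ≫ transpose τ = transpose σ := by
  have h : yoneda.map f.left ≫ τ.hom = σ.hom := CostructuredArrow.w f
  rw [transpose, transpose, ← h]
  exact ((toPCatAdj T).homEquiv_naturality_left_symm _ _).symm

/-- The pushout `W_σ` of `L F[m+1, θ, k] ⟵ L F[m, θ, k] ⟶ W` in precategories. -/
def conePushout (σ : Elements W) : PCat T :=
  pushout (cell.map (toCone.app σ.left)) (transpose σ)

/-- The map `σ' : L F[m+1, θ, k] ⟶ W_σ`. -/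
def fromCell (σ : Elements W) : cell.obj (coneFunctor.obj σ.left) ⟶ conePushout σ :=
  pushout.inl _ _

/-- The map `ι_σ : W ⟶ W_σ`. -/
def fromBase (σ : Elements W) : W ⟶ conePushout σ :=
  pushout.inr _ _

/-- The object `⊤` of `𝔠 W_σ`, the image of `m+1` under `σ'`. -/
def coneTop (σ : Elements W) : Coh (conePushout σ) :=
  Coh.onObj (fromCell σ) (cellVertex _ (Fin.last _))

/-- Functoriality of `W_σ` in `σ`. -/
def conePushoutMap {σ τ : Elements W} (f : σ ⟶ τ) : conePushout σ ⟶ conePushout τ :=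
  pushout.desc (cell.map (coneFunctor.map f.left) ≫ fromCell τ) (fromBase τ) (by
    have h := toCone.naturality f.left
    rw [← Category.assoc, ← Functor.map_comp, ← h, Functor.map_comp, Category.assoc,
      ← transpose_naturality f, Category.assoc]
    exact congrArg (cell.map f.left ≫ ·) pushout.condition)

lemma fromBase_map {σ τ : Elements W} (f : σ ⟶ τ) :
    fromBase σ ≫ conePushoutMap f = fromBase τ :=
  pushout.inr_desc _ _ _

lemma fromCell_map {σ τ : Elements W} (f : σ ⟶ τ) :
    fromCell σ ≫ conePushoutMap f = cell.map (coneFunctor.map f.left) ≫ fromCell τ :=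
  pushout.inl_desc _ _ _

lemma conePushoutMap_id (σ : Elements W) : conePushoutMap (𝟙 σ) = 𝟙 _ := by
  apply pushout.hom_ext
  · refine (fromCell_map (𝟙 σ)).trans ?_
    have h : coneFunctor.map (CommaMorphism.left (𝟙 σ)) = 𝟙 _ := coneFunctor.map_id _
    have h' : cell.map (coneFunctor.map (CommaMorphism.left (𝟙 σ))) = 𝟙 _ :=
      (congrArg cell.map h).trans (cell.map_id _)
    rw [h', Category.id_comp]
    exact (Category.comp_id _).symm
  · exact (fromBase_map (𝟙 σ)).trans (Category.comp_id _).symm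

lemma conePushoutMap_comp {σ τ υ : Elements W} (f : σ ⟶ τ) (g : τ ⟶ υ) :
    conePushoutMap (f ≫ g) = conePushoutMap f ≫ conePushoutMap g := by
  apply pushout.hom_ext
  · change fromCell σ ≫ _ = fromCell σ ≫ _
    have h : coneFunctor.map (CommaMorphism.left (f ≫ g)) =
      coneFunctor.map f.left ≫ coneFunctor.map g.left := coneFunctor.map_comp _ _
    rw [fromCell_map, h, Functor.map_comp, Category.assoc, ← fromCell_map g, ← Category.assoc,
      ← fromCell_map f, Category.assoc]
  · change fromBase σ ≫ _ = fromBase σ ≫ _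
    rw [fromBase_map, ← Category.assoc, fromBase_map, fromBase_map]

lemma onObj_coneTop {σ τ : Elements W} (f : σ ⟶ τ) :
    Coh.onObj (conePushoutMap f) (coneTop σ) = coneTop τ := by
  rw [coneTop, ← Coh.onObj_comp, fromCell_map, Coh.onObj_comp, onObj_cellVertex]
  exact congrArg (fun i => Coh.onObj (fromCell τ) (cellVertex _ i)) (coneMap_last f.left.1)

lemma onObj_fromBase {σ τ : Elements W} (f : σ ⟶ τ) (a : Coh W) :
    Coh.onObj (conePushoutMap f) (Coh.onObj (fromBase σ) a) = Coh.onObj (fromBase τ) a := by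
  rw [← Coh.onObj_comp, fromBase_map]

lemma stElements_naturality {σ τ : Elements W} (f : σ ⟶ τ) (a b : Coh W) :
    (a ⟶[Space T] b) ◁ Coh.mapHom (conePushoutMap f) (onObj_fromBase f b) (onObj_coneTop f) ≫
        Coh.mapHom (fromBase τ) rfl rfl ▷ _ ≫ eComp (Space T) _ _ (coneTop τ) =
      (Coh.mapHom (fromBase σ) rfl rfl ▷ _ ≫ eComp (Space T) _ _ (coneTop σ)) ≫
        Coh.mapHom (conePushoutMap f) (onObj_fromBase f a) (onObj_coneTop f) := by
  rw [Category.assoc, Coh.mapHom_eComp _ (onObj_fromBase f a) (onObj_fromBase f b)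
    (onObj_coneTop f), MonoidalCategory.tensorHom_def, Category.assoc,
    ← MonoidalCategory.comp_whiskerRight_assoc,
    ← Coh.mapHom_comp (fromBase σ) (conePushoutMap f) rfl rfl (onObj_fromBase f a)
      (onObj_fromBase f b) (onObj_fromBase f a) (onObj_fromBase f b), whisker_exchange_assoc]
  congr 2
  exact (Coh.mapHom_congr (fromBase_map f).symm _ _ _ _)

variable (W) in
/-- The functor `σ ↦ St_W(σ)` from the category of elements of `W` to enriched presheaves on `𝔠 W`,
where `St_W(σ) = Hom_{𝔠 W_σ}((𝔠 ι_σ)(-), ⊤)`. -/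
def stElements : Elements W ⥤ EPresheaf (Space T) (Coh W) where
  obj σ := (EPresheaf.representable (Space T) (coneTop σ)).comap (Coh.functor (fromBase σ))
  map {σ τ} f := EPresheaf.Hom.mk
    (fun a => Coh.mapHom (conePushoutMap f) (onObj_fromBase f a) (onObj_coneTop f))
    (fun a b => stElements_naturality f a b)
  map_id σ := by
    ext a : 1
    exact (Coh.mapHom_congr (conePushoutMap_id σ) (onObj_fromBase (𝟙 σ) a) (onObj_coneTop (𝟙 σ))
      (Coh.onObj_id _) (Coh.onObj_id _)).trans (Coh.mapHom_id _ _)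
  map_comp f g := by
    ext a : 1
    have h₁ := conePushoutMap_comp f g ▸ onObj_fromBase (f ≫ g) a
    have h₂ := conePushoutMap_comp f g ▸ onObj_coneTop (f ≫ g)
    exact (Coh.mapHom_congr (conePushoutMap_comp f g) (onObj_fromBase (f ≫ g) a)
      (onObj_coneTop (f ≫ g)) h₁ h₂).trans (Coh.mapHom_comp _ _ (onObj_fromBase f a)
        (onObj_coneTop f) (onObj_fromBase g a) (onObj_coneTop g) h₁ h₂)

variable (W) in
/-- The straightening functor `St_W`: the left Kan extension of `σ ↦ St_W(σ)` along the Yoneda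
embedding, under the equivalence between the slice category over `W` and presheaves on the category
of elements of `W`. -/
def St : Over W.obj ⥤ EPresheaf (Space T) (Coh W) :=
  (overEquivPresheafCostructuredArrow W.obj).functor ⋙
    uliftYoneda.{0}.leftKanExtension (stElements W)

variable (W) in
/-- The unstraightening functor `Un_W`. -/
def Un : EPresheaf (Space T) (Coh W) ⥤ Over W.obj :=
  Presheaf.restrictedULiftYoneda.{0} (stElements W) ⋙
    (overEquivPresheafCostructuredArrow W.obj).inverse

variable (W) in
/-- The straightening-unstraightening adjunction `St_W ⊣ Un_W`. -/
def stUnAdj : St W ⊣ Un W :=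
  (overEquivPresheafCostructuredArrow W.obj).toAdjunction.comp
    (Presheaf.uliftYonedaAdjunction _ (uliftYoneda.{0}.leftKanExtensionUnit (stElements W)))

end Straightening
/-! ## Enriched adjunctions -/

section EnrichedAdjunctions

universe v u v₁ u₁ v₂ u₂

variable (V : Type u) [Category.{v} V] [MonoidalCategory V] {C : Type u₁} [Category.{v₁} C]
  [EnrichedOrdinaryCategory V C] {D : Type u₂} [Category.{v₂} D] [EnrichedOrdinaryCategory V D]

/-- The structure of an enriched functor on an ordinary functor between the underlying categories of
enriched categories. -/
structure Enrichment (F : C ⥤ D) where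
  map (x y : C) : (x ⟶[V] y) ⟶ (F.obj x ⟶[V] F.obj y)
  map_id (x : C) : eId V x ≫ map x x = eId V (F.obj x)
  map_comp (x y z : C) :
    eComp V x y z ≫ map x z = (map x y ⊗ₘ map y z) ≫ eComp V (F.obj x) (F.obj y) (F.obj z)
  eHomEquiv_map {x y : C} (f : x ⟶ y) : eHomEquiv V (F.map f) = eHomEquiv V f ≫ map x y

/-- The structure of an enriched adjunction on an adjunction between the underlying categories of
enriched categories: both functors are enriched, and the bijections between hom sets underlie
isomorphisms `Map(L c, d) ≅ Map(c, R d)` of hom objects that are enriched natural in `c` and `d`. -/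
structure EnrichedAdjunction {L : C ⥤ D} {R : D ⥤ C} (adj : L ⊣ R) where
  left : Enrichment V L
  right : Enrichment V R
  homIso (c : C) (d : D) : (L.obj c ⟶[V] d) ≅ (c ⟶[V] R.obj d)
  naturality_left (c c' : C) (d : D) :
    left.map c c' ▷ (L.obj c' ⟶[V] d) ≫ eComp V (L.obj c) (L.obj c') d ≫ (homIso c d).hom =
      (c ⟶[V] c') ◁ (homIso c' d).hom ≫ eComp V c c' (R.obj d)
  naturality_right (c : C) (d d' : D) :
    eComp V (L.obj c) d d' ≫ (homIso c d').hom =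
      ((homIso c d).hom ⊗ₘ right.map d d') ≫ eComp V c (R.obj d) (R.obj d')
  homEquiv_eq {c : C} {d : D} (f : L.obj c ⟶ d) :
    eHomEquiv V (adj.homEquiv c d f) = eHomEquiv V f ≫ (homIso c d).hom

end EnrichedAdjunctions

section

variable {T : Type} [SmallCategory T] [HasTerminal T]

/-- The slice category, enriched over `T`-spaces by its tensors: `Map(p, q)_{θ,k}` is the set of maps
`p ⊗ F[θ, k] ⟶ q`. -/
instance (S : SimplicialSpace T) : EnrichedOrdinaryCategory (Space T) (Over S) :=
  enrichment (Over S)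

/-- The category of enriched presheaves, enriched over `T`-spaces by its tensors: `Map(F, G)_{θ,k}` is
the set of maps `F ⊗ F[θ, k] ⟶ G`. -/
instance (W : PCat T) : EnrichedOrdinaryCategory (Space T) (EPresheaf (Space T) (Coh W)) :=
  enrichment (EPresheaf (Space T) (Coh W))

end

end Straightening

end

open Straightening

open scoped MonoidalRightAction

/-!
The straightening functor is compared with an explicit one, for which compatibility with tensors is
evident, and compatibility with tensors then formally makes the adjunction enriched.

For `p : P ⟶ W`, an element of `St_W(p)(a)` in degree `d = (θ, k)` should be a morphism from `a` to
the cone point of the cone on `P`. Such a morphism is a composite of a morphism `f` of `𝔠 W` from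
`a` to a vertex `i` of some `m`-simplex `x` of `P`, and of an arrow `u` of `c^h Δ[m+1]` from `i` to
`m+1`, evaluated on the cone on `x`. The explicit straightening `explicitSt W` is the quotient of
the set `ConeGen` of such triples `(x, f, u)` by two relations: arrows of `c^h Δ[m]` may be moved
between `f` and `u`, and `x` may be restricted along `[m] ⟶ [m']`. The simplex `x` always has the
same degree `d` as the result, and no relation changes this degree. Hence a triple for `p ⊗ X` is a
triple for `p` together with an element of `X` in degree `d`, which the relations preserve: this is
`explicitStTensor`.

It remains to identify `explicitSt W` with `St W`. For an element `σ` of `W`, evaluating triples in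
`𝔠 W_σ` gives a map `fromExplicit` from the explicit straightening of the representable at `σ` to
`St_W(σ)`. Its inverse comes from an enriched functor from `𝔠 W_σ` to the collage of the explicit
straightening, the category `𝔠 W` with one object `⊤` adjoined such that the morphisms to `⊤` are
the elements of the presheaf. Enriched functors out of `𝔠 Z` correspond to maps from `Z` to the
homotopy coherent nerve (`ofNerve`, `toNerve_ofNerve`, `map_eq_of_toNerve_eq`), so by the universal
property of the pushout `W_σ` it suffices to give an `(m+1)`-simplex of the nerve of the collage;
this is `coneSimplex`. The same universal property shows that the composite on `𝔠 W_σ` is the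
identity (`toNerve_toCollage_comp_fromCollage`), and the other composite is computed on generators
(`map_toCollage_coneGenHom`). Since the relations between triples already hold over representables
(`ConeGen.Rel.exists_map`), `explicitSt W` is the left Kan extension of its restriction to the
category of elements (`isColimitExplicitStCocone`), as is `St W`; so both agree (`stIso`).

Finally, for an adjunction `L ⊣ R` with `L (A ⊗ X) ≅ L A ⊗ X`, coherently in `X`, an element of
`Map(L A, B)` in degree `d` is a map `L A ⊗ F[d] ≅ L (A ⊗ F[d]) ⟶ B`, that is, a map
`A ⊗ F[d] ⟶ R B`; this gives `enrichedAdjunction`.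
-/

noncomputable section

namespace Straightening

/-! ### Simplices of the hom objects of `c^h Δ[m]` -/

namespace PathSimplex

variable {m m' m'' k k' : SimplexCategory}

/-- A `k`-simplex of the nerve of the poset of paths, as a functor. -/
abbrev toFunctor {i j : Fin (m.len + 1)} (p : PathSimplex m k i j) :
    Fin (k.len + 1) ⥤ (SimplicialThickening.mk i ⟶ SimplicialThickening.mk j) := p

/-- The subset of `{i, …, j}` at the vertex `t` of a simplex of `Hom_{c^h Δ[m]}(i, j)`. -/
def support {i j : Fin (m.len + 1)} (p : PathSimplex m k i j) (t : Fin (k.len + 1)) :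
    Set (Fin (m.len + 1)) :=
  (p.toFunctor.obj t).I

/-- Homs of `c^h Δ[m]` are nerves of posets, so simplices are determined by their vertices. -/
lemma ext_support {i j : Fin (m.len + 1)} {p q : PathSimplex m k i j}
    (h : ∀ t, p.support t = q.support t) : p = q := by
  have h' : ∀ t, p.toFunctor.obj t = q.toFunctor.obj t := fun t =>
    SimplicialThickening.Path.ext (h t)
  refine CategoryTheory.Functor.ext (F := p.toFunctor) (G := q.toFunctor) h' ?_
  intro s t f
  exact InducedCategory.hom_ext (Subsingleton.elim _ _)

lemma support_comp {i j l : Fin (m.len + 1)} (p : PathSimplex m k i j) (q : PathSimplex m k j l)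
    (t : Fin (k.len + 1)) : (p.comp q).support t = p.support t ∪ q.support t := rfl

lemma support_id (i : Fin (m.len + 1)) (t : Fin (k.len + 1)) :
    (PathSimplex.id k i).support t = {i} := rfl

lemma support_push (α : m ⟶ m') {i j : Fin (m.len + 1)} (p : PathSimplex m k i j)
    (t : Fin (k.len + 1)) : (p.push α).support t = α.toOrderHom '' p.support t := rfl

lemma src_mem {i j : Fin (m.len + 1)} (p : PathSimplex m k i j) (t : Fin (k.len + 1)) :
    i ∈ p.support t := (p.toFunctor.obj t).left

lemma tgt_mem {i j : Fin (m.len + 1)} (p : PathSimplex m k i j) (t : Fin (k.len + 1)) :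
    j ∈ p.support t := (p.toFunctor.obj t).right

lemma le_tgt {i j : Fin (m.len + 1)} (p : PathSimplex m k i j) {t : Fin (k.len + 1)}
    {x : Fin (m.len + 1)} (h : x ∈ p.support t) : x ≤ j := (p.toFunctor.obj t).le_right _ h

lemma src_le_tgt {i j : Fin (m.len + 1)} (p : PathSimplex m k i j) : i ≤ j :=
  p.le_tgt (p.src_mem 0)

/-- Transport along equalities of endpoints. -/
def cast {i j i' j' : Fin (m.len + 1)} (hi : i = i') (hj : j = j') (p : PathSimplex m k i j) :
    PathSimplex m k i' j' :=
  hi ▸ hj ▸ p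

lemma support_cast {i j i' j' : Fin (m.len + 1)} (hi : i = i') (hj : j = j')
    (p : PathSimplex m k i j) (t : Fin (k.len + 1)) :
    (p.cast hi hj).support t = p.support t := by
  subst hi hj
  rfl

lemma push_comp (α : m ⟶ m') {i j l : Fin (m.len + 1)} (p : PathSimplex m k i j)
    (q : PathSimplex m k j l) : (p.comp q).push α = (p.push α).comp (q.push α) :=
  ext_support fun t => by
    simp only [support_push, support_comp, Set.image_union]

lemma push_id (α : m ⟶ m') (i : Fin (m.len + 1)) :
    (PathSimplex.id k i).push α = PathSimplex.id k (α.toOrderHom i) :=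
  ext_support fun t => by
    simp only [support_push, support_id, Set.image_singleton]

lemma push_push (α : m ⟶ m') (β : m' ⟶ m'') {i j : Fin (m.len + 1)} (p : PathSimplex m k i j) :
    (p.push α).push β = p.push (α ≫ β) :=
  ext_support fun t => by
    simp only [support_push]
    exact Set.image_image _ _ _

lemma push_self {i j : Fin (m.len + 1)} (p : PathSimplex m k i j) :
    p.push (𝟙 m) = p :=
  ext_support fun _ => Set.image_id _

/-- Only the values up to the target of a path matter when it is pushed forward. -/
lemma push_push_eq_cast {α : m ⟶ m'} {β : m' ⟶ m} {i j : Fin (m.len + 1)}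
    (p : PathSimplex m k i j) (h : ∀ x ≤ j, β.toOrderHom (α.toOrderHom x) = x) :
    (p.push α).push β = p.cast (h i p.src_le_tgt).symm (h j le_rfl).symm := by
  refine ext_support fun t => ?_
  rw [support_push, support_push, support_cast]
  ext x
  constructor
  · rintro ⟨_, ⟨y, hy, rfl⟩, rfl⟩
    rwa [h y (p.le_tgt hy)]
  · intro hx
    exact ⟨_, ⟨x, hx, rfl⟩, h x (p.le_tgt hx)⟩

lemma restrict_cast (κ : k' ⟶ k) {i j i' j' : Fin (m.len + 1)} (hi : i = i') (hj : j = j')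
    (p : PathSimplex m k i j) : (p.cast hi hj).restrict κ = (p.restrict κ).cast hi hj := by
  subst hi hj
  rfl

lemma eq_id {i : Fin (m.len + 1)} (p : PathSimplex m k i i) : p = PathSimplex.id k i :=
  ext_support fun t => by
    ext x
    refine ⟨fun hx => le_antisymm (p.le_tgt hx) ((p.toFunctor.obj t).left_le x hx), ?_⟩
    rintro rfl
    exact p.src_mem t

lemma comp_id {i j : Fin (m.len + 1)} (p : PathSimplex m k i j) :
    p.comp (PathSimplex.id k j) = p :=
  ext_support fun t => by
    rw [support_comp, support_id, Set.union_singleton, Set.insert_eq_of_mem (p.tgt_mem t)]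

end PathSimplex

/-! ### Elements of hom objects -/

section Elements

variable {T : Type} [SmallCategory T] {D : Type} [EnrichedCategory (Space T) D]

/-- The set of morphisms from `x` to `y` in degree `d` of a category enriched over `T`-spaces. -/
abbrev HomAt (d : (T × SimplexCategory)ᵒᵖ) (x y : D) : Type := (x ⟶[Space T] y).obj d

namespace HomAt

variable {d d' : (T × SimplexCategory)ᵒᵖ} {x y z w : D}

variable (d) in
/-- The identity in degree `d`. -/
def id (x : D) : HomAt d x x := (eId (Space T) x).app d PUnit.unit

/-- Composition in degree `d`. -/
def comp (f : HomAt d x y) (g : HomAt d y z) : HomAt d x z := (eComp (Space T) x y z).app d (f, g)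

lemma id_comp (f : HomAt d x y) : (id d x).comp f = f :=
  congrArg (fun (t : (x ⟶[Space T] y) ⟶ (x ⟶[Space T] y)) => t.app d f) (e_id_comp (Space T) x y)

lemma comp_id (f : HomAt d x y) : f.comp (id d y) = f :=
  congrArg (fun (t : (x ⟶[Space T] y) ⟶ (x ⟶[Space T] y)) => t.app d f) (e_comp_id (Space T) x y)

lemma assoc (f : HomAt d x y) (g : HomAt d y z) (h : HomAt d z w) :
    (f.comp g).comp h = f.comp (g.comp h) :=
  congrArg (fun (t : (x ⟶[Space T] y) ⊗ (y ⟶[Space T] z) ⊗ (z ⟶[Space T] w) ⟶ _) =>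
    t.app d (f, (g, h))) (e_assoc (Space T) x y z w)

/-- Restriction to another degree. -/
def restrict (g : d ⟶ d') (f : HomAt d x y) : HomAt d' x y := (x ⟶[Space T] y).map g f

lemma restrict_id (g : d ⟶ d') : (id d x).restrict g = id d' x :=
  (NatTrans.naturality_apply (eId (Space T) x) g PUnit.unit).symm

lemma restrict_comp (κ : d ⟶ d') (f : HomAt d x y) (g : HomAt d y z) :
    (f.comp g).restrict κ = (f.restrict κ).comp (g.restrict κ) :=
  (NatTrans.naturality_apply (eComp (Space T) x y z) κ
    ((f, g) : HomAt d x y × HomAt d y z)).symm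

lemma restrict_restrict {d'' : (T × SimplexCategory)ᵒᵖ} (κ : d ⟶ d') (κ' : d' ⟶ d'')
    (f : HomAt d x y) : (f.restrict κ).restrict κ' = f.restrict (κ ≫ κ') :=
  (Functor.map_comp_apply (x ⟶[Space T] y) κ κ' f).symm

lemma restrict_self (f : HomAt d x y) : f.restrict (𝟙 d) = f :=
  Functor.map_id_apply (x ⟶[Space T] y) d f

/-- Transport along equalities of source and target, which the vertices of simplices satisfy only
propositionally. -/
def cast {x' y' : D} (hx : x = x') (hy : y = y') (f : HomAt d x y) : HomAt d x' y' := hx ▸ hy ▸ f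

@[simp]
lemma cast_cast {x' y' x'' y'' : D} (hx : x = x') (hy : y = y') (hx' : x' = x'') (hy' : y' = y'')
    (f : HomAt d x y) : (f.cast hx hy).cast hx' hy' = f.cast (hx.trans hx') (hy.trans hy') := by
  subst hx hy hx' hy'
  rfl

lemma cast_comp {x' y' z' : D} (hx : x = x') (hy : y = y') (hz : z = z') (f : HomAt d x y)
    (g : HomAt d y z) : (f.comp g).cast hx hz = (f.cast hx hy).comp (g.cast hy hz) := by
  subst hx hy hz
  rfl

lemma cast_id {x' : D} (hx : x = x') : (id d x).cast hx hx = id d x' := by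
  subst hx
  rfl

lemma cast_comp_cast {y' : D} (h : y = y') (f : HomAt d x y) (g : HomAt d y z) :
    (f.cast rfl h).comp (g.cast h rfl) = f.comp g := by
  subst h
  rfl

lemma cast_comp_eq {y' : D} (h : y = y') (f : HomAt d x y) (g : HomAt d y' z) :
    (f.cast rfl h).comp g = f.comp (g.cast h.symm rfl) := by
  subst h
  rfl

lemma comp_id_cast {y' : D} (h : y = y') (f : HomAt d x y) :
    f.comp ((id d y).cast rfl h) = f.cast rfl h := by
  subst h
  exact comp_id f

lemma id_cast_comp {x' : D} (h : x' = x) (f : HomAt d x y) :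
    ((id d x').cast rfl h).comp f = f.cast h.symm rfl := by
  subst h
  exact id_comp f

lemma restrict_cast {x' y' : D} (hx : x = x') (hy : y = y') (κ : d ⟶ d') (f : HomAt d x y) :
    (f.cast hx hy).restrict κ = (f.restrict κ).cast hx hy := by
  subst hx hy
  rfl

variable {E : Type} [EnrichedCategory (Space T) E]

/-- The action of an enriched functor on morphisms in degree `d`. -/
def map (Φ : EnrichedFunctor (Space T) D E) (f : HomAt d x y) : HomAt d (Φ.obj x) (Φ.obj y) :=
  (Φ.map x y).app d f

lemma map_id (Φ : EnrichedFunctor (Space T) D E) : (id d x).map Φ = id d (Φ.obj x) :=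
  congrArg (fun (t : 𝟙_ (Space T) ⟶ _) => t.app d PUnit.unit) (Φ.map_id x)

lemma map_comp (Φ : EnrichedFunctor (Space T) D E) (f : HomAt d x y) (g : HomAt d y z) :
    (f.comp g).map Φ = (f.map Φ).comp (g.map Φ) :=
  congrArg (fun (t : (x ⟶[Space T] y) ⊗ (y ⟶[Space T] z) ⟶ _) => t.app d (f, g))
    (Φ.map_comp x y z)

lemma map_restrict (Φ : EnrichedFunctor (Space T) D E) (κ : d ⟶ d') (f : HomAt d x y) :
    (f.restrict κ).map Φ = (f.map Φ).restrict κ :=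
  NatTrans.naturality_apply (Φ.map x y) κ f

lemma map_cast (Φ : EnrichedFunctor (Space T) D E) {x' y' : D} (hx : x = x') (hy : y = y')
    (f : HomAt d x y) :
    (f.cast hx hy).map Φ = (f.map Φ).cast (congrArg Φ.obj hx) (congrArg Φ.obj hy) := by
  subst hx hy
  rfl

lemma cast_map_comp (Φ : EnrichedFunctor (Space T) D E) {x' y' z' : E} (hx : Φ.obj x = x')
    (hy : Φ.obj y = y') (hz : Φ.obj z = z') (f : HomAt d x y) (g : HomAt d y z) :
    ((f.comp g).map Φ).cast hx hz = ((f.map Φ).cast hx hy).comp ((g.map Φ).cast hy hz) := by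
  rw [map_comp, cast_comp]

end HomAt

/-- Enriched functors from their effect on elements of hom objects. -/
def functorOfHomAt {E : Type} [EnrichedCategory (Space T) E] (obj : D → E)
    (map : ∀ {d : (T × SimplexCategory)ᵒᵖ} {x y : D}, HomAt d x y → HomAt d (obj x) (obj y))
    (map_restrict : ∀ {d d' : (T × SimplexCategory)ᵒᵖ} (κ : d ⟶ d') {x y : D} (f : HomAt d x y),
      map (f.restrict κ) = (map f).restrict κ)
    (map_id : ∀ (d : (T × SimplexCategory)ᵒᵖ) (x : D),
      map (HomAt.id d x) = HomAt.id d (obj x))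
    (map_comp : ∀ {d : (T × SimplexCategory)ᵒᵖ} {x y z : D} (f : HomAt d x y) (g : HomAt d y z),
      map (f.comp g) = (map f).comp (map g)) :
    EnrichedFunctor (Space T) D E where
  obj := obj
  map x y :=
    { app d := ↾map
      naturality d d' κ := by
        ext f
        exact map_restrict κ f }
  map_id x := by
    ext d f
    exact map_id d x
  map_comp x y z := by
    ext d f
    exact map_comp f.1 f.2

end Elements

/-! ### The homotopy coherent nerve -/

section Nerve

variable {T : Type} [SmallCategory T]

/-- An `(m, d)`-simplex of the homotopy coherent nerve of a category `D` enriched over `T`-spaces: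
objects `x_0, …, x_m` of `D` and maps `Hom_{c^h Δ[m]}(i, j) × F[d] ⟶ D(x_i, x_j)`, compatible with
identities and composition. -/
structure NerveSimplex (D : Type) [EnrichedCategory (Space T) D] (m : SimplexCategory)
    (d : T × SimplexCategory) where
  obj : Fin (m.len + 1) → D
  map {i j : Fin (m.len + 1)} {e : T × SimplexCategory} (f : e ⟶ d) (u : PathSimplex m e.2 i j) :
    HomAt (op e) (obj i) (obj j)
  map_restrict {i j : Fin (m.len + 1)} {e e' : T × SimplexCategory} (g : e' ⟶ e) (f : e ⟶ d)
    (u : PathSimplex m e.2 i j) : map (g ≫ f) (u.restrict g.2) = (map f u).restrict g.op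
  map_id {e : T × SimplexCategory} (f : e ⟶ d) (i : Fin (m.len + 1)) :
    map f (PathSimplex.id e.2 i) = HomAt.id (op e) (obj i)
  map_comp {i j l : Fin (m.len + 1)} {e : T × SimplexCategory} (f : e ⟶ d)
    (u : PathSimplex m e.2 i j) (v : PathSimplex m e.2 j l) :
    map f (u.comp v) = (map f u).comp (map f v)

namespace NerveSimplex

variable {D E : Type} [EnrichedCategory (Space T) D] [EnrichedCategory (Space T) E]
  {m m' m'' : SimplexCategory} {d d' d'' : T × SimplexCategory}

lemma ext_cast {s t : NerveSimplex D m d} (h : ∀ i, s.obj i = t.obj i)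
    (h' : ∀ {i j : Fin (m.len + 1)} {e : T × SimplexCategory} (f : e ⟶ d)
      (u : PathSimplex m e.2 i j), (s.map f u).cast (h i) (h j) = t.map f u) : s = t := by
  obtain ⟨so, sm, _, _, _⟩ := s
  obtain ⟨t₀, tm, _, _, _⟩ := t
  obtain rfl : so = t₀ := funext h
  congr
  funext i j e f u
  exact h' f u

/-- The dependence of `map` on the simplex, up to transport. -/
lemma map_congr {s t : NerveSimplex D m d} (h : s = t) {i j : Fin (m.len + 1)}
    {e : T × SimplexCategory} (f : e ⟶ d) (u : PathSimplex m e.2 i j) {x y : D}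
    (hx : s.obj i = x) (hy : s.obj j = y) :
    (s.map f u).cast hx hy = (t.map f u).cast (h ▸ hx) (h ▸ hy) := by
  subst h
  rfl

/-- Restriction along maps in both variables. -/
def restrict (s : NerveSimplex D m d) (α : m' ⟶ m) (g : d' ⟶ d) : NerveSimplex D m' d' where
  obj i := s.obj (α.toOrderHom i)
  map f u := s.map (f ≫ g) (u.push α)
  map_restrict g' f u := by
    rw [← s.map_restrict, PathSimplex.restrict_push, Category.assoc]
  map_id f i := by rw [PathSimplex.push_id, s.map_id]
  map_comp f u v := by rw [PathSimplex.push_comp, s.map_comp]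

/-- The image of a simplex under an enriched functor. -/
def mapFunctor (Φ : EnrichedFunctor (Space T) D E) (s : NerveSimplex D m d) :
    NerveSimplex E m d where
  obj i := Φ.obj (s.obj i)
  map f u := (s.map f u).map Φ
  map_restrict g f u := by rw [s.map_restrict, HomAt.map_restrict]
  map_id f i := by rw [s.map_id, HomAt.map_id]
  map_comp f u v := by rw [s.map_comp, HomAt.map_comp]

/-- The degenerate simplex at an object. -/
def const (x : D) : NerveSimplex D m d where
  obj _ := x
  map _ _ := HomAt.id _ x
  map_restrict g _ _ := (HomAt.restrict_id g.op).symm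
  map_id _ _ := rfl
  map_comp _ _ _ := (HomAt.id_comp _).symm

/-- All `0`-simplices are degenerate, so that the nerve is discrete in dimension `0`. -/
lemma eq_const (s : NerveSimplex D (SimplexCategory.mk 0) d) : s = const (s.obj 0) := by
  have h0 (i : Fin ((SimplexCategory.mk 0).len + 1)) : i = 0 := Subsingleton.elim (α := Fin 1) i 0
  refine ext_cast (fun i => by rw [h0 i]; rfl) ?_
  intro i j e f u
  obtain rfl := h0 i
  obtain rfl := h0 j
  rw [u.eq_id, s.map_id]
  rfl

end NerveSimplex

variable (T) (D : Type) [EnrichedCategory (Space T) D]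

/-- The homotopy coherent nerve of a category enriched over `T`-spaces, as a `(Δ × T)`-space. -/
def nerveSpace : SimplicialSpace T where
  obj c := NerveSimplex D c.unop.1 c.unop.2
  map f := ↾fun s => s.restrict f.unop.1 f.unop.2
  map_id c := by
    ext s
    refine NerveSimplex.ext_cast (fun _ => rfl) fun f u => ?_
    exact congrArg₂ (fun f u => s.map f u) (Category.comp_id f) u.push_self
  map_comp f g := by
    ext s
    refine NerveSimplex.ext_cast (fun _ => rfl) fun f' u => ?_
    exact congrArg₂ (fun f u => s.map f u) (Category.assoc _ _ _).symm (u.push_push _ _).symm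

variable [HasTerminal T]

/-- The homotopy coherent nerve of a category enriched over `T`-spaces, as a precategory. -/
def enrichedNerve : PCat T where
  obj := nerveSpace T D
  property := by
    rw [isPrecat_iff]
    intro d d' f
    constructor
    · intro s t h
      have h' : NerveSimplex.obj s 0 = NerveSimplex.obj t 0 :=
        congrArg (fun s : NerveSimplex D (SimplexCategory.mk 0) d'.unop => s.obj 0) h
      exact (NerveSimplex.eq_const s).trans
        ((congrArg NerveSimplex.const h').trans (NerveSimplex.eq_const t).symm)
    · intro s
      refine ⟨NerveSimplex.const (NerveSimplex.obj s 0), ?_⟩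
      exact (NerveSimplex.eq_const s).symm

variable {T D} {E : Type} [EnrichedCategory (Space T) E]

/-- Functoriality of the homotopy coherent nerve. -/
def enrichedNerveMap (Φ : EnrichedFunctor (Space T) D E) :
    enrichedNerve T D ⟶ enrichedNerve T E where
  hom := { app c := ↾fun s => NerveSimplex.mapFunctor Φ s }

end Nerve

/-! ### Generators of the hom objects of `𝔠 Z` -/

section Generators

variable {T : Type} [SmallCategory T]

/-- The set of `(m, d)`-simplices of a `(Δ × T)`-space. -/
abbrev Simplex (Z : SimplicialSpace T) (m : SimplexCategory) (d : T × SimplexCategory) : Type :=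
  Z.obj (op (m, d))

namespace Simplex

variable {Z Y : SimplicialSpace T} {m m' m'' : SimplexCategory} {d d' d'' : T × SimplexCategory}

/-- Restriction of simplices along maps in both variables. -/
def res (s : Simplex Z m d) (α : m' ⟶ m) (g : d' ⟶ d) : Simplex Z m' d' :=
  Z.map (Prod.mkHom α g).op s

lemma res_res (s : Simplex Z m d) (α : m' ⟶ m) (g : d' ⟶ d) (α' : m'' ⟶ m') (g' : d'' ⟶ d') :
    (s.res α g).res α' g' = s.res (α' ≫ α) (g' ≫ g) :=
  (Functor.map_comp_apply Z (Prod.mkHom α g).op (Prod.mkHom α' g').op s).symm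

lemma res_self (s : Simplex Z m d) : s.res (𝟙 m) (𝟙 d) = s := Functor.map_id_apply Z _ s

/-- The image of a simplex. -/
def map (u : Z ⟶ Y) (s : Simplex Z m d) : Simplex Y m d := u.app _ s

lemma map_res (u : Z ⟶ Y) (s : Simplex Z m d) (α : m' ⟶ m) (g : d' ⟶ d) :
    (s.res α g).map u = (s.map u).res α g :=
  NatTrans.naturality_apply u _ s

end Simplex

variable [HasTerminal T]

namespace Coh

variable {Z Y : PCat T} {m m' m'' : SimplexCategory} {d d' d'' : T × SimplexCategory}

/-- The `i`-th vertex of a simplex, as an object of `𝔠 Z`. -/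
def vtx (s : Simplex Z.obj m d) (i : Fin (m.len + 1)) : Coh Z :=
  ofVertex Z (op d) (vertex ((row T (op d)).obj Z.obj) s i)

/-- Since `Z_0` is discrete, `vtx s i = a` says that the `i`-th vertex of `s` is constant at `a`. -/
lemma vertex_eq_label_iff (s : Simplex Z.obj m d) (i : Fin (m.len + 1)) (a : Coh Z) :
    vertex ((row T (op d)).obj Z.obj) s i = label Z (op d) a ↔ vtx s i = a := by
  constructor
  · intro h
    exact (label_bijective Z (op d)).1 ((label_ofVertex _ _ _).trans h)
  · rintro rfl
    exact (label_ofVertex _ _ _).symm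

lemma vertex_eq_label (s : Simplex Z.obj m d) (i : Fin (m.len + 1)) :
    vertex ((row T (op d)).obj Z.obj) s i = label Z (op d) (vtx s i) :=
  (vertex_eq_label_iff s i _).2 rfl

lemma vtx_res (s : Simplex Z.obj m d) (α : m' ⟶ m) (g : d' ⟶ d) (i : Fin (m'.len + 1)) :
    vtx (s.res α g) i = vtx s (α.toOrderHom i) := by
  rw [← vertex_eq_label_iff]
  refine Eq.trans ?_ (rowMap_label Z (show op d ⟶ op d' from g.op) (vtx s (α.toOrderHom i)))
  rw [← vertex_eq_label]
  refine (Simplex.res_res s α g (SimplexCategory.const _ _ i) (𝟙 d')).trans (Eq.trans ?_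
    (Simplex.res_res s (SimplexCategory.const _ _ (α.toOrderHom i)) (𝟙 d) (𝟙 _) g).symm)
  rw [Category.id_comp, Category.comp_id, Category.id_comp]
  rfl

lemma onObj_vtx (u : Z ⟶ Y) (s : Simplex Z.obj m d) (i : Fin (m.len + 1)) :
    onObj u (vtx s i) = vtx (s.map u.hom) i := by
  symm
  rw [← vertex_eq_label_iff, ← label_onObj, ← vertex_eq_label]
  exact (Simplex.map_res u.hom s _ _).symm

lemma vtx_res_id (s : Simplex Z.obj m d) (g : d' ⟶ d) (i : Fin (m.len + 1)) :
    vtx (s.res (𝟙 m) g) i = vtx s i :=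
  vtx_res s (𝟙 m) g i

lemma vtx_obj (a : Coh Z) :
    vtx (m := SimplexCategory.mk 0) (d := pt T) (show Simplex Z.obj _ _ from a) 0 = a := by
  rw [← vertex_eq_label_iff]
  have h : Prod.mkHom (SimplexCategory.const (SimplexCategory.mk 0) (SimplexCategory.mk 0) 0)
      (𝟙 (pt T)) = Prod.mkHom (𝟙 (SimplexCategory.mk 0)) (toPt T (pt T)) :=
    Prod.hom_ext (SimplexCategory.isTerminalZero.hom_ext _ _) (toPt_unique _ _)
  exact congrArg (fun t => Simplex.res (show Simplex Z.obj _ _ from a) t.1 t.2) h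

/-- The morphism of `𝔠 Z` given by a simplex of `Z` and an arrow of `c^h Δ[m]`. -/
def gen (s : Simplex Z.obj m d) {i j : Fin (m.len + 1)} (u : PathSimplex m d.2 i j) :
    HomAt (op d) (vtx s i) (vtx s j) :=
  Quot.mk _ (.of ⟨m, s, i, j, u, vertex_eq_label s i, vertex_eq_label s j⟩)

lemma mk_of (s : Simplex Z.obj m d) {i j : Fin (m.len + 1)} (u : PathSimplex m d.2 i j)
    {a b : Coh Z} (ha : vertex ((row T (op d)).obj Z.obj) s i = label Z (op d) a)
    (hb : vertex ((row T (op d)).obj Z.obj) s j = label Z (op d) b) :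
    (show HomAt (op d) a b from Quot.mk _ (.of ⟨m, s, i, j, u, ha, hb⟩)) =
      (gen s u).cast ((vertex_eq_label_iff s i a).1 ha) ((vertex_eq_label_iff s j b).1 hb) := by
  obtain rfl := (vertex_eq_label_iff s i a).1 ha
  obtain rfl := (vertex_eq_label_iff s j b).1 hb
  rfl

lemma gen_congr {s t : Simplex Z.obj m d} (h : s = t) {i j : Fin (m.len + 1)}
    (u : PathSimplex m d.2 i j) :
    gen s u = (gen t u).cast (by rw [h]) (by rw [h]) := by
  subst h
  rfl

lemma gen_cast (s : Simplex Z.obj m d) {i j i' j' : Fin (m.len + 1)} (hi : i = i') (hj : j = j')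
    (u : PathSimplex m d.2 i j) :
    gen s (u.cast hi hj) = (gen s u).cast (by rw [hi]) (by rw [hj]) := by
  subst hi hj
  rfl

lemma gen_comp (s : Simplex Z.obj m d) {i j l : Fin (m.len + 1)} (u : PathSimplex m d.2 i j)
    (v : PathSimplex m d.2 j l) : gen s (u.comp v) = (gen s u).comp (gen s v) :=
  (Quot.sound (.gen_comp _ _ _ _ _ _ _ _ _ _)).symm

lemma gen_id (s : Simplex Z.obj m d) (i : Fin (m.len + 1)) :
    gen s (PathSimplex.id d.2 i) = HomAt.id (op d) (vtx s i) :=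
  Quot.sound (.gen_id _ _ _ _)

lemma gen_res (s : Simplex Z.obj m d) (α : m' ⟶ m) {i j : Fin (m'.len + 1)}
    (u : PathSimplex m' d.2 i j) :
    gen (s.res α (𝟙 d)) u =
      (gen s (u.push α)).cast (vtx_res s α (𝟙 d) i).symm (vtx_res s α (𝟙 d) j).symm := by
  have h := Quot.sound (Word.Rel.gen_push (ℓ := label Z (op d)) m' m α s i j u
    (vertex_eq_label (s.res α (𝟙 d)) i) (vertex_eq_label (s.res α (𝟙 d)) j)
    ((vertex_eq_label_iff s _ _).2 (vtx_res s α (𝟙 d) i).symm)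
    ((vertex_eq_label_iff s _ _).2 (vtx_res s α (𝟙 d) j).symm))
  exact h.symm.trans (mk_of _ _ _ _)

lemma restrict_gen (s : Simplex Z.obj m d) (g : d' ⟶ d) {i j : Fin (m.len + 1)}
    (u : PathSimplex m d.2 i j) :
    (gen s u).restrict g.op =
      (gen (s.res (𝟙 m) g) (u.restrict g.2)).cast (vtx_res_id s g i) (vtx_res_id s g j) :=
  mk_of (s.res (𝟙 m) g) (u.restrict g.2) _ _

lemma map_gen (v : Z ⟶ Y) (s : Simplex Z.obj m d) {i j : Fin (m.len + 1)}
    (u : PathSimplex m d.2 i j) :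
    (gen s u).map (functor v) =
      (gen (s.map v.hom) u).cast (onObj_vtx v s i).symm (onObj_vtx v s j).symm :=
  mk_of (s.map v.hom) u _ _

/-- Morphisms of `𝔠 Z` are composites of generators. -/
lemma hom_induction {P : ∀ {a b : Coh Z}, HomAt (op d) a b → Prop}
    (of : ∀ {m : SimplexCategory} (s : Simplex Z.obj m d) {i j : Fin (m.len + 1)}
      (u : PathSimplex m d.2 i j), P (gen s u))
    (id : ∀ a : Coh Z, P (HomAt.id (op d) a))
    (comp : ∀ {a b c : Coh Z} (f : HomAt (op d) a b) (g : HomAt (op d) b c), P f → P g →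
      P (f.comp g)) {a b : Coh Z} (f : HomAt (op d) a b) : P f := by
  induction f using Quot.ind with
  | mk w =>
    induction w with
    | of g =>
      obtain ⟨m, s, i, j, u, ha, hb⟩ := g
      obtain rfl := (vertex_eq_label_iff s i _).1 ha
      obtain rfl := (vertex_eq_label_iff s j _).1 hb
      exact of s u
    | id a => exact id a
    | comp v w hv hw => exact comp _ _ hv hw

end Coh

end Generators

/-! ### The adjunction between `𝔠` and the nerve -/

section Transposition

variable {T : Type} [SmallCategory T] [HasTerminal T] {Z Y : PCat T}
  {D E : Type} [EnrichedCategory (Space T) D] [EnrichedCategory (Space T) E]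

open Coh

lemma gen_res_restrict {m m' : SimplexCategory} {d d' d'' : T × SimplexCategory}
    (s : Simplex Z.obj m d) (α : m' ⟶ m) (g : d' ⟶ d) (f : d'' ⟶ d') {i j : Fin (m'.len + 1)}
    (u : PathSimplex m' d''.2 i j) (h h') :
    gen ((s.res α g).res (𝟙 m') f) u = (gen (s.res (𝟙 m) (f ≫ g)) (u.push α)).cast h h' := by
  have e : (s.res α g).res (𝟙 m') f = (s.res (𝟙 m) (f ≫ g)).res α (𝟙 d'') := by
    rw [Simplex.res_res, Simplex.res_res]
    simp
  rw [gen_congr e, gen_res, HomAt.cast_cast]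

/-- The simplex of the nerve corresponding to a simplex of `Z` and an enriched functor
`𝔠 Z ⟶ D`. -/
def toNerveSimplex (Φ : EnrichedFunctor (Space T) (Coh Z) D) {m : SimplexCategory}
    {d : T × SimplexCategory} (s : Simplex Z.obj m d) : NerveSimplex D m d where
  obj i := Φ.obj (vtx s i)
  map {i j e} f u := ((gen (s.res (𝟙 _) f) u).map Φ).cast
    (congrArg Φ.obj (vtx_res_id s f i)) (congrArg Φ.obj (vtx_res_id s f j))
  map_restrict {i j e e'} g f u := by
    rw [HomAt.restrict_cast, ← HomAt.map_restrict, restrict_gen, HomAt.map_cast,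
      HomAt.cast_cast]
    have h : (s.res (𝟙 m) f).res (𝟙 m) g = s.res (𝟙 m) (g ≫ f) := by
      rw [Simplex.res_res, Category.id_comp]
    rw [gen_congr h, HomAt.map_cast, HomAt.cast_cast]
  map_id f i := by
    rw [gen_id, HomAt.map_id, HomAt.cast_id]
  map_comp f u v := by
    rw [gen_comp, HomAt.map_comp, HomAt.cast_comp]

lemma toNerveSimplex_res (Φ : EnrichedFunctor (Space T) (Coh Z) D) {m m' : SimplexCategory}
    {d d' : T × SimplexCategory} (s : Simplex Z.obj m d) (α : m' ⟶ m) (g : d' ⟶ d) :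
    toNerveSimplex Φ (s.res α g) = (toNerveSimplex Φ s).restrict α g := by
  refine NerveSimplex.ext_cast (fun i => congrArg Φ.obj (vtx_res s α g i)) ?_
  intro i j e f u
  change HomAt.cast _ _ (HomAt.cast _ _ _) = HomAt.cast _ _ _
  rw [gen_res_restrict s α g f u ((vtx_res_id s (f ≫ g) _).trans
      ((vtx_res_id _ f _).trans (vtx_res s α g _)).symm)
      ((vtx_res_id s (f ≫ g) _).trans ((vtx_res_id _ f _).trans (vtx_res s α g _)).symm),
    HomAt.map_cast]
  exact (HomAt.cast_cast _ _ _ _ _).trans (HomAt.cast_cast _ _ _ _ _)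

lemma toNerveSimplex_map (Φ : EnrichedFunctor (Space T) (Coh Z) D) {m : SimplexCategory}
    {d : T × SimplexCategory} (s : Simplex Z.obj m d) {i j : Fin (m.len + 1)}
    (u : PathSimplex m d.2 i j) :
    (toNerveSimplex Φ s).map (𝟙 d) u = (gen s u).map Φ := by
  change HomAt.cast _ _ _ = _
  rw [gen_congr s.res_self, HomAt.map_cast]
  exact HomAt.cast_cast _ _ _ _ _

/-- The map `Z ⟶ N D` corresponding to an enriched functor `𝔠 Z ⟶ D`. -/
def toNerve (Φ : EnrichedFunctor (Space T) (Coh Z) D) : Z ⟶ enrichedNerve T D where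
  hom :=
    { app c := ↾fun s => toNerveSimplex (m := c.unop.1) (d := c.unop.2) Φ s
      naturality c c' f := by
        ext s
        exact toNerveSimplex_res Φ s f.unop.1 f.unop.2 }

/-- An enriched functor out of `𝔠 Z` is determined by its transpose, on objects. -/
lemma obj_eq_of_toNerve_eq {Φ Ψ : EnrichedFunctor (Space T) (Coh Z) D}
    (h : toNerve Φ = toNerve Ψ) (a : Coh Z) : Φ.obj a = Ψ.obj a := by
  have h' : toNerveSimplex (m := SimplexCategory.mk 0) (d := pt T) Φ a =
      toNerveSimplex (m := SimplexCategory.mk 0) (d := pt T) Ψ a :=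
    congrArg (fun t : Z ⟶ enrichedNerve T D => t.hom.app _ a) h
  have h'' := congrArg (fun s => NerveSimplex.obj s 0) h'
  simpa only [toNerveSimplex, vtx_obj] using h''

/-- An enriched functor out of `𝔠 Z` is determined by its transpose, on morphisms. -/
lemma map_eq_of_toNerve_eq {Φ Ψ : EnrichedFunctor (Space T) (Coh Z) D}
    (h : toNerve Φ = toNerve Ψ) {d : T × SimplexCategory} {a b : Coh Z} (f : HomAt (op d) a b) :
    (f.map Φ).cast (obj_eq_of_toNerve_eq h a) (obj_eq_of_toNerve_eq h b) = f.map Ψ := by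
  induction f using Coh.hom_induction with
  | of s u =>
    have h' : toNerveSimplex Φ s = toNerveSimplex Ψ s :=
      congrArg (fun t : Z ⟶ enrichedNerve T D => t.hom.app _ s) h
    have e := obj_eq_of_toNerve_eq h
    have h'' := NerveSimplex.map_congr h' (𝟙 _) u (e (vtx s _)) (e (vtx s _))
    rw [toNerveSimplex_map, toNerveSimplex_map] at h''
    exact h''
  | id a => rw [HomAt.map_id, HomAt.map_id, HomAt.cast_id]
  | comp f g hf hg =>
    rw [HomAt.map_comp, HomAt.map_comp, ← hf, ← hg, HomAt.cast_comp]

lemma toNerve_naturality_left (v : Z ⟶ Y) (Φ : EnrichedFunctor (Space T) (Coh Y) D) :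
    toNerve ((functor v).comp (Space T) Φ) = v ≫ toNerve Φ := by
  ext c s
  refine NerveSimplex.ext_cast
    (fun i => congrArg Φ.obj (onObj_vtx v (m := c.unop.1) (d := c.unop.2) s i)) ?_
  intro i j e f u
  change HomAt.cast _ _ (HomAt.cast _ _ (((gen (Simplex.res (Z := Z.obj) s (𝟙 _) f) u).map
    (functor v)).map Φ)) = HomAt.cast _ _ ((gen ((Simplex.map v.hom s).res (𝟙 _) f) u).map Φ)
  have h := (map_gen v (Simplex.res (Z := Z.obj) s (𝟙 _) f) u).trans
    ((congrArg (HomAt.cast _ _) (gen_congr (Simplex.map_res v.hom s (𝟙 _) f) u)).trans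
      (HomAt.cast_cast _ _ _ _ _))
  rw [h]
  exact (congrArg (fun t => HomAt.cast _ _ (HomAt.cast _ _ t)) (HomAt.map_cast Φ _ _ _)).trans
    ((HomAt.cast_cast _ _ _ _ _).trans (HomAt.cast_cast _ _ _ _ _))

lemma toNerve_naturality_right (Φ : EnrichedFunctor (Space T) (Coh Z) D)
    (Ψ : EnrichedFunctor (Space T) D E) :
    toNerve (Φ.comp (Space T) Ψ) = toNerve Φ ≫ enrichedNerveMap Ψ := by
  ext c s
  refine NerveSimplex.ext_cast (fun i => rfl) ?_
  intro i j e f u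
  exact (HomAt.map_cast Ψ _ _ _).symm

/-- The simplex of the nerve of `D` at a simplex of `Z`. -/
abbrev nerveApp (v : Z ⟶ enrichedNerve T D) {m : SimplexCategory} {d : T × SimplexCategory}
    (s : Simplex Z.obj m d) : NerveSimplex D m d := v.hom.app _ s

lemma nerveApp_res (v : Z ⟶ enrichedNerve T D) {m m' : SimplexCategory} {d d' : T × SimplexCategory}
    (s : Simplex Z.obj m d) (α : m' ⟶ m) (g : d' ⟶ d) :
    nerveApp v (s.res α g) = (nerveApp v s).restrict α g :=
  NatTrans.naturality_apply v.hom _ s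

/-- The effect on objects of the enriched functor `𝔠 Z ⟶ D` corresponding to `Z ⟶ N D`. -/
def liftObj (v : Z ⟶ enrichedNerve T D) (a : Coh Z) : D :=
  (nerveApp v (m := SimplexCategory.mk 0) (d := pt T) a).obj 0

lemma liftObj_vtx (v : Z ⟶ enrichedNerve T D) {m : SimplexCategory} {d : T × SimplexCategory}
    (s : Simplex Z.obj m d) (i : Fin (m.len + 1)) :
    liftObj v (vtx s i) = (nerveApp v s).obj i := by
  have h₁ := nerveApp_res v (m := SimplexCategory.mk 0) (d := pt T) (vtx s i) (𝟙 _) (toPt T d)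
  have h₂ := nerveApp_res v s (SimplexCategory.const (SimplexCategory.mk 0) m i) (𝟙 d)
  have h₃ : Simplex.res (Z := Z.obj) (m := SimplexCategory.mk 0) (d := pt T) (vtx s i) (𝟙 _)
      (toPt T d) = s.res (SimplexCategory.const (SimplexCategory.mk 0) m i) (𝟙 d) :=
    (vertex_eq_label s i).symm
  rw [h₃, h₂] at h₁
  exact (congrArg (fun t => NerveSimplex.obj t 0) h₁).symm

/-- The effect on formal composites of the enriched functor `𝔠 Z ⟶ D` corresponding to
`Z ⟶ N D`. -/
def liftWord (v : Z ⟶ enrichedNerve T D) {d : T × SimplexCategory} :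
    ∀ {a b : Coh Z}, Word ((row T (op d)).obj Z.obj) (label Z (op d)) d.2 a b →
      HomAt (op d) (liftObj v a) (liftObj v b)
  | _, _, .of g => ((nerveApp v (m := g.m) (d := d) g.simplex).map (𝟙 d) g.path).cast
      ((liftObj_vtx v _ _).symm.trans (congrArg (liftObj v) ((vertex_eq_label_iff _ _ _).1 g.src)))
      ((liftObj_vtx v _ _).symm.trans (congrArg (liftObj v) ((vertex_eq_label_iff _ _ _).1 g.tgt)))
  | _, _, .id a => HomAt.id _ _
  | _, _, .comp w w' => (liftWord v w).comp (liftWord v w')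

lemma liftWord_rel (v : Z ⟶ enrichedNerve T D) {d : T × SimplexCategory} {a b : Coh Z}
    {w w' : Word ((row T (op d)).obj Z.obj) (label Z (op d)) d.2 a b}
    (h : Word.Rel _ _ _ w w') : liftWord v w = liftWord v w' := by
  induction h with
  | id_comp w => exact HomAt.id_comp _
  | comp_id w => exact HomAt.comp_id _
  | assoc u v w => exact HomAt.assoc _ _ _
  | comp_left u h ih => exact congrArg (HomAt.comp _) ih
  | comp_right w h ih => exact congrArg (fun t => HomAt.comp t _) ih
  | gen_comp m σ i j l p q ha hb hc =>
    simp only [liftWord]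
    rw [NerveSimplex.map_comp]
    exact (HomAt.cast_comp _ _ _ _ _).symm
  | gen_id m σ i ha =>
    simp only [liftWord]
    rw [NerveSimplex.map_id]
    exact HomAt.cast_id _
  | gen_push m m' α σ i j p ha hb ha' hb' =>
    simp only [liftWord]
    have h := nerveApp_res v (m := m') (d := d) σ α (𝟙 d)
    refine Eq.trans ?_ (NerveSimplex.map_congr h (𝟙 d) p _ _).symm
    refine congrArg (HomAt.cast _ _) ?_
    exact congrArg (fun f => (nerveApp v (m := m') (d := d) σ).map f (p.push α))
      (Category.comp_id (𝟙 d)).symm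

/-- The effect on morphisms of the enriched functor `𝔠 Z ⟶ D` corresponding to `Z ⟶ N D`. -/
def liftHom (v : Z ⟶ enrichedNerve T D) {d : T × SimplexCategory} {a b : Coh Z}
    (f : HomAt (op d) a b) : HomAt (op d) (liftObj v a) (liftObj v b) :=
  Quot.lift (liftWord v) (fun _ _ => liftWord_rel v) f

lemma liftHom_gen (v : Z ⟶ enrichedNerve T D) {m : SimplexCategory} {d : T × SimplexCategory}
    (s : Simplex Z.obj m d) {i j : Fin (m.len + 1)} (u : PathSimplex m d.2 i j) :
    liftHom v (gen s u) = ((nerveApp v s).map (𝟙 d) u).cast (liftObj_vtx v s i).symm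
      (liftObj_vtx v s j).symm := rfl

lemma liftHom_id (v : Z ⟶ enrichedNerve T D) {d : T × SimplexCategory} (a : Coh Z) :
    liftHom v (HomAt.id (op d) a) = HomAt.id (op d) (liftObj v a) := rfl

lemma liftHom_comp (v : Z ⟶ enrichedNerve T D) {d : T × SimplexCategory} {a b c : Coh Z}
    (f : HomAt (op d) a b) (g : HomAt (op d) b c) :
    liftHom v (f.comp g) = (liftHom v f).comp (liftHom v g) := by
  induction f using Quot.ind
  induction g using Quot.ind
  rfl

lemma liftHom_cast (v : Z ⟶ enrichedNerve T D) {d : T × SimplexCategory} {a b a' b' : Coh Z}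
    (ha : a = a') (hb : b = b') (f : HomAt (op d) a b) :
    liftHom v (f.cast ha hb) =
      (liftHom v f).cast (congrArg (liftObj v) ha) (congrArg (liftObj v) hb) := by
  subst ha hb
  rfl

lemma liftHom_restrict (v : Z ⟶ enrichedNerve T D) {d d' : T × SimplexCategory} (g : d' ⟶ d)
    {a b : Coh Z} (f : HomAt (op d) a b) :
    liftHom v (f.restrict g.op) = (liftHom v f).restrict g.op := by
  induction f using Coh.hom_induction with
  | of s u =>
    rw [restrict_gen, liftHom_cast, liftHom_gen, liftHom_gen, HomAt.restrict_cast, HomAt.cast_cast,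
      ← NerveSimplex.map_restrict]
    rw [NerveSimplex.map_congr (nerveApp_res v s (𝟙 _) g)]
    refine congrArg (HomAt.cast _ _) ?_
    refine congrArg₂ (fun f u => (nerveApp v s).map f u) ?_ (PathSimplex.push_self _)
    exact (Category.id_comp g).trans (Category.comp_id g).symm
  | id a => rw [HomAt.restrict_id, liftHom_id, liftHom_id, HomAt.restrict_id]
  | comp f f' hf hf' => rw [HomAt.restrict_comp, liftHom_comp, liftHom_comp, HomAt.restrict_comp,
      hf, hf']

/-- The enriched functor `𝔠 Z ⟶ D` corresponding to `Z ⟶ N D`. -/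
def ofNerve (v : Z ⟶ enrichedNerve T D) : EnrichedFunctor (Space T) (Coh Z) D :=
  functorOfHomAt (liftObj v) (fun {d} => liftHom v (d := d.unop))
    (fun κ => liftHom_restrict v κ.unop) (fun _ => liftHom_id v) (fun {_} => liftHom_comp v)

/-- Every map `Z ⟶ N D` is the transpose of an enriched functor `𝔠 Z ⟶ D`. -/
lemma toNerve_ofNerve (v : Z ⟶ enrichedNerve T D) : toNerve (ofNerve v) = v := by
  ext c s
  refine NerveSimplex.ext_cast (fun i => liftObj_vtx v (m := c.unop.1) (d := c.unop.2) s i) ?_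
  intro i j e f u
  change HomAt.cast _ _ (HomAt.cast _ _ (liftHom v (gen (Simplex.res (Z := Z.obj) s (𝟙 _) f) u))) =
    _
  rw [liftHom_gen, NerveSimplex.map_congr (nerveApp_res v _ (𝟙 _) f) (𝟙 e) u]
  refine ((HomAt.cast_cast _ _ _ _ _).trans (HomAt.cast_cast _ _ _ _ _)).trans ?_
  refine congrArg₂ (fun f u => (nerveApp v (m := c.unop.1) (d := c.unop.2) s).map f u) ?_
    (PathSimplex.push_self _)
  exact Category.id_comp f

end Transposition

/-! ### The explicit straightening -/

section ExplicitStraightening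

/-- The degeneracy `[m+1] ⟶ [m]` sending `m+1` to `m`. -/
def coneRetr (m : SimplexCategory) : SimplexCategory.mk (m.len + 1) ⟶ m :=
  SimplexCategory.Hom.mk
    { toFun := Fin.lastCases (Fin.last m.len) (fun i => i)
      monotone' := by
        intro i j h
        induction j using Fin.lastCases with
        | last => simpa using Fin.le_last _
        | cast j =>
          induction i using Fin.lastCases with
          | last => exact absurd (lt_of_lt_of_le (Fin.castSucc_lt_last j) h) (lt_irrefl _)
          | cast i => simpa using Fin.castSucc_le_castSucc_iff.1 h }

@[simp]
lemma coneRetr_castSucc {m : SimplexCategory} (i : Fin (m.len + 1)) :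
    (coneRetr m).toOrderHom i.castSucc = i :=
  Fin.lastCases_castSucc (motive := fun _ => Fin (m.len + 1)) (last := Fin.last _)
    (cast := fun i => i) i

variable {T : Type} [SmallCategory T] [HasTerminal T] {W : PCat T}

open Coh

lemma coneRetr_incl_castSucc {m : SimplexCategory} {j : Fin (m.len + 1)}
    (x : Fin (m.len + 1 + 1)) (hx : x ≤ j.castSucc) :
    (coneIncl m).toOrderHom ((coneRetr m).toOrderHom x) = x := by
  induction x using Fin.lastCases with
  | last => exact absurd (lt_of_lt_of_le (Fin.castSucc_lt_last j) hx) (lt_irrefl _)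
  | cast x => exact congrArg Fin.castSucc (coneRetr_castSucc x)

/-- The morphism of `𝔠 W` given by a simplex `s` and an arrow of `c^h Δ[m+1]` between vertices
different from `m+1`. Such an arrow lies in `c^h Δ[m]`, and pushing it forward along the degeneracy
recovers it there. -/
def baseGen {m : SimplexCategory} {d : T × SimplexCategory} (s : Simplex W.obj m d)
    {i j : Fin (m.len + 1)}
    (q : PathSimplex (SimplexCategory.mk (m.len + 1)) d.2 i.castSucc j.castSucc) :
    HomAt (op d) (vtx s i) (vtx s j) :=
  (gen s (q.push (coneRetr m))).cast (congrArg (vtx s) (coneRetr_castSucc i))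
    (congrArg (vtx s) (coneRetr_castSucc j))

section baseGen

variable {m m' : SimplexCategory} {d d' : T × SimplexCategory} (s : Simplex W.obj m d)
    {i j l : Fin (m.len + 1)}

lemma baseGen_congr {t : Simplex W.obj m d} (h : s = t)
    (q : PathSimplex (SimplexCategory.mk (m.len + 1)) d.2 i.castSucc j.castSucc) :
    baseGen s q = (baseGen t q).cast (by rw [h]) (by rw [h]) := by
  subst h
  rfl

lemma baseGen_comp (q : PathSimplex (SimplexCategory.mk (m.len + 1)) d.2 i.castSucc j.castSucc)
    (q' : PathSimplex (SimplexCategory.mk (m.len + 1)) d.2 j.castSucc l.castSucc) :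
    baseGen s (q.comp q') = (baseGen s q).comp (baseGen s q') := by
  rw [baseGen, PathSimplex.push_comp, gen_comp]
  exact HomAt.cast_comp _ _ _ _ _

lemma baseGen_id : baseGen s (PathSimplex.id d.2 i.castSucc) = HomAt.id (op d) (vtx s i) := by
  rw [baseGen, PathSimplex.push_id, gen_id]
  exact HomAt.cast_id _

lemma restrict_baseGen (g : d' ⟶ d)
    (q : PathSimplex (SimplexCategory.mk (m.len + 1)) d.2 i.castSucc j.castSucc) :
    (baseGen s q).restrict g.op =
      (baseGen (s.res (𝟙 m) g) (q.restrict g.2)).cast (vtx_res_id s g i) (vtx_res_id s g j) := by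
  rw [baseGen, HomAt.restrict_cast, restrict_gen, baseGen, HomAt.cast_cast, HomAt.cast_cast,
    PathSimplex.restrict_push]

/-- The two ways of evaluating an arrow of `c^h Δ[m+1]` between vertices different from `m+1` on an
`(m+1)`-simplex agree. -/
lemma baseGen_coneIncl (s : Simplex W.obj (SimplexCategory.mk (m.len + 1)) d)
    (q : PathSimplex (SimplexCategory.mk (m.len + 1)) d.2 i.castSucc j.castSucc) :
    baseGen (s.res (coneIncl m) (𝟙 d)) q = (gen s q).cast (vtx_res s (coneIncl m) _ _).symm
      (vtx_res s (coneIncl m) _ _).symm := by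
  rw [baseGen, gen_res, PathSimplex.push_push_eq_cast q coneRetr_incl_castSucc,
    gen_cast, HomAt.cast_cast, HomAt.cast_cast]
  rfl

lemma baseGen_push (q : PathSimplex m d.2 i j) : baseGen s (q.push (coneIncl m)) = gen s q := by
  change HomAt.cast _ _ (gen s ((PathSimplex.push (coneIncl m) q).push (coneRetr m))) = _
  rw [PathSimplex.push_push_eq_cast q fun x _ => coneRetr_castSucc x, gen_cast]
  exact HomAt.cast_cast _ _ _ _ _

end baseGen

/-- Generators of the set of morphisms from `a` to the cone point in degree `d`, for `p : P ⟶ W`: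
an `m`-simplex `x` of `P`, a morphism `f` of `𝔠 W` from `a` to its `i`-th vertex, and an arrow `u`
of `c^h Δ[m+1]` from `i` to `m+1`. -/
structure ConeGen (p : Over W.obj) (d : T × SimplexCategory) (a : Coh W) where
  m : SimplexCategory
  simplex : Simplex p.left m d
  i : Fin (m.len + 1)
  hom : HomAt (op d) a (vtx (simplex.map p.hom) i)
  path : PathSimplex (SimplexCategory.mk (m.len + 1)) d.2 i.castSucc (Fin.last (m.len + 1))

namespace ConeGen

variable {p q r : Over W.obj} {d d' : T × SimplexCategory} {a b : Coh W}

lemma vtx_map_res {m m' : SimplexCategory} (x : Simplex p.left m d) (α : m' ⟶ m) (g : d' ⟶ d)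
    (i : Fin (m'.len + 1)) :
    vtx ((x.res α g).map p.hom) i = vtx (x.map p.hom) (α.toOrderHom i) := by
  rw [Simplex.map_res, vtx_res]

lemma vtx_map_res_id {m : SimplexCategory} (x : Simplex p.left m d) (g : d' ⟶ d)
    (i : Fin (m.len + 1)) : vtx ((x.res (𝟙 m) g).map p.hom) i = vtx (x.map p.hom) i :=
  vtx_map_res x (𝟙 m) g i

lemma vtx_map_map {m : SimplexCategory} (φ : p ⟶ q) (x : Simplex p.left m d)
    (i : Fin (m.len + 1)) :
    vtx (x.map p.hom) i = vtx ((x.map φ.left).map q.hom) i := by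
  rw [← Over.w φ]
  rfl

lemma mk_congr {m : SimplexCategory} {x y : Simplex p.left m d} {i : Fin (m.len + 1)}
    {f : HomAt (op d) a (vtx (x.map p.hom) i)} {g : HomAt (op d) a (vtx (y.map p.hom) i)}
    {u v : PathSimplex (SimplexCategory.mk (m.len + 1)) d.2 i.castSucc (Fin.last (m.len + 1))}
    (h : x = y) (hf : f.cast rfl (by rw [h]) = g) (hu : u = v) :
    (⟨m, x, i, f, u⟩ : ConeGen p d a) = ⟨m, y, i, g, v⟩ := by
  subst h hf hu
  rfl

/-- The relations: morphisms of `𝔠 W` coming from the simplex may be moved from `f` to `u`, and the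
generators are compatible with restriction of the simplex along `α : [m] ⟶ [m']`. -/
inductive Rel (p : Over W.obj) (d : T × SimplexCategory) (a : Coh W) :
    ConeGen p d a → ConeGen p d a → Prop
  | slide {m : SimplexCategory} (x : Simplex p.left m d) {i j : Fin (m.len + 1)}
      (f : HomAt (op d) a (vtx (x.map p.hom) i))
      (q : PathSimplex (SimplexCategory.mk (m.len + 1)) d.2 i.castSucc j.castSucc)
      (u : PathSimplex (SimplexCategory.mk (m.len + 1)) d.2 j.castSucc (Fin.last (m.len + 1))) :
      Rel p d a ⟨m, x, j, f.comp (baseGen (x.map p.hom) q), u⟩ ⟨m, x, i, f, q.comp u⟩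
  | pull {m m' : SimplexCategory} (α : m ⟶ m') (x : Simplex p.left m' d) {i : Fin (m.len + 1)}
      (f : HomAt (op d) a (vtx (x.map p.hom) (α.toOrderHom i)))
      (u : PathSimplex (SimplexCategory.mk (m.len + 1)) d.2 i.castSucc (Fin.last (m.len + 1))) :
      Rel p d a
        ⟨m', x, α.toOrderHom i, f, (u.push (coneMap α)).cast (coneMap_castSucc α i)
          (coneMap_last α)⟩
        ⟨m, x.res α (𝟙 d), i, f.cast rfl (vtx_map_res x α (𝟙 d) i).symm, u⟩

lemma Rel.of_eq {z w z' w' : ConeGen p d a} (h : Rel p d a z w) (hz : z = z') (hw : w = w') :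
    Rel p d a z' w' := by
  subst hz hw
  exact h

/-- Precomposition with a morphism of `𝔠 W`. -/
def precomp (g : HomAt (op d) a b) (z : ConeGen p d b) : ConeGen p d a :=
  ⟨z.m, z.simplex, z.i, g.comp z.hom, z.path⟩

lemma precomp_rel (g : HomAt (op d) a b) {z w : ConeGen p d b} (h : Rel p d b z w) :
    Rel p d a (z.precomp g) (w.precomp g) := by
  cases h with
  | slide x f q u =>
    simp only [precomp]
    rw [← HomAt.assoc]
    exact .slide _ _ _ _
  | pull α x f u =>
    have h := Rel.pull α x (g.comp f) u
    rw [HomAt.cast_comp rfl rfl] at h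
    exact h

/-- Restriction in `T × Δ`. -/
def restrict (g : d' ⟶ d) (z : ConeGen p d a) : ConeGen p d' a :=
  ⟨z.m, z.simplex.res (𝟙 _) g, z.i, (z.hom.restrict g.op).cast rfl
    (vtx_map_res_id z.simplex g z.i).symm, z.path.restrict g.2⟩

lemma restrict_rel (g : d' ⟶ d) {z w : ConeGen p d a} (h : Rel p d a z w) :
    Rel p d' a (z.restrict g) (w.restrict g) := by
  cases h with
  | @slide m x i j f q u =>
    have h := Rel.slide (x.res (𝟙 _) g) ((f.restrict g.op).cast rfl
      (vtx_map_res_id x g i).symm) (q.restrict g.2) (u.restrict g.2)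
    simp only [restrict]
    rw [PathSimplex.restrict_comp, HomAt.restrict_comp, restrict_baseGen, HomAt.cast_comp rfl
      (vtx_map_res_id x g i).symm (vtx_map_res_id x g j).symm, HomAt.cast_cast]
    rw [baseGen_congr _ (Simplex.map_res p.hom x _ _)] at h
    exact h
  | @pull m m' α x i f u =>
    have h := Rel.pull α (x.res (𝟙 _) g) (i := i) ((f.restrict g.op).cast rfl
      (vtx_map_res_id x g _).symm) (u.restrict g.2)
    have e₁ : (((u.restrict g.2).push (coneMap α)).cast (coneMap_castSucc α i)
        (coneMap_last α)) = ((u.push (coneMap α)).cast (coneMap_castSucc α i)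
          (coneMap_last α)).restrict g.2 := by
      rw [PathSimplex.restrict_cast, PathSimplex.restrict_push]
    have e₂ : (x.res (𝟙 m') g).res α (𝟙 d') = (x.res α (𝟙 d)).res (𝟙 m) g := by
      rw [Simplex.res_res, Simplex.res_res]
      simp
    rw [e₁] at h
    refine h.of_eq rfl (mk_congr e₂ ?_ rfl)
    rw [HomAt.restrict_cast, HomAt.cast_cast, HomAt.cast_cast, HomAt.cast_cast]

lemma restrict_self (z : ConeGen p d a) : z.restrict (𝟙 d) = z := by
  refine mk_congr z.simplex.res_self ?_ ?_
  · have h : z.hom.restrict (𝟙 d).op = z.hom := HomAt.restrict_self _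
    rw [h, HomAt.cast_cast]
    rfl
  · exact Functor.map_id_apply _ _ _

lemma restrict_restrict {d'' : T × SimplexCategory} (g : d' ⟶ d) (g' : d'' ⟶ d')
    (z : ConeGen p d a) : (z.restrict g).restrict g' = z.restrict (g' ≫ g) := by
  have h : (z.simplex.res (𝟙 _) g).res (𝟙 _) g' = z.simplex.res (𝟙 _) (g' ≫ g) := by
    rw [Simplex.res_res, Category.id_comp]
  simp only [restrict]
  refine mk_congr h ?_ ?_
  · rw [HomAt.restrict_cast, HomAt.restrict_restrict]
    exact (HomAt.cast_cast _ _ _ _ _).trans (HomAt.cast_cast _ _ _ _ _)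
  · exact (Functor.map_comp_apply _ _ _ _).symm

lemma restrict_precomp (κ : d' ⟶ d) (g : HomAt (op d) a b) (z : ConeGen p d b) :
    (z.precomp g).restrict κ = (z.restrict κ).precomp (g.restrict κ.op) := by
  simp only [precomp, restrict]
  refine mk_congr rfl ?_ rfl
  rw [HomAt.restrict_comp]
  exact (HomAt.cast_cast _ _ _ _ _).trans (HomAt.cast_comp rfl rfl _ _ _)

/-- Functoriality in `p`. -/
def map (φ : p ⟶ q) (z : ConeGen p d a) : ConeGen q d a :=
  ⟨z.m, z.simplex.map φ.left, z.i, z.hom.cast rfl (vtx_map_map φ z.simplex z.i), z.path⟩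

lemma map_rel (φ : p ⟶ q) {z w : ConeGen p d a} (h : Rel p d a z w) :
    Rel q d a (z.map φ) (w.map φ) := by
  cases h with
  | @slide m x i j f r u =>
    have h := Rel.slide (x.map φ.left) (f.cast rfl (vtx_map_map φ x i)) r u
    simp only [map]
    have e : (x.map φ.left).map q.hom = x.map p.hom := by
      rw [← Over.w φ]
      rfl
    rw [baseGen_congr _ e] at h
    rw [HomAt.cast_comp rfl (vtx_map_map φ x i) (vtx_map_map φ x j)]
    exact h
  | @pull m m' α x i f u =>
    have h := Rel.pull α (x.map φ.left) (f.cast rfl (vtx_map_map φ x _)) u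
    refine h.of_eq rfl (mk_congr (Simplex.map_res φ.left x α (𝟙 d)).symm ?_ rfl)
    rw [HomAt.cast_cast, HomAt.cast_cast, HomAt.cast_cast]

lemma map_precomp (φ : p ⟶ q) (g : HomAt (op d) a b) (z : ConeGen p d b) :
    (z.precomp g).map φ = (z.map φ).precomp g := by
  simp only [precomp, map]
  refine mk_congr rfl ?_ rfl
  exact (HomAt.cast_cast _ _ _ _ _).trans (HomAt.cast_comp rfl rfl _ _ _)

lemma map_restrict (φ : p ⟶ q) (κ : d' ⟶ d) (z : ConeGen p d a) :
    (z.restrict κ).map φ = (z.map φ).restrict κ := by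
  simp only [restrict, map]
  refine mk_congr (Simplex.map_res φ.left z.simplex _ κ) ?_ rfl
  rw [HomAt.restrict_cast]
  exact ((HomAt.cast_cast _ _ _ _ _).trans (HomAt.cast_cast _ _ _ _ _)).trans
    (HomAt.cast_cast _ _ _ _ _).symm

lemma map_map (φ : p ⟶ q) (ψ : q ⟶ r) (z : ConeGen p d a) :
    (z.map φ).map ψ = z.map (φ ≫ ψ) := by
  simp only [map]
  exact mk_congr rfl ((HomAt.cast_cast _ _ _ _ _).trans (HomAt.cast_cast _ _ _ _ _)) rfl

end ConeGen

/-- The value of the explicit straightening of `p` at `a`. -/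
def explicitStObj (p : Over W.obj) (a : Coh W) : Space T where
  obj d := Quot (ConeGen.Rel p d.unop a)
  map κ := ↾Quot.map (ConeGen.restrict κ.unop) (fun _ _ => ConeGen.restrict_rel κ.unop)
  map_id d := by
    ext z
    induction z using Quot.ind with
    | mk z => exact congrArg (Quot.mk _) z.restrict_self
  map_comp f g := by
    ext z
    induction z using Quot.ind with
    | mk z => exact congrArg (Quot.mk _) (z.restrict_restrict _ _).symm

/-- The explicit straightening of `p : P ⟶ W`, as an enriched presheaf on `𝔠 W`: the free one on
the generators `ConeGen`, modulo `ConeGen.Rel`. -/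
def explicitStPresheaf (p : Over W.obj) : EPresheaf (Space T) (Coh W) where
  obj a := explicitStObj p a
  act a b :=
    { app d := ↾fun y => Quot.map (ConeGen.precomp (d := d.unop) y.1)
        (fun _ _ => ConeGen.precomp_rel y.1) y.2
      naturality d d' κ := by
        ext y
        obtain ⟨g, z⟩ := y
        induction z using Quot.ind with
        | mk z => exact congrArg (Quot.mk _) (ConeGen.restrict_precomp κ.unop g z).symm }
  id_act a := by
    ext d z
    induction z using Quot.ind with
    | mk z => exact congrArg (Quot.mk _) (ConeGen.mk_congr rfl (HomAt.id_comp z.hom) rfl)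
  comp_act a b c := by
    ext d y
    obtain ⟨g, g', z⟩ := y
    induction z using Quot.ind with
    | mk z => exact congrArg (Quot.mk _) (ConeGen.mk_congr rfl (HomAt.assoc g g' z.hom) rfl)

/-- The class of a generator. -/
def ConeGen.toSt {p : Over W.obj} {d : T × SimplexCategory} {a : Coh W} (z : ConeGen p d a) :
    ((explicitStPresheaf p).obj a).obj (op d) := Quot.mk _ z

lemma ConeGen.map_toSt {p : Over W.obj} {d d' : T × SimplexCategory} {a : Coh W}
    (z : ConeGen p d a) (g : d' ⟶ d) :
    ((explicitStPresheaf p).obj a).map g.op z.toSt = (z.restrict g).toSt := rfl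

lemma ConeGen.act_toSt {p : Over W.obj} {d : T × SimplexCategory} {a b : Coh W}
    (g : HomAt (op d) a b) (z : ConeGen p d b) :
    ((explicitStPresheaf p).act a b).app (op d) (g, z.toSt) = (z.precomp g).toSt := rfl

/-- The explicit straightening functor. -/
def explicitSt (W : PCat T) : Over W.obj ⥤ EPresheaf (Space T) (Coh W) where
  obj p := explicitStPresheaf p
  map φ := EPresheaf.Hom.mk
    (fun a =>
      { app d := ↾Quot.map (ConeGen.map φ) (fun _ _ => ConeGen.map_rel φ)
        naturality d d' κ := by
          ext z
          induction z using Quot.ind with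
          | mk z => exact congrArg (Quot.mk _) (ConeGen.map_restrict φ κ.unop z) })
    (fun a b => by
      ext d y
      obtain ⟨g, z⟩ := y
      induction z using Quot.ind with
      | mk z => exact congrArg (Quot.mk _) (ConeGen.map_precomp φ g z).symm)
  map_id p := by
    ext a d z
    induction z using Quot.ind with
    | mk z => rfl
  map_comp φ ψ := by
    ext a d z
    induction z using Quot.ind with
    | mk z => exact congrArg (Quot.mk _) (ConeGen.map_map φ ψ z).symm

end ExplicitStraightening

/-! ### The explicit straightening of a tensor -/

section Tensors

variable {T : Type} [SmallCategory T] [HasTerminal T] {W : PCat T}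

open Coh MonoidalRightAction

namespace ConeGen

variable {p q : Over W.obj} {X Y : Space T} {d d' : T × SimplexCategory} {a b : Coh W}

/-- A pair of a simplex of `P` and an element of `X`, as a simplex of `P × X`. -/
def pair {m : SimplexCategory} (x : Simplex p.left m d) (ξ : X.obj (op d)) :
    Simplex (p ⊙ᵣ X).left m d := (x, ξ)

/-- The generators of the straightening of `p ⊗ X` over a given element of `X`. -/
def tensor (ξ : X.obj (op d)) (z : ConeGen p d a) : ConeGen (p ⊙ᵣ X) d a :=
  ⟨z.m, pair z.simplex ξ, z.i, z.hom, z.path⟩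

lemma tensor_rel (ξ : X.obj (op d)) {z w : ConeGen p d a} (h : Rel p d a z w) :
    Rel (p ⊙ᵣ X) d a (z.tensor ξ) (w.tensor ξ) := by
  cases h with
  | slide x f q u => exact Rel.slide (p := p ⊙ᵣ X) (pair x ξ) f q u
  | pull α x f u =>
    have h := Rel.pull (p := p ⊙ᵣ X) α (pair x ξ) f u
    refine h.of_eq rfl (mk_congr ?_ rfl rfl)
    exact congrArg (pair (x.res α (𝟙 d))) (Functor.map_id_apply X (op d) ξ)

/-- The generator of the straightening of `p` underlying one of `p ⊗ X`. -/
def untensor (z : ConeGen (p ⊙ᵣ X) d a) : ConeGen p d a :=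
  ⟨z.m, z.simplex.1, z.i, z.hom, z.path⟩

/-- The element of `X` underlying a generator of the straightening of `p ⊗ X`. -/
def label (z : ConeGen (p ⊙ᵣ X) d a) : X.obj (op d) := z.simplex.2

lemma untensor_rel {z w : ConeGen (p ⊙ᵣ X) d a} (h : Rel (p ⊙ᵣ X) d a z w) :
    Rel p d a z.untensor w.untensor := by
  cases h with
  | slide x f q u => exact Rel.slide (p := p) x.1 f q u
  | pull α x f u => exact Rel.pull (p := p) α x.1 f u

/-- The relations fix the degree in `T × Δ`, hence do not change the element of `X`. -/
lemma label_rel {z w : ConeGen (p ⊙ᵣ X) d a} (h : Rel (p ⊙ᵣ X) d a z w) :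
    z.label = w.label := by
  cases h with
  | slide x f q u => rfl
  | pull α x f u => exact (Functor.map_id_apply X (op d) x.2).symm

end ConeGen

open ConeGen

/-- The pointwise comparison between the straightening of `p ⊗ X` and that of `p`. -/
def explicitStTensorEquiv (p : Over W.obj) (X : Space T) (a : Coh W)
    (d : (T × SimplexCategory)ᵒᵖ) :
    (explicitStObj (p ⊙ᵣ X) a).obj d ≃ (explicitStObj p a).obj d × X.obj d where
  toFun z :=
    (Quot.map untensor (fun _ _ => untensor_rel) z, Quot.lift label (fun _ _ => label_rel) z)
  invFun y := Quot.map (tensor y.2) (fun _ _ => tensor_rel y.2) y.1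
  left_inv z := by
    induction z using Quot.ind
    rfl
  right_inv y := by
    obtain ⟨z, ξ⟩ := y
    induction z using Quot.ind
    rfl

/-- `St(p ⊗ X) ≅ St(p) ⊗ X` for the explicit straightening. -/
def explicitStTensor (p : Over W.obj) (X : Space T) :
    (explicitSt W).obj (p ⊙ᵣ X) ≅ (explicitSt W).obj p ⊙ᵣ X :=
  EPresheaf.isoMk (fun a => NatIso.ofComponents
      (fun d => (explicitStTensorEquiv p X a d).toIso) (by
        intro d d' κ
        ext z
        induction z using Quot.ind
        rfl)) (by
    intro a b
    ext d y
    obtain ⟨g, z⟩ := y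
    induction z using Quot.ind
    rfl)

instance : (explicitSt W).OplaxRightLinear (Space T) where
  δᵣ p X := (explicitStTensor p X).hom
  δᵣ_naturality_right p X Y f := by
    ext a d z
    induction z using Quot.ind
    rfl
  δᵣ_naturality_left f X := by
    ext a d z
    induction z using Quot.ind
    rfl
  δᵣ_associativity p X Y := by
    ext a d z
    induction z using Quot.ind
    rfl
  δᵣ_unitality_inv p := by
    ext a d z
    induction z using Quot.ind
    rfl

instance (p : Over W.obj) (X : Space T) :
    IsIso (Functor.OplaxRightLinear.δᵣ (explicitSt W) p X) :=
  inferInstanceAs (IsIso (explicitStTensor p X).hom)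

end Tensors

/-! ### Collages -/

section Collages

variable {T : Type} [SmallCategory T] {C : Type} [EnrichedCategory (Space T) C]

/-- The objects of the collage of an enriched presheaf `F` on `C`: those of `C` and one additional
object `none`, with `Hom(a, none) = F a` and no maps from `none` to `C`. -/
def Collage (_ : EPresheaf (Space T) C) : Type := Option C

namespace Collage

/-- The hom `T`-spaces of the collage. -/
def hom (F : EPresheaf (Space T) C) : Option C → Option C → Space T
  | some a, some b => a ⟶[Space T] b
  | some a, none => F.obj a
  | none, some _ => (Functor.const _).obj PEmpty
  | none, none => 𝟙_ (Space T)

/-- The identities of the collage. -/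
def homId (F : EPresheaf (Space T) C) : ∀ x : Option C, 𝟙_ (Space T) ⟶ hom F x x
  | some a => eId (Space T) a
  | none => 𝟙 _

/-- The composition of the collage. -/
def homComp (F : EPresheaf (Space T) C) :
    ∀ x y z : Option C, hom F x y ⊗ hom F y z ⟶ hom F x z
  | some a, some b, some c => eComp (Space T) a b c
  | some a, some b, none => F.act a b
  | some a, none, none => (ρ_ (F.obj a)).hom
  | none, none, none => (ρ_ (𝟙_ (Space T))).hom
  | some a, none, some c =>
    { app d := ↾fun y => PEmpty.elim y.2
      naturality d d' f := by
        ext y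
        exact PEmpty.elim y.2 }
  | none, none, some c =>
    { app d := ↾fun y => PEmpty.elim y.2
      naturality d d' f := by
        ext y
        exact PEmpty.elim y.2 }
  | none, some b, z =>
    { app d := ↾fun y => PEmpty.elim y.1
      naturality d d' f := by
        ext y
        exact PEmpty.elim y.1 }

instance (F : EPresheaf (Space T) C) : EnrichedCategory (Space T) (Collage F) where
  Hom := hom F
  id := homId F
  comp := homComp F
  id_comp x y := by
    cases x <;> cases y
    · rfl
    · ext d z
      exact PEmpty.elim z
    · exact F.id_act _
    · exact e_id_comp _ _ _
  comp_id x y := by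
    cases x <;> cases y
    · rfl
    · ext d z
      exact PEmpty.elim z
    · rfl
    · exact e_comp_id _ _ _
  assoc x y z w := by
    ext d t
    obtain ⟨f, g, h⟩ := t
    rcases x with _ | a <;> rcases y with _ | b
    · rcases z with _ | c <;> rcases w with _ | e
      · rfl
      · exact PEmpty.elim h
      · exact PEmpty.elim g
      · exact PEmpty.elim g
    · exact PEmpty.elim f
    · rcases z with _ | c <;> rcases w with _ | e
      · rfl
      · exact PEmpty.elim h
      · exact PEmpty.elim g
      · exact PEmpty.elim g
    · rcases z with _ | c <;> rcases w with _ | e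
      · rfl
      · exact PEmpty.elim h
      · exact congrArg (fun (t : (a ⟶[Space T] b) ⊗ (b ⟶[Space T] c) ⊗ F.obj c ⟶ F.obj a) =>
          t.app d (f, g, h)) (F.comp_act a b c)
      · exact HomAt.assoc (D := C) f g h

variable (F : EPresheaf (Space T) C) {d d' : (T × SimplexCategory)ᵒᵖ} {a b c : C}

/-- An object of `C` as an object of the collage. -/
def base (a : C) : Collage F := some a

/-- The additional object of the collage. -/
def top : Collage F := none

variable {F}

/-- A morphism of `C` as a morphism of the collage. -/
def ofHom (f : HomAt d a b) : HomAt d (base F a) (base F b) := f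

/-- An element of `F` as a morphism of the collage. -/
def ofElem (x : (F.obj a).obj d) : HomAt d (base F a) (top F) := x

lemma ofHom_comp (f : HomAt d a b) (g : HomAt d b c) :
    (ofHom (f.comp g) : HomAt d (base F a) (base F c)) = (ofHom f).comp (ofHom g) := rfl

lemma ofHom_id (a : C) : (ofHom (HomAt.id d a) : HomAt d (base F a) (base F a)) =
    HomAt.id d (base F a) := rfl

lemma ofHom_comp_ofElem (f : HomAt d a b) (x : (F.obj b).obj d) :
    (ofHom f).comp (ofElem x) = ofElem ((F.act a b).app d (f, x)) := rfl

lemma restrict_ofHom (κ : d ⟶ d') (f : HomAt d a b) :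
    (ofHom f : HomAt d (base F a) (base F b)).restrict κ = ofHom (f.restrict κ) := rfl

lemma restrict_ofElem (κ : d ⟶ d') (x : (F.obj a).obj d) :
    (ofElem x).restrict κ = ofElem ((F.obj a).map κ x) := rfl

lemma ofHom_cast {a' b' : C} (ha : a = a') (hb : b = b') (f : HomAt d a b) :
    (ofHom (f.cast ha hb) : HomAt d (base F a') (base F b')) =
      (ofHom f).cast (congrArg (base F) ha) (congrArg (base F) hb) := by
  subst ha hb
  rfl

variable (F) in
/-- The inclusion of `C` into the collage. -/
def incl : EnrichedFunctor (Space T) C (Collage F) :=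
  functorOfHomAt (base F) ofHom (fun _ _ _ _ => rfl) (fun _ _ => rfl) (fun _ _ => rfl)

variable {E : Type} [EnrichedCategory (Space T) E]

/-- The enriched functor out of the collage of `F` given by an enriched functor `Φ` out of `C`, an
object `t`, and a map from `F` to the presheaf `Hom(Φ(-), t)`. -/
def desc (Φ : EnrichedFunctor (Space T) C E) (t : E)
    (θ : F ⟶ (EPresheaf.representable (Space T) t).comap Φ) :
    EnrichedFunctor (Space T) (Collage F) E :=
  functorOfHomAt (fun x => Option.rec t Φ.obj x)
    (fun {d x y} => match x, y with
      | some _, some _ => fun f => HomAt.map Φ f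
      | some a, none => fun f => (EPresheaf.Hom.app θ a).app d f
      | none, some _ => fun f => PEmpty.elim f
      | none, none => fun _ => HomAt.id d t)
    (by
      rintro d d' κ (_ | a) (_ | b) f
      · exact (HomAt.restrict_id κ).symm
      · exact PEmpty.elim f
      · exact NatTrans.naturality_apply (EPresheaf.Hom.app θ a) κ f
      · exact HomAt.map_restrict Φ κ f)
    (by
      rintro d (_ | a)
      · rfl
      · exact HomAt.map_id Φ)
    (by
      rintro d (_ | a) (_ | b) (_ | c) f g
      · exact (HomAt.id_comp _).symm
      · exact PEmpty.elim g
      · exact PEmpty.elim f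
      · exact PEmpty.elim f
      · exact (HomAt.comp_id _).symm
      · exact PEmpty.elim g
      · exact (congrArg (fun (t : (a ⟶[Space T] b) ⊗ F.obj b ⟶ _) => t.app d (f, g))
          (EPresheaf.naturality θ a b)).symm
      · exact HomAt.map_comp Φ f g)

end Collage

end Collages

/-! ### The universal simplex in the nerve of the collage -/

section UniversalSimplex

variable {T : Type} [SmallCategory T] [HasTerminal T] {W : PCat T}

open Coh

section ConeSimplex

variable {p : Over W.obj} {m : SimplexCategory} {d : T × SimplexCategory}

open Collage

/-- The generator given by a vertex of a simplex `x`, regarded in degree `e` along `f : e ⟶ d`. -/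
def coneElem (x : Simplex p.left m d) {e : T × SimplexCategory} (f : e ⟶ d) {i : Fin (m.len + 1)}
    (u : PathSimplex (SimplexCategory.mk (m.len + 1)) e.2 i.castSucc (Fin.last (m.len + 1))) :
    ConeGen p e (vtx (x.map p.hom) i) :=
  ⟨m, x.res (𝟙 m) f, i, (HomAt.id (op e) _).cast rfl (ConeGen.vtx_map_res_id x f i).symm, u⟩

/-- The morphism of `𝔠 W` given by a simplex of `P`, regarded in degree `e` along `f : e ⟶ d`. -/
def baseElem (x : Simplex p.left m d) {e : T × SimplexCategory} (f : e ⟶ d)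
    {i j : Fin (m.len + 1)}
    (u : PathSimplex (SimplexCategory.mk (m.len + 1)) e.2 i.castSucc j.castSucc) :
    HomAt (op e) (vtx (x.map p.hom) i) (vtx (x.map p.hom) j) :=
  (baseGen ((x.map p.hom).res (𝟙 m) f) u).cast (vtx_res_id _ f i) (vtx_res_id _ f j)

/-- The vertices of the universal `(m+1)`-simplex on `x`. -/
def coneObj (x : Simplex p.left m d) :
    Fin ((SimplexCategory.mk (m.len + 1)).len + 1) → Collage (explicitStPresheaf p) :=
  Fin.lastCases (top _) (fun i : Fin (m.len + 1) => base _ (vtx (x.map p.hom) i))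

lemma coneObj_castSucc (x : Simplex p.left m d) (i : Fin (m.len + 1)) :
    coneObj x i.castSucc = base _ (vtx (x.map p.hom) i) := Fin.lastCases_castSucc _

lemma coneObj_last (x : Simplex p.left m d) :
    coneObj x (Fin.last (m.len + 1)) = top _ := Fin.lastCases_last

/-- The effect on arrows of the universal `(m+1)`-simplex on `x`. -/
def coneMor (x : Simplex p.left m d) {e : T × SimplexCategory} (f : e ⟶ d)
    (i j : Fin ((SimplexCategory.mk (m.len + 1)).len + 1)) :
    PathSimplex (SimplexCategory.mk (m.len + 1)) e.2 i j →
      HomAt (op e) (coneObj x i) (coneObj x j) :=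
  Fin.lastCases
    (motive := fun j => PathSimplex (SimplexCategory.mk (m.len + 1)) e.2 i j →
      HomAt (op e) (coneObj x i) (coneObj x j))
    (Fin.lastCases
      (motive := fun i => PathSimplex (SimplexCategory.mk (m.len + 1)) e.2 i
        (Fin.last (m.len + 1)) → HomAt (op e) (coneObj x i) (coneObj x (Fin.last (m.len + 1))))
      (fun _ => HomAt.id (op e) _)
      (fun i u => (ofElem (coneElem x f u).toSt).cast (coneObj_castSucc x i).symm
        (coneObj_last x).symm) i)
    (fun j => Fin.lastCases
      (motive := fun i => PathSimplex (SimplexCategory.mk (m.len + 1)) e.2 i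
        j.castSucc → HomAt (op e) (coneObj x i) (coneObj x j.castSucc))
      (fun u => absurd (lt_of_lt_of_le (Fin.castSucc_lt_last j) u.src_le_tgt) (lt_irrefl _))
      (fun i u => (ofHom (baseElem x f u)).cast (coneObj_castSucc x i).symm
        (coneObj_castSucc x j).symm) i) j

variable (x : Simplex p.left m d) {e : T × SimplexCategory} (f : e ⟶ d)

lemma coneMor_last_last
    (u : PathSimplex (SimplexCategory.mk (m.len + 1)) e.2 (Fin.last (m.len + 1))
      (Fin.last (m.len + 1))) : coneMor x f _ _ u = HomAt.id (op e) _ := by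
  simp [coneMor]

lemma coneMor_castSucc_last {i : Fin (m.len + 1)}
    (u : PathSimplex (SimplexCategory.mk (m.len + 1)) e.2 i.castSucc (Fin.last (m.len + 1))) :
    coneMor x f _ _ u = (ofElem (coneElem x f u).toSt).cast (coneObj_castSucc x i).symm
        (coneObj_last x).symm := by
  simp [coneMor]

lemma coneMor_castSucc_castSucc {i j : Fin (m.len + 1)}
    (u : PathSimplex (SimplexCategory.mk (m.len + 1)) e.2 i.castSucc j.castSucc) :
    coneMor x f _ _ u = (ofHom (baseElem x f u)).cast (coneObj_castSucc x i).symm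
        (coneObj_castSucc x j).symm := by
  simp [coneMor]

/-- Case distinction on the endpoints of an arrow of `c^h Δ[m+1]`. -/
lemma path_cases {k : SimplexCategory}
    {P : ∀ i j, PathSimplex (SimplexCategory.mk (m.len + 1)) k i j → Prop}
    (h₁ : ∀ (i j : Fin (m.len + 1))
      (u : PathSimplex (SimplexCategory.mk (m.len + 1)) k i.castSucc j.castSucc), P _ _ u)
    (h₂ : ∀ (i : Fin (m.len + 1))
      (u : PathSimplex (SimplexCategory.mk (m.len + 1)) k i.castSucc (Fin.last (m.len + 1))),
        P _ _ u)
    (h₃ : P _ _ (PathSimplex.id k (Fin.last (m.len + 1)))) {i j}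
    (u : PathSimplex (SimplexCategory.mk (m.len + 1)) k i j) : P i j u := by
  induction j using Fin.lastCases with
  | last =>
    induction i using Fin.lastCases with
    | last =>
      rw [u.eq_id]
      exact h₃
    | cast i => exact h₂ i u
  | cast j =>
    induction i using Fin.lastCases with
    | last => exact absurd (lt_of_lt_of_le (Fin.castSucc_lt_last j) u.src_le_tgt) (lt_irrefl _)
    | cast i => exact h₁ i j u

lemma restrict_baseElem {e' : T × SimplexCategory} (g : e' ⟶ e) {i j : Fin (m.len + 1)}
    (u : PathSimplex (SimplexCategory.mk (m.len + 1)) e.2 i.castSucc j.castSucc) :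
    (baseElem x f u).restrict g.op = baseElem x (g ≫ f) (u.restrict g.2) := by
  have h : ((x.map p.hom).res (𝟙 m) f).res (𝟙 m) g = (x.map p.hom).res (𝟙 m) (g ≫ f) := by
    rw [Simplex.res_res, Category.id_comp]
  rw [baseElem, HomAt.restrict_cast, restrict_baseGen, baseGen_congr _ h, HomAt.cast_cast,
    HomAt.cast_cast, baseElem]

lemma restrict_coneElem {e' : T × SimplexCategory} (g : e' ⟶ e) {i : Fin (m.len + 1)}
    (u : PathSimplex (SimplexCategory.mk (m.len + 1)) e.2 i.castSucc (Fin.last (m.len + 1))) :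
    (coneElem x f u).restrict g = coneElem x (g ≫ f) (u.restrict g.2) := by
  have h : (x.res (𝟙 m) f).res (𝟙 m) g = x.res (𝟙 m) (g ≫ f) := by
    rw [Simplex.res_res, Category.id_comp]
  simp only [ConeGen.restrict, coneElem]
  refine ConeGen.mk_congr h ?_ rfl
  rw [HomAt.restrict_cast, HomAt.restrict_id]
  exact (HomAt.cast_cast _ _ _ _ _).trans (HomAt.cast_cast _ _ _ _ _)

/-- Compatibility of the universal simplex with composition is the relation `slide`. -/
lemma coneElem_comp {i j : Fin (m.len + 1)}
    (q : PathSimplex (SimplexCategory.mk (m.len + 1)) e.2 i.castSucc j.castSucc)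
    (u : PathSimplex (SimplexCategory.mk (m.len + 1)) e.2 j.castSucc (Fin.last (m.len + 1))) :
    ((coneElem x f u).precomp (baseElem x f q)).toSt = (coneElem x f (q.comp u)).toSt := by
  have h := ConeGen.Rel.slide (x.res (𝟙 m) f) (i := i) ((HomAt.id (op e) _).cast rfl
    (ConeGen.vtx_map_res_id x f i).symm) q u
  refine Eq.trans ?_ (Quot.sound h)
  refine congrArg (Quot.mk _) (ConeGen.mk_congr rfl ?_ rfl)
  rw [HomAt.id_cast_comp, baseGen_congr _ (Simplex.map_res p.hom x _ _)]
  refine (HomAt.comp_id_cast _ _).trans ?_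
  exact (HomAt.cast_cast _ _ _ _ _).trans (HomAt.cast_cast _ _ _ _ _).symm

/-- The universal `(m+1)`-simplex on an `m`-simplex `x` of `P` in the nerve of the collage of the
straightening of `P`. -/
def coneSimplex :
    NerveSimplex (Collage (explicitStPresheaf p)) (SimplexCategory.mk (m.len + 1)) d where
  obj := coneObj x
  map f u := coneMor x f _ _ u
  map_restrict {i j e e'} g f u := by
    induction u using path_cases with
    | h₁ i j u =>
      rw [coneMor_castSucc_castSucc, coneMor_castSucc_castSucc, HomAt.restrict_cast, restrict_ofHom,
        restrict_baseElem]
    | h₂ i u =>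
      rw [coneMor_castSucc_last, coneMor_castSucc_last, HomAt.restrict_cast, restrict_ofElem,
        ConeGen.map_toSt, restrict_coneElem]
    | h₃ => rw [coneMor_last_last, coneMor_last_last, HomAt.restrict_id]
  map_id {e} f i := by
    induction i using Fin.lastCases with
    | last => rw [coneMor_last_last]
    | cast i =>
      rw [coneMor_castSucc_castSucc, baseElem, baseGen_id, HomAt.cast_id, ofHom_id, HomAt.cast_id]
  map_comp {i j l e} f u v := by
    induction v using path_cases with
    | h₁ j l v =>
      induction i using Fin.lastCases with
      | last => exact absurd (lt_of_lt_of_le (Fin.castSucc_lt_last j) u.src_le_tgt) (lt_irrefl _)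
      | cast i =>
        rw [coneMor_castSucc_castSucc, coneMor_castSucc_castSucc, coneMor_castSucc_castSucc,
          ← HomAt.cast_comp, ← ofHom_comp, baseElem, baseGen_comp,
          HomAt.cast_comp _ (vtx_res_id _ f j) _]
        rfl
    | h₂ j v =>
      induction i using Fin.lastCases with
      | last => exact absurd (lt_of_lt_of_le (Fin.castSucc_lt_last j) u.src_le_tgt) (lt_irrefl _)
      | cast i =>
        rw [coneMor_castSucc_castSucc, coneMor_castSucc_last, coneMor_castSucc_last,
          ← HomAt.cast_comp, ofHom_comp_ofElem, ConeGen.act_toSt, coneElem_comp]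
    | h₃ => rw [coneMor_last_last, HomAt.comp_id, PathSimplex.comp_id]

lemma coneSimplex_map_last {i : Fin (m.len + 1)} {s t : Fin (m.len + 1 + 1)}
    (hs : s = i.castSucc) (ht : t = Fin.last (m.len + 1))
    (u : PathSimplex (SimplexCategory.mk (m.len + 1)) e.2 s t) :
    (coneSimplex x).map f u = (ofElem (coneElem x f (u.cast hs ht)).toSt).cast
      ((coneObj_castSucc x i).symm.trans (congrArg (coneObj x) hs.symm))
      ((coneObj_last x).symm.trans (congrArg (coneObj x) ht.symm)) := by
  subst hs ht
  exact coneMor_castSucc_last x f u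

/-- The face of the universal simplex on `x` opposite to the cone point is the image of `x`. -/
lemma coneSimplex_restrict_coneIncl :
    (coneSimplex x).restrict (coneIncl m) (𝟙 d) =
      toNerveSimplex (incl (explicitStPresheaf p)) (x.map p.hom) := by
  refine NerveSimplex.ext_cast (fun i => coneObj_castSucc x i) ?_
  intro i j e f u
  have h : baseElem x (f ≫ 𝟙 d) (i := i) (j := j) (u.push (coneIncl m)) =
      (gen ((x.map p.hom).res (𝟙 m) f) u).cast (vtx_res_id _ f i) (vtx_res_id _ f j) := by
    rw [Category.comp_id]
    exact congrArg (HomAt.cast _ _) (baseGen_push _ u)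
  refine (congrArg (HomAt.cast _ _) (coneMor_castSucc_castSucc x (f ≫ 𝟙 d)
    (i := i) (j := j) (u.push (coneIncl m)))).trans ((HomAt.cast_cast _ _ _ _ _).trans ?_)
  exact (congrArg ofHom h).trans (ofHom_cast _ _ _)

end ConeSimplex

end UniversalSimplex

/-! ### The comparison map on representables -/

section Comparison

variable {T : Type} [SmallCategory T] [HasTerminal T] {W : PCat T}

open Coh

lemma map_baseGen {Z : PCat T} (v : W ⟶ Z) {m : SimplexCategory} {d : T × SimplexCategory}
    (s : Simplex W.obj m d) {i j : Fin (m.len + 1)}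
    (q : PathSimplex (SimplexCategory.mk (m.len + 1)) d.2 i.castSucc j.castSucc) :
    (baseGen s q).map (functor v) =
      (baseGen (s.map v.hom) q).cast (onObj_vtx v s i).symm (onObj_vtx v s j).symm := by
  refine (HomAt.map_cast _ _ _ _).trans ?_
  rw [map_gen, baseGen]
  exact (HomAt.cast_cast _ _ _ _ _).trans (HomAt.cast_cast _ _ _ _ _).symm

section CellElem

variable {Z Y : PCat T} {c c' : SimplexCategory × (T × SimplexCategory)}

/-- The simplex of `Z` given by a map `L F[m, d] ⟶ Z`. -/
def cellElem : (cell.obj c ⟶ Z) ≃ Simplex Z.obj c.1 c.2 :=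
  ((toPCatAdj T).homEquiv (yoneda.obj c) Z).trans yonedaEquiv

lemma cellElem_map_comp (f : c' ⟶ c) (v : cell.obj c ⟶ Z) :
    cellElem (cell.map f ≫ v) = (cellElem v).res f.1 f.2 := by
  refine (congrArg yonedaEquiv ((toPCatAdj T).homEquiv_naturality_left (yoneda.map f) v)).trans ?_
  exact (yonedaEquiv_naturality _ f).symm

lemma cellElem_comp (v : cell.obj c ⟶ Z) (w : Z ⟶ Y) :
    cellElem (v ≫ w) = (cellElem v).map w.hom :=
  congrArg yonedaEquiv ((toPCatAdj T).homEquiv_naturality_right v w)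

lemma cellVertex_eq (i : Fin (c.1.len + 1)) :
    cellVertex c i = vtx (cellElem (𝟙 (cell.obj c))) i := by
  have h : cellElem (𝟙 (cell.obj c)) = ((toPCatAdj T).unit.app (yoneda.obj c)).app (op c) (𝟙 c) :=
    congrArg yonedaEquiv ((toPCatAdj T).homEquiv_id _)
  rw [h]
  refine congrArg (ofVertex _ (op c.2)) ?_
  refine Eq.trans ?_ (NatTrans.naturality_apply ((toPCatAdj T).unit.app (yoneda.obj c))
    (Prod.mkHom (SimplexCategory.const (SimplexCategory.mk 0) c.1 i) (𝟙 c.2)).op (𝟙 c))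
  exact congrArg (((toPCatAdj T).unit.app (yoneda.obj c)).app _) (Category.comp_id _).symm

end CellElem

variable (σ : Elements W)

/-- The object of the slice category given by an element of `W`. -/
abbrev overRep : Over W.obj := Over.mk σ.hom

/-- The tautological simplex of the representable at `σ`. -/
def tautSimplex : Simplex (overRep σ).left σ.left.1 σ.left.2 := 𝟙 σ.left

omit [HasTerminal T] in
lemma tautSimplex_res {n : SimplexCategory} {e : T × SimplexCategory} (α : n ⟶ σ.left.1)
    (f : e ⟶ σ.left.2) : (tautSimplex σ).res α f = Prod.mkHom α f :=
  Category.comp_id (Prod.mkHom α f : (n, e) ⟶ σ.left)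

lemma cellElem_transpose : cellElem (transpose σ) = (tautSimplex σ).map (overRep σ).hom :=
  congrArg yonedaEquiv (((toPCatAdj T).homEquiv _ _).apply_symm_apply σ.hom)

/-- The `(m+1)`-simplex of `W_σ` given by the canonical map `L F[m+1, θ, k] ⟶ W_σ`. -/
def coneCell : Simplex (conePushout σ).obj (SimplexCategory.mk (σ.left.1.len + 1)) σ.left.2 :=
  cellElem (c := coneFunctor.obj σ.left) (fromCell σ)

lemma coneCell_res_coneIncl :
    (coneCell σ).res (coneIncl σ.left.1) (𝟙 σ.left.2) =
      ((tautSimplex σ).map (overRep σ).hom).map (fromBase σ).hom := by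
  have h : cell.map (toCone.app σ.left) ≫ fromCell σ = transpose σ ≫ fromBase σ :=
    pushout.condition
  have h' := congrArg (cellElem (c := σ.left)) h
  refine (cellElem_map_comp (toCone.app σ.left) (fromCell σ)).symm.trans (h'.trans ?_)
  rw [cellElem_comp, cellElem_transpose]

lemma vtx_coneCell_last : vtx (coneCell σ) (Fin.last _) = coneTop σ := by
  rw [coneTop, cellVertex_eq, onObj_vtx, ← cellElem_comp, Category.id_comp]
  rfl

/-- The simplex of `W_σ` given by the cone on a simplex of the representable at `σ`. -/
def coneCellAt {n : SimplexCategory} {e : T × SimplexCategory} (y : Simplex (overRep σ).left n e) :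
    Simplex (conePushout σ).obj (SimplexCategory.mk (n.len + 1)) e :=
  (coneCell σ).res (coneMap (show (n, e) ⟶ σ.left from y).1) (show (n, e) ⟶ σ.left from y).2

section coneCellAt

variable {n n' : SimplexCategory} {e e' : T × SimplexCategory} (y : Simplex (overRep σ).left n e)

lemma coneCellAt_res (α : n' ⟶ n) (g : e' ⟶ e) :
    coneCellAt σ (y.res α g) = (coneCellAt σ y).res (coneMap α) g := by
  refine Eq.trans ?_ (Simplex.res_res _ _ _ _ _).symm
  rw [← coneMap_comp]
  rfl

lemma coneCellAt_res_coneIncl :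
    (coneCellAt σ y).res (coneIncl n) (𝟙 e) =
      (y.map (overRep σ).hom).map (fromBase σ).hom := by
  have hy : (tautSimplex σ).res (show (n, e) ⟶ σ.left from y).1 (show (n, e) ⟶ σ.left from y).2 =
      y := tautSimplex_res σ _ _
  rw [← hy, Simplex.map_res, Simplex.map_res, ← coneCell_res_coneIncl, Simplex.res_res, hy,
    coneCellAt, Simplex.res_res, coneIncl_naturality]
  simp

lemma vtx_coneCellAt_castSucc (i : Fin (n.len + 1)) :
    vtx (coneCellAt σ y) i.castSucc =
      onObj (fromBase σ) (vtx (y.map (overRep σ).hom) i) := by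
  rw [onObj_vtx, ← coneCellAt_res_coneIncl, vtx_res]
  rfl

lemma vtx_coneCellAt_last : vtx (coneCellAt σ y) (Fin.last _) = coneTop σ := by
  rw [coneCellAt, vtx_res, coneMap_last]
  exact vtx_coneCell_last σ

/-- The morphism of `𝔠 W_σ` to the cone point given by a generator. -/
def coneGenHom {a : Coh W} (z : ConeGen (overRep σ) e a) :
    HomAt (op e) (onObj (fromBase σ) a) (coneTop σ) :=
  (z.hom.map (functor (fromBase σ))).comp ((gen (coneCellAt σ z.simplex) z.path).cast
    (vtx_coneCellAt_castSucc σ z.simplex z.i) (vtx_coneCellAt_last σ z.simplex))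

lemma map_baseGen_coneCellAt {i j : Fin (n.len + 1)}
    (q : PathSimplex (SimplexCategory.mk (n.len + 1)) e.2 i.castSucc j.castSucc) :
    (baseGen (y.map (overRep σ).hom) q).map (functor (fromBase σ)) =
      (gen (coneCellAt σ y) q).cast (vtx_coneCellAt_castSucc σ y i)
        (vtx_coneCellAt_castSucc σ y j) := by
  rw [map_baseGen, baseGen_congr _ (coneCellAt_res_coneIncl σ y).symm, baseGen_coneIncl]
  exact (HomAt.cast_cast _ _ _ _ _).trans (HomAt.cast_cast _ _ _ _ _)

lemma coneGenHom_rel {a : Coh W} {z w : ConeGen (overRep σ) e a}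
    (h : ConeGen.Rel (overRep σ) e a z w) : coneGenHom σ z = coneGenHom σ w := by
  cases h with
  | @slide m x i j f q u =>
    simp only [coneGenHom]
    rw [HomAt.map_comp, map_baseGen_coneCellAt, gen_comp]
    exact (HomAt.assoc _ _ _).trans (congrArg (HomAt.comp _) (HomAt.cast_comp _ _ _ _ _).symm)
  | @pull m m' α x i f u =>
    simp only [coneGenHom]
    have hv : onObj (fromBase σ) (vtx (x.map (overRep σ).hom) (α.toOrderHom i)) =
        onObj (fromBase σ) (vtx ((x.res α (𝟙 e)).map (overRep σ).hom) i) :=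
      congrArg (onObj (fromBase σ)) (ConeGen.vtx_map_res x α (𝟙 e) i).symm
    have h : (gen (coneCellAt σ (x.res α (𝟙 e))) u).cast
        (vtx_coneCellAt_castSucc σ (x.res α (𝟙 e)) i) (vtx_coneCellAt_last σ (x.res α (𝟙 e))) =
        ((gen (coneCellAt σ x) ((u.push (coneMap α)).cast (coneMap_castSucc α i)
          (coneMap_last α))).cast (vtx_coneCellAt_castSucc σ x _)
            (vtx_coneCellAt_last σ x)).cast hv rfl := by
      rw [gen_congr (coneCellAt_res σ x α (𝟙 e)), gen_res, gen_cast, HomAt.cast_cast,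
        HomAt.cast_cast, HomAt.cast_cast, HomAt.cast_cast]
    exact (HomAt.cast_comp_cast hv _ _).symm.trans
      (congrArg₂ HomAt.comp (HomAt.map_cast _ _ _ _).symm h.symm)

end coneCellAt

section coneCellAt

variable {e e' : T × SimplexCategory} {a b : Coh W}

lemma coneGenHom_restrict (g : e' ⟶ e) (z : ConeGen (overRep σ) e a) :
    coneGenHom σ (z.restrict g) = (coneGenHom σ z).restrict g.op := by
  have hv := congrArg (onObj (fromBase σ)) (ConeGen.vtx_map_res_id z.simplex g z.i).symm
  have e : coneCellAt σ (z.simplex.res (𝟙 _) g) = (coneCellAt σ z.simplex).res (𝟙 _) g := by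
    rw [coneCellAt_res, coneMap_id]
  have h : (gen (coneCellAt σ (z.simplex.res (𝟙 _) g)) (z.path.restrict g.2)).cast
      (vtx_coneCellAt_castSucc σ _ z.i) (vtx_coneCellAt_last σ _) =
      (((gen (coneCellAt σ z.simplex) z.path).cast (vtx_coneCellAt_castSucc σ z.simplex z.i)
        (vtx_coneCellAt_last σ z.simplex)).restrict g.op).cast hv rfl := by
    rw [gen_congr e, HomAt.restrict_cast, restrict_gen, HomAt.cast_cast, HomAt.cast_cast,
      HomAt.cast_cast]
  refine (congrArg₂ HomAt.comp (HomAt.map_cast (functor (fromBase σ)) rfl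
    (ConeGen.vtx_map_res_id z.simplex g z.i).symm (z.hom.restrict g.op)) h).trans ?_
  refine (HomAt.cast_comp_cast hv _ _).trans ?_
  refine Eq.trans ?_ (HomAt.restrict_comp _ _ _).symm
  exact congrArg (fun t => HomAt.comp t _) (HomAt.map_restrict (functor (fromBase σ)) g.op z.hom)

lemma coneGenHom_precomp (g : HomAt (op e) a b) (z : ConeGen (overRep σ) e b) :
    coneGenHom σ (z.precomp g) = (g.map (functor (fromBase σ))).comp (coneGenHom σ z) := by
  simp only [coneGenHom, ConeGen.precomp]
  rw [HomAt.map_comp]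
  exact HomAt.assoc _ _ _

end coneCellAt

/-- The comparison map from the explicit straightening of a representable. -/
def fromExplicit : explicitStPresheaf (overRep σ) ⟶ (stElements W).obj σ :=
  EPresheaf.Hom.mk
    (fun a =>
      { app d := ↾Quot.lift (coneGenHom σ (e := d.unop)) (fun _ _ => coneGenHom_rel σ)
        naturality d d' κ := by
          ext z
          induction z using Quot.ind with
          | mk z => exact coneGenHom_restrict σ κ.unop z })
    (fun a b => by
      ext d y
      obtain ⟨g, z⟩ := y
      induction z using Quot.ind with
      | mk z => exact (coneGenHom_precomp σ g z).symm)

end Comparison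

/-! ### The comparison map on representables is invertible -/

section Comparison

variable {T : Type} [SmallCategory T] [HasTerminal T] {W : PCat T} (σ : Elements W)

open Coh

lemma coneCellAt_tautSimplex_res {e : T × SimplexCategory} (f : e ⟶ σ.left.2) :
    coneCellAt σ ((tautSimplex σ).res (𝟙 _) f) = (coneCell σ).res (𝟙 _) f := by
  rw [tautSimplex_res]
  exact congrArg (fun α => (coneCell σ).res α f) (coneMap_id _)

lemma coneCellAt_tautSimplex : coneCellAt σ (tautSimplex σ) = coneCell σ := by
  have h := coneCellAt_tautSimplex_res σ (𝟙 _)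
  rwa [Simplex.res_self, Simplex.res_self] at h

/-- The universal `(m+1)`-simplex of the nerve of the collage, as a map out of `L F[m+1, θ, k]`. -/
def universalCell : cell.obj (coneFunctor.obj σ.left) ⟶
    enrichedNerve T (Collage (explicitStPresheaf (overRep σ))) :=
  cellElem.symm (coneSimplex (tautSimplex σ))

lemma cellElem_universalCell :
    cellElem (c := coneFunctor.obj σ.left) (universalCell σ) = coneSimplex (tautSimplex σ) :=
  Equiv.apply_symm_apply _ _

/-- The map from `W_σ` to the nerve of the collage given by the universal `(m+1)`-simplex. -/
def toCollageNerve : conePushout σ ⟶ enrichedNerve T (Collage (explicitStPresheaf (overRep σ))) :=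
  pushout.desc (universalCell σ) (toNerve (Collage.incl _)) (by
    apply (cellElem (c := σ.left)).injective
    refine (cellElem_map_comp (toCone.app σ.left) _).trans ?_
    rw [cellElem_comp, cellElem_transpose]
    exact (congrArg (fun s => Simplex.res s (coneIncl σ.left.1) (𝟙 σ.left.2))
      (cellElem_universalCell σ)).trans (coneSimplex_restrict_coneIncl (tautSimplex σ)))

lemma fromBase_toCollageNerve : fromBase σ ≫ toCollageNerve σ = toNerve (Collage.incl _) :=
  pushout.inr_desc _ _ _

lemma fromCell_toCollageNerve : fromCell σ ≫ toCollageNerve σ = universalCell σ :=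
  pushout.inl_desc _ _ _

lemma nerveApp_coneCell : nerveApp (toCollageNerve σ) (coneCell σ) = coneSimplex (tautSimplex σ) :=
  (cellElem_comp (fromCell σ) (toCollageNerve σ)).symm.trans
    ((congrArg cellElem (fromCell_toCollageNerve σ)).trans (cellElem_universalCell σ))

/-- The enriched functor from `𝔠 W_σ` to the collage given by the universal `(m+1)`-simplex. -/
def toCollage : EnrichedFunctor (Space T) (Coh (conePushout σ))
    (Collage (explicitStPresheaf (overRep σ))) :=
  ofNerve (toCollageNerve σ)

/-- The enriched functor from the collage to `𝔠 W_σ` given by the comparison map. -/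
def fromCollage : EnrichedFunctor (Space T) (Collage (explicitStPresheaf (overRep σ)))
    (Coh (conePushout σ)) :=
  Collage.desc (functor (fromBase σ)) (coneTop σ) (fromExplicit σ)

lemma toNerve_functor_comp_toCollage :
    toNerve ((functor (fromBase σ)).comp (Space T) (toCollage σ)) = toNerve (Collage.incl _) := by
  rw [toNerve_naturality_left, toCollage, toNerve_ofNerve, fromBase_toCollageNerve]

lemma toCollage_obj_base (a : Coh W) :
    (toCollage σ).obj (onObj (fromBase σ) a) = Collage.base _ a :=
  obj_eq_of_toNerve_eq (toNerve_functor_comp_toCollage σ) a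

lemma toCollage_obj_top : (toCollage σ).obj (coneTop σ) = Collage.top _ := by
  refine (congrArg (toCollage σ).obj (vtx_coneCell_last σ).symm).trans ?_
  refine (liftObj_vtx (toCollageNerve σ) (coneCell σ) _).trans ?_
  rw [nerveApp_coneCell]
  exact coneObj_last _

lemma vtx_coneCell_castSucc (i : Fin (σ.left.1.len + 1)) :
    vtx (coneCell σ) i.castSucc =
      onObj (fromBase σ) (vtx ((tautSimplex σ).map (overRep σ).hom) i) := by
  rw [← vtx_coneCellAt_castSucc, coneCellAt_tautSimplex]

lemma fromCollage_obj_coneObj (i : Fin (σ.left.1.len + 1 + 1)) :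
    (fromCollage σ).obj (coneObj (tautSimplex σ) i) = vtx (coneCell σ) i := by
  induction i using Fin.lastCases with
  | last =>
    rw [coneObj_last, vtx_coneCell_last]
    rfl
  | cast i =>
    rw [coneObj_castSucc, vtx_coneCell_castSucc]
    rfl

lemma map_baseElem_tautSimplex {e : T × SimplexCategory} (f : e ⟶ σ.left.2)
    {i j : Fin (σ.left.1.len + 1)}
    (u : PathSimplex (SimplexCategory.mk (σ.left.1.len + 1)) e.2 i.castSucc j.castSucc) :
    (baseElem (tautSimplex σ) f u).map (functor (fromBase σ)) =
      (gen ((coneCell σ).res (𝟙 _) f) u).cast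
        ((vtx_res_id _ f _).trans (vtx_coneCell_castSucc σ i))
        ((vtx_res_id _ f _).trans (vtx_coneCell_castSucc σ j)) := by
  rw [baseElem, baseGen_congr _ (Simplex.map_res (overRep σ).hom (tautSimplex σ) (𝟙 _) f).symm]
  refine (congrArg (HomAt.map _) (HomAt.cast_cast _ _ _ _ _)).trans ?_
  refine (HomAt.map_cast _ _ _ _).trans ?_
  rw [map_baseGen_coneCellAt, gen_congr (coneCellAt_tautSimplex_res σ f)]
  exact (HomAt.cast_cast _ _ _ _ _).trans (HomAt.cast_cast _ _ _ _ _)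

lemma coneGenHom_coneElem_tautSimplex {e : T × SimplexCategory} (f : e ⟶ σ.left.2)
    {i : Fin (σ.left.1.len + 1)}
    (u : PathSimplex (SimplexCategory.mk (σ.left.1.len + 1)) e.2 i.castSucc (Fin.last _)) :
    coneGenHom σ (coneElem (tautSimplex σ) f u) =
      (gen ((coneCell σ).res (𝟙 _) f) u).cast
        ((vtx_res_id _ f _).trans (vtx_coneCell_castSucc σ i))
        ((vtx_res_id _ f _).trans (vtx_coneCell_last σ)) := by
  have h : vtx ((tautSimplex σ).map (overRep σ).hom) i =
      vtx (((tautSimplex σ).res (𝟙 _) f).map (overRep σ).hom) i :=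
    (ConeGen.vtx_map_res_id (tautSimplex σ) f i).symm
  refine (congrArg (fun t => HomAt.comp t _) ((HomAt.map_cast (functor (fromBase σ)) rfl h
    (HomAt.id (op e) _)).trans (congrArg (HomAt.cast _ _)
      (HomAt.map_id (functor (fromBase σ)))))).trans ?_
  refine (HomAt.id_cast_comp _ _).trans ?_
  simp only [coneElem]
  rw [gen_congr (coneCellAt_tautSimplex_res σ f)]
  exact (HomAt.cast_cast _ _ _ _ _).trans (HomAt.cast_cast _ _ _ _ _)

lemma mapFunctor_coneSimplex_tautSimplex :
    NerveSimplex.mapFunctor (fromCollage σ) (coneSimplex (tautSimplex σ)) =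
      toNerveSimplex (EnrichedFunctor.id (Space T) _) (coneCell σ) := by
  refine NerveSimplex.ext_cast (fromCollage_obj_coneObj σ) ?_
  intro i j e f u
  have hu : ((coneMor (tautSimplex σ) f _ _ u).map (fromCollage σ)).cast
      (fromCollage_obj_coneObj σ i) (fromCollage_obj_coneObj σ j) =
      (gen ((coneCell σ).res (𝟙 _) f) u).cast (vtx_res_id _ f _) (vtx_res_id _ f _) := by
    induction u using path_cases with
    | h₁ i j u =>
      rw [coneMor_castSucc_castSucc, HomAt.map_cast]
      refine (HomAt.cast_cast _ _ _ _ _).trans ?_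
      refine (congrArg (HomAt.cast _ _) (map_baseElem_tautSimplex σ f u)).trans ?_
      exact HomAt.cast_cast _ _ _ _ _
    | h₂ i u =>
      rw [coneMor_castSucc_last, HomAt.map_cast]
      refine (HomAt.cast_cast _ _ _ _ _).trans ?_
      refine (congrArg (HomAt.cast _ _) (coneGenHom_coneElem_tautSimplex σ f u)).trans ?_
      exact HomAt.cast_cast _ _ _ _ _
    | h₃ =>
      rw [coneMor_last_last, HomAt.map_id, gen_id]
      exact (HomAt.cast_id _).trans (HomAt.cast_id _).symm
  exact hu

/-- The composite of the comparison functors has the same transpose as the identity of `𝔠 W_σ`. By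
`map_eq_of_toNerve_eq` it is the identity, up to the identification of objects. -/
lemma toNerve_toCollage_comp_fromCollage :
    toNerve ((toCollage σ).comp (Space T) (fromCollage σ)) =
      toNerve (EnrichedFunctor.id (Space T) (Coh (conePushout σ))) := by
  rw [toNerve_naturality_right, toCollage, toNerve_ofNerve]
  apply pushout.hom_ext
  · refine (Category.assoc (fromCell σ) _ _).symm.trans ?_
    refine Eq.trans ?_ (rfl : fromCell σ ≫ _ = _)
    apply (cellElem (c := coneFunctor.obj σ.left)).injective
    rw [fromCell_toCollageNerve, cellElem_comp, cellElem_comp]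
    refine (congrArg (Simplex.map (enrichedNerveMap (fromCollage σ)).hom)
      (cellElem_universalCell σ)).trans (mapFunctor_coneSimplex_tautSimplex σ)
  · refine (Category.assoc (fromBase σ) _ _).symm.trans ?_
    refine Eq.trans ?_ (rfl : fromBase σ ≫ _ = _)
    rw [fromBase_toCollageNerve, ← toNerve_naturality_right, ← toNerve_naturality_left]
    ext c s
    exact NerveSimplex.ext_cast (fun _ => rfl) (fun f u => rfl)

end Comparison

section Comparison

variable {T : Type} [SmallCategory T] [HasTerminal T] {W : PCat T} (σ : Elements W)

open Coh

lemma map_functor_map_toCollage {d : T × SimplexCategory} {a b : Coh W} (f : HomAt (op d) a b) :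
    ((f.map (functor (fromBase σ))).map (toCollage σ)).cast (toCollage_obj_base σ a)
      (toCollage_obj_base σ b) = Collage.ofHom f :=
  map_eq_of_toNerve_eq (toNerve_functor_comp_toCollage σ) f

/-- The generator given by a simplex of the representable at `σ` and an arrow of `c^h Δ[n+1]` to
`n+1`. -/
def simplexGen {n : SimplexCategory} {e : T × SimplexCategory} (y : Simplex (overRep σ).left n e)
    {i : Fin (n.len + 1)}
    (u : PathSimplex (SimplexCategory.mk (n.len + 1)) e.2 i.castSucc (Fin.last _)) :
    ConeGen (overRep σ) e (vtx (y.map (overRep σ).hom) i) :=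
  ⟨n, y, i, HomAt.id (op e) _, u⟩

lemma ofElem_cast {p : Over W.obj} {e : T × SimplexCategory} {a b : Coh W} (h : a = b)
    (z : ConeGen p e a) :
    (Collage.ofElem z.toSt).cast (congrArg (Collage.base (explicitStPresheaf p)) h) rfl =
      Collage.ofElem (z.precomp ((HomAt.id (op e) b).cast rfl h.symm)).toSt := by
  subst h
  exact congrArg (fun f => Collage.ofElem (F := explicitStPresheaf p)
    (ConeGen.toSt ⟨z.m, z.simplex, z.i, f, z.path⟩)) (HomAt.id_comp z.hom).symm

/-- The universal simplex, restricted along a simplex `y` of the representable, recovers the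
generators at `y`; this is the relation `pull`. -/
lemma coneSimplex_tautSimplex_map {n : SimplexCategory} {e : T × SimplexCategory}
    (y : Simplex (overRep σ).left n e) {i : Fin (n.len + 1)}
    (u : PathSimplex (SimplexCategory.mk (n.len + 1)) e.2 i.castSucc (Fin.last _)) (h h') :
    (((coneSimplex (tautSimplex σ)).restrict (coneMap (show (n, e) ⟶ σ.left from y).1)
      (show (n, e) ⟶ σ.left from y).2).map (𝟙 e) u).cast h h' =
      Collage.ofElem (simplexGen σ y u).toSt := by
  let α : n ⟶ σ.left.1 := (show (n, e) ⟶ σ.left from y).1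
  let g : e ⟶ σ.left.2 := (show (n, e) ⟶ σ.left from y).2
  have hy : (tautSimplex σ).res α g = y := tautSimplex_res σ α g
  have hv : vtx (y.map (overRep σ).hom) i =
      vtx ((tautSimplex σ).map (overRep σ).hom) (α.toOrderHom i) := by
    rw [← hy, ConeGen.vtx_map_res]
  let w : PathSimplex (SimplexCategory.mk (σ.left.1.len + 1)) e.2 (α.toOrderHom i).castSucc
    (Fin.last _) := (u.push (coneMap α)).cast (coneMap_castSucc α i) (coneMap_last α)
  refine (congrArg (HomAt.cast _ _) (coneSimplex_map_last (tautSimplex σ) (𝟙 e ≫ g)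
    (coneMap_castSucc α i) (coneMap_last α) (u.push (coneMap α)))).trans ?_
  refine (HomAt.cast_cast _ _ _ _ _).trans ?_
  refine (ofElem_cast hv.symm
    (coneElem (tautSimplex σ) (𝟙 e ≫ g) w)).trans ?_
  rw [Category.id_comp]
  have hp := ConeGen.Rel.pull α ((tautSimplex σ).res (𝟙 _) g) (i := i)
    (((HomAt.id (op e) _).cast rfl hv).comp ((HomAt.id (op e) _).cast rfl
      (ConeGen.vtx_map_res_id (tautSimplex σ) g (α.toOrderHom i)).symm)) u
  refine congrArg Collage.ofElem ((Quot.sound hp).trans (congrArg (Quot.mk _) ?_))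
  refine ConeGen.mk_congr ?_ ?_ rfl
  · rw [Simplex.res_res, Category.comp_id, Category.id_comp]
    exact hy
  · rw [HomAt.id_cast_comp]
    refine ((HomAt.cast_cast _ _ _ _ _).trans (HomAt.cast_cast _ _ _ _ _)).trans ?_
    refine (HomAt.cast_cast _ _ _ _ _).trans ?_
    exact HomAt.cast_id _

/-- `toCollage` sends the morphism given by a generator back to the class of that generator. -/
lemma map_toCollage_coneGenHom {e : T × SimplexCategory} {a : Coh W} (z : ConeGen (overRep σ) e a) :
    ((coneGenHom σ z).map (toCollage σ)).cast (toCollage_obj_base σ a) (toCollage_obj_top σ) =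
      Collage.ofElem z.toSt := by
  obtain ⟨n, y, i, f, u⟩ := z
  have h₁ : ((gen (coneCellAt σ y) u).map (toCollage σ)).cast
      ((congrArg (toCollage σ).obj (vtx_coneCellAt_castSucc σ y i)).trans
        (toCollage_obj_base σ _))
      ((congrArg (toCollage σ).obj (vtx_coneCellAt_last σ y)).trans (toCollage_obj_top σ)) =
      Collage.ofElem (simplexGen σ y u).toSt := by
    have h₂ : nerveApp (toCollageNerve σ) (coneCellAt σ y) =
        (coneSimplex (tautSimplex σ)).restrict (coneMap (show (n, e) ⟶ σ.left from y).1)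
          (show (n, e) ⟶ σ.left from y).2 := by
      rw [← nerveApp_coneCell]
      exact nerveApp_res _ _ _ _
    refine (HomAt.cast_cast _ _ _ _ _).trans ?_
    refine (NerveSimplex.map_congr h₂ (𝟙 e) u _ _).trans ?_
    exact coneSimplex_tautSimplex_map σ y u _ _
  refine (HomAt.cast_map_comp (toCollage σ) (toCollage_obj_base σ a) (toCollage_obj_base σ _)
    (toCollage_obj_top σ) (f.map (functor (fromBase σ))) _).trans ?_
  refine (congrArg₂ HomAt.comp (map_functor_map_toCollage σ f) ((congrArg (HomAt.cast _ _)
    (HomAt.map_cast _ _ _ _)).trans ((HomAt.cast_cast _ _ _ _ _).trans h₁))).trans ?_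
  exact congrArg (fun f => Collage.ofElem (F := explicitStPresheaf (overRep σ))
    (ConeGen.toSt ⟨n, y, i, f, u⟩)) (HomAt.comp_id f)

/-- `toCollage` is a left inverse on morphisms to the cone point. -/
lemma coneGenHom_injective {e : T × SimplexCategory} {a : Coh W} {z w : ConeGen (overRep σ) e a}
    (h : coneGenHom σ z = coneGenHom σ w) : z.toSt = w.toSt := by
  have h' := map_toCollage_coneGenHom σ z
  rw [h] at h'
  exact h'.symm.trans (map_toCollage_coneGenHom σ w)

/-- Every morphism to the cone point is the image under `fromCollage` of a class of generators. -/
lemma coneGenHom_surjective {e : T × SimplexCategory} {a : Coh W}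
    (f : HomAt (op e) (onObj (fromBase σ) a) (coneTop σ)) :
    ∃ z : ConeGen (overRep σ) e a, coneGenHom σ z = f := by
  have h := map_eq_of_toNerve_eq (toNerve_toCollage_comp_fromCollage σ) f
  let y := (f.map (toCollage σ)).cast (toCollage_obj_base σ a) (toCollage_obj_top σ)
  obtain ⟨z, hz⟩ :=
    Quot.exists_rep (show ((explicitStPresheaf (overRep σ)).obj a).obj (op e) from y)
  refine ⟨z, ?_⟩
  have hy : y.map (fromCollage σ) = f :=
    (HomAt.map_cast _ _ _ _).trans h
  refine Eq.trans ?_ hy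
  have hz' : y = Collage.ofElem z.toSt := hz.symm
  rw [hz']
  rfl

/-- The explicit straightening of a representable is isomorphic to `St_W(σ)`. -/
def explicitIso : explicitStPresheaf (overRep σ) ≅ (stElements W).obj σ :=
  EPresheaf.isoMk
    (fun a => NatIso.ofComponents
      (fun d => (Equiv.ofBijective ((EPresheaf.Hom.app (fromExplicit σ) a).app d) (by
        constructor
        · intro y y' h
          induction y using Quot.ind
          induction y' using Quot.ind
          exact coneGenHom_injective σ h
        · intro f
          obtain ⟨z, hz⟩ := coneGenHom_surjective σ (e := d.unop) f
          exact ⟨z.toSt, hz⟩)).toIso)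
      (fun κ => (EPresheaf.Hom.app (fromExplicit σ) a).naturality κ))
    (fun a b => EPresheaf.naturality (fromExplicit σ) a b)

variable {σ} {τ : Elements W} (φ : σ ⟶ τ)

lemma mapHom_app_eq_cast {Z Y : PCat T} (v : Z ⟶ Y) {a b : Coh Z} {a' b' : Coh Y}
    (ha : onObj v a = a') (hb : onObj v b = b') {d : T × SimplexCategory} (f : HomAt (op d) a b) :
    (mapHom v ha hb).app (op d) f = (f.map (functor v)).cast ha hb := by
  subst ha hb
  rfl

/-- The map of representables over `W` induced by a map of elements. -/
abbrev overRepMap : overRep σ ⟶ overRep τ := (CostructuredArrow.toOver yoneda W.obj).map φ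

lemma coneCellAt_map {n : SimplexCategory} {e : T × SimplexCategory}
    (y : Simplex (overRep σ).left n e) :
    (coneCellAt σ y).map (conePushoutMap φ).hom =
      coneCellAt τ (y.map (overRepMap φ).left) := by
  have h : (coneCell σ).map (conePushoutMap φ).hom =
      (coneCell τ).res (coneMap φ.left.1) φ.left.2 := by
    refine (cellElem_comp (fromCell σ) (conePushoutMap φ)).symm.trans ?_
    rw [fromCell_map]
    exact cellElem_map_comp (coneFunctor.map φ.left) (fromCell τ)
  rw [coneCellAt, Simplex.map_res, h, Simplex.res_res, ← coneMap_comp]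
  rfl

lemma map_functor_conePushoutMap {d : T × SimplexCategory} {a b : Coh W} (f : HomAt (op d) a b) :
    ((f.map (functor (fromBase σ))).map (functor (conePushoutMap φ))).cast (onObj_fromBase φ a)
      (onObj_fromBase φ b) = f.map (functor (fromBase τ)) := by
  refine (mapHom_app_eq_cast _ _ _ _).symm.trans ?_
  have h := mapHom_comp (fromBase σ) (conePushoutMap φ) (a := a) (b := b) rfl rfl
    (onObj_fromBase φ a) (onObj_fromBase φ b) (onObj_fromBase φ a) (onObj_fromBase φ b)
  have h' := mapHom_congr (fromBase_map φ) (onObj_fromBase φ a) (onObj_fromBase φ b) rfl rfl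
  exact congrArg (fun t : (a ⟶[Space T] b) ⟶ _ => t.app (op d) f) (h.symm.trans h')

lemma coneGenHom_map {e : T × SimplexCategory} {a : Coh W} (z : ConeGen (overRep σ) e a) :
    coneGenHom τ (z.map (overRepMap φ)) =
      (mapHom (conePushoutMap φ) (onObj_fromBase φ a) (onObj_coneTop φ)).app (op e)
        (coneGenHom σ z) := by
  rw [mapHom_app_eq_cast]
  obtain ⟨n, y, i, f, u⟩ := z
  have hv := congrArg (onObj (fromBase τ))
    (ConeGen.vtx_map_map (overRepMap φ) y i)
  have h : ((gen (coneCellAt σ y) u).cast (vtx_coneCellAt_castSucc σ y i)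
      (vtx_coneCellAt_last σ y)).map (functor (conePushoutMap φ)) =
      ((gen (coneCellAt τ (y.map (overRepMap φ).left)) u).cast
        (vtx_coneCellAt_castSucc τ _ i) (vtx_coneCellAt_last τ _)).cast
          (hv.symm.trans (onObj_fromBase φ _).symm) (onObj_coneTop φ).symm := by
    refine (HomAt.map_cast _ _ _ _).trans ?_
    rw [map_gen, gen_congr (coneCellAt_map φ y)]
    exact (HomAt.cast_cast _ _ _ _ _).trans ((HomAt.cast_cast _ _ _ _ _).trans
      (HomAt.cast_cast _ _ _ _ _).symm)
  refine Eq.trans ?_ (HomAt.cast_map_comp (functor (conePushoutMap φ)) (onObj_fromBase φ a)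
    (onObj_fromBase φ _) (onObj_coneTop φ) (f.map (functor (fromBase σ))) _).symm
  refine Eq.trans ?_ (congrArg₂ HomAt.comp (map_functor_conePushoutMap φ f).symm
    ((congrArg (HomAt.cast _ _) h).trans (HomAt.cast_cast _ _ _ _ _)).symm)
  refine (congrArg (fun t => HomAt.comp t _) (HomAt.map_cast (functor (fromBase τ)) rfl
    (ConeGen.vtx_map_map (overRepMap φ) y i) f)).trans ?_
  exact HomAt.cast_comp_eq hv _ _

variable (W) in
/-- The explicit straightening restricts to `σ ↦ St_W(σ)` on the category of elements. -/
def explicitStElementsIso :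
    CostructuredArrow.toOver yoneda W.obj ⋙ explicitSt W ≅ stElements W :=
  NatIso.ofComponents explicitIso (fun φ => by
    ext a d z
    induction z using Quot.ind with
    | mk z => exact coneGenHom_map φ z)

end Comparison

/-! ### The explicit straightening as a left Kan extension -/

section KanExtension

variable {T : Type} [SmallCategory T] [HasTerminal T] {W : PCat T}

open Coh

variable {p : Over W.obj}

section SimplexHom

variable {m : SimplexCategory} {d : T × SimplexCategory} (x : Simplex p.left m d)

/-- The element of `W` under a simplex of `P`. -/
def elementAt : Elements W :=
  CostructuredArrow.mk (Y := (m, d)) (yonedaEquiv.symm x ≫ p.hom)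

/-- A simplex of `P` as a map from a representable over `W`. -/
def simplexHom : overRep (elementAt x) ⟶ p :=
  Over.homMk (yonedaEquiv.symm x) rfl

/-- The tautological simplex of the source of `simplexHom`. -/
def tautAt : Simplex (overRep (elementAt x)).left m d := 𝟙 (m, d)

omit [HasTerminal T] in
lemma tautAt_map : (tautAt x).map (simplexHom x).left = x :=
  yonedaEquiv.apply_symm_apply x

variable {σ : Elements W} (g : overRep σ ⟶ p) (y : Simplex (overRep σ).left m d)

omit [HasTerminal T] in
lemma yonedaEquiv_symm_map : yonedaEquiv.symm (y.map g.left) =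
    yoneda.map (show (m, d) ⟶ σ.left from y) ≫ g.left :=
  (Equiv.symm_apply_eq _).2 (congrArg (g.left.app (op (m, d)))
    (Category.id_comp (show (m, d) ⟶ σ.left from y)).symm)

/-- The map of representables over `P` given by a simplex of the source of a map `g` to `P`. -/
def elementAtMap : elementAt (y.map g.left) ⟶ σ :=
  CostructuredArrow.homMk (show (m, d) ⟶ σ.left from y)
    ((congrArg (yoneda.map (show (m, d) ⟶ σ.left from y) ≫ ·) (Over.w g).symm).trans
      ((Category.assoc _ _ _).symm.trans (congrArg (· ≫ p.hom) (yonedaEquiv_symm_map g y).symm)))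

omit [HasTerminal T] in
lemma overRepMap_elementAtMap_comp :
    overRepMap (elementAtMap g y) ≫ g = simplexHom (y.map g.left) :=
  Over.OverMorphism.ext (yonedaEquiv_symm_map g y).symm

omit [HasTerminal T] in
lemma tautAt_map_elementAtMap :
    (tautAt (y.map g.left)).map (overRepMap (elementAtMap g y)).left = y :=
  Category.id_comp (show (m, d) ⟶ σ.left from y)

end SimplexHom

namespace ConeGen

variable {d d' : T × SimplexCategory} {a b : Coh W}

/-- The generator at the tautological simplex whose image is a given generator. -/
def taut (z : ConeGen p d a) : ConeGen (overRep (elementAt z.simplex)) d a :=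
  ⟨z.m, tautAt z.simplex, z.i, z.hom.cast rfl (by
    rw [vtx_map_map (simplexHom z.simplex), tautAt_map]), z.path⟩

lemma taut_map (z : ConeGen p d a) : z.taut.map (simplexHom z.simplex) = z := by
  simp only [taut, map]
  refine mk_congr (tautAt_map z.simplex) ?_ rfl
  exact (HomAt.cast_cast _ _ _ _ _).trans (HomAt.cast_cast _ _ _ _ _)

lemma taut_map_map {σ : Elements W} (g : overRep σ ⟶ p) (z : ConeGen (overRep σ) d a) :
    (z.map g).taut.map (overRepMap (elementAtMap g z.simplex)) = z := by
  simp only [taut, map]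
  refine mk_congr (tautAt_map_elementAtMap g z.simplex) ?_ rfl
  exact ((HomAt.cast_cast _ _ _ _ _).trans (HomAt.cast_cast _ _ _ _ _)).trans
    (HomAt.cast_cast _ _ _ _ _)

/-- The relations between generators come from representables. -/
lemma Rel.exists_map {z w : ConeGen p d a} (h : Rel p d a z w) :
    ∃ (σ : Elements W) (g : overRep σ ⟶ p) (z' w' : ConeGen (overRep σ) d a),
      Rel (overRep σ) d a z' w' ∧ z'.map g = z ∧ w'.map g = w := by
  have hx {m : SimplexCategory} (x : Simplex p.left m d) : ∃ (σ : Elements W)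
      (g : overRep σ ⟶ p) (y : Simplex (overRep σ).left m d), x = y.map g.left :=
    ⟨_, simplexHom x, tautAt x, (tautAt_map x).symm⟩
  cases h with
  | @slide m x i j f q u =>
    obtain ⟨σ, g, y, rfl⟩ := hx x
    refine ⟨σ, g, _, _, Rel.slide y (f.cast rfl (vtx_map_map g y i).symm) q u, ?_, ?_⟩
    · simp only [map]
      have e : (y.map g.left).map p.hom = y.map (overRep σ).hom := by
        rw [← Over.w g]
        rfl
      refine mk_congr rfl ?_ rfl
      rw [baseGen_congr _ e.symm, HomAt.cast_comp rfl (vtx_map_map g y i) (vtx_map_map g y j)]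
      exact congrArg₂ HomAt.comp (HomAt.cast_cast _ _ _ _ _) (HomAt.cast_cast _ _ _ _ _)
    · simp only [map]
      refine mk_congr rfl ?_ rfl
      exact (HomAt.cast_cast _ _ _ _ _).trans (HomAt.cast_cast _ _ _ _ _)
  | @pull m m' α x i f u =>
    obtain ⟨σ, g, y, rfl⟩ := hx x
    refine ⟨σ, g, _, _, Rel.pull α y (f.cast rfl (vtx_map_map g y _).symm) u, ?_, ?_⟩
    · simp only [map]
      refine mk_congr rfl ?_ rfl
      exact (HomAt.cast_cast _ _ _ _ _).trans (HomAt.cast_cast _ _ _ _ _)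
    · simp only [map]
      refine mk_congr (Simplex.map_res g.left y α (𝟙 d)) ?_ rfl
      exact ((HomAt.cast_cast _ _ _ _ _).trans (HomAt.cast_cast _ _ _ _ _)).trans
        (HomAt.cast_cast _ _ _ _ _)

end ConeGen

section Desc

variable {F : EPresheaf (Space T) (Coh W)}
  (s : ∀ (σ : Elements W) (_ : overRep σ ⟶ p), explicitStPresheaf (overRep σ) ⟶ F)

/-- The map out of the explicit straightening given by a cocone, on generators. -/
def descGen {d : T × SimplexCategory} {a : Coh W} (z : ConeGen p d a) : (F.obj a).obj (op d) :=
  (EPresheaf.Hom.app (s _ (simplexHom z.simplex)) a).app (op d) z.taut.toSt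

variable (hs : ∀ {σ τ : Elements W} (φ : σ ⟶ τ) (g : overRep τ ⟶ p),
    (explicitSt W).map (overRepMap φ) ≫ s τ g = s σ (overRepMap φ ≫ g))
  {d d' : T × SimplexCategory} {a b : Coh W}

include hs

/-- On generators coming from a representable over `p`, the induced map is the given leg. -/
lemma descGen_map {σ : Elements W} (g : overRep σ ⟶ p) (z : ConeGen (overRep σ) d a) :
    descGen s (z.map g) = (EPresheaf.Hom.app (s σ g) a).app (op d) z.toSt := by
  have h := hs (elementAtMap g z.simplex) g
  rw [overRepMap_elementAtMap_comp] at h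
  have h' := congrArg (fun (t : explicitStPresheaf _ ⟶ F) =>
    (EPresheaf.Hom.app t a).app (op d) (z.map g).taut.toSt) h
  refine h'.symm.trans ?_
  exact congrArg (fun t => (EPresheaf.Hom.app (s σ g) a).app (op d) (ConeGen.toSt t))
    (ConeGen.taut_map_map g z)

lemma descGen_rel {z w : ConeGen p d a} (h : ConeGen.Rel p d a z w) :
    descGen s z = descGen s w := by
  obtain ⟨σ, g, z, w, h', rfl, rfl⟩ := h.exists_map
  rw [descGen_map s hs, descGen_map s hs]
  exact congrArg _ (Quot.sound h')

lemma descGen_restrict (κ : d' ⟶ d) (z : ConeGen p d a) :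
    descGen s (z.restrict κ) = (F.obj a).map κ.op (descGen s z) := by
  have h : z.restrict κ = (z.taut.restrict κ).map (simplexHom z.simplex) := by
    rw [ConeGen.map_restrict, ConeGen.taut_map]
  rw [h, descGen_map s hs]
  exact NatTrans.naturality_apply (EPresheaf.Hom.app (s _ (simplexHom z.simplex)) a) κ.op
    z.taut.toSt

lemma descGen_precomp (f : HomAt (op d) a b) (z : ConeGen p d b) :
    descGen s (z.precomp f) = (F.act a b).app (op d) (f, descGen s z) := by
  have h : z.precomp f = (z.taut.precomp f).map (simplexHom z.simplex) := by
    rw [ConeGen.map_precomp, ConeGen.taut_map]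
  rw [h, descGen_map s hs]
  exact (congrArg (fun (t : (a ⟶[Space T] b) ⊗ (explicitStPresheaf _).obj b ⟶ F.obj a) =>
    t.app (op d) (f, z.taut.toSt))
      (EPresheaf.naturality (s _ (simplexHom z.simplex)) a b)).symm

/-- The map out of the explicit straightening given by a compatible family of maps out of the
explicit straightenings of the representables over `p`. -/
def explicitDesc : explicitStPresheaf p ⟶ F :=
  EPresheaf.Hom.mk
    (fun a =>
      { app d := ↾Quot.lift (descGen s (d := d.unop)) (fun _ _ => descGen_rel s hs)
        naturality d d' κ := by
          ext z
          induction z using Quot.ind with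
          | mk z => exact descGen_restrict s hs κ.unop z })
    (fun a b => by
      ext d y
      obtain ⟨f, z⟩ := y
      induction z using Quot.ind with
      | mk z => exact (descGen_precomp s hs f z).symm)

end Desc

/-- The compatible family of maps out of the explicit straightenings of the representables over `p`
given by a cocone. -/
abbrev coconeLeg (s : Cocone (CostructuredArrow.proj (CostructuredArrow.toOver yoneda W.obj) p ⋙
    CostructuredArrow.toOver yoneda W.obj ⋙ explicitSt W)) (σ : Elements W)
    (g : overRep σ ⟶ p) : explicitStPresheaf (overRep σ) ⟶ s.pt :=
  s.ι.app (CostructuredArrow.mk (Y := σ) g)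

lemma coconeLeg_comp (s : Cocone (CostructuredArrow.proj (CostructuredArrow.toOver yoneda W.obj) p ⋙
    CostructuredArrow.toOver yoneda W.obj ⋙ explicitSt W)) {σ τ : Elements W} (φ : σ ⟶ τ)
    (g : overRep τ ⟶ p) :
    (explicitSt W).map (overRepMap φ) ≫ coconeLeg s τ g = coconeLeg s σ (overRepMap φ ≫ g) := by
  exact s.w (CostructuredArrow.homMk φ rfl : CostructuredArrow.mk (Y := σ) (overRepMap φ ≫ g) ⟶
    CostructuredArrow.mk (Y := τ) g)

variable (p) in
/-- The explicit straightening of `p` is the colimit of those of the representables over `p`. -/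
def isColimitExplicitStCocone : IsColimit ((Functor.LeftExtension.mk (explicitSt W)
    (𝟙 (CostructuredArrow.toOver yoneda W.obj ⋙ explicitSt W))).coconeAt p) where
  desc s := explicitDesc (F := s.pt) (coconeLeg s) (coconeLeg_comp s)
  fac s g := by
    ext a d z
    induction z using Quot.ind with
    | mk z => exact descGen_map (coconeLeg s) (coconeLeg_comp s) g.hom z
  uniq s f hf := by
    ext a d z
    induction z using Quot.ind with
    | mk z =>
      have h := congrArg (fun (t : explicitStPresheaf _ ⟶ s.pt) =>
        (EPresheaf.Hom.app t a).app d (ConeGen.taut z).toSt)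
        (hf (CostructuredArrow.mk (Y := elementAt (ConeGen.simplex z))
          (simplexHom (ConeGen.simplex z))))
      refine Eq.trans ?_ h
      exact congrArg (fun w => (EPresheaf.Hom.app f a).app d (ConeGen.toSt w))
        (ConeGen.taut_map z).symm

instance : (explicitSt W).IsLeftKanExtension
    (𝟙 (CostructuredArrow.toOver yoneda W.obj ⋙ explicitSt W)) :=
  Functor.LeftExtension.IsPointwiseLeftKanExtension.isLeftKanExtension
    (E := Functor.LeftExtension.mk (explicitSt W) (𝟙 _)) isColimitExplicitStCocone

variable (W) in
/-- Under the equivalence between the slice category and presheaves on the category of elements,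
the representables over `W` correspond to the representables. -/
def toOverIsoULiftYoneda : CostructuredArrow.toOver yoneda W.obj ⋙
    (overEquivPresheafCostructuredArrow W.obj).functor ≅ uliftYoneda.{0} :=
  CostructuredArrow.toOverCompOverEquivPresheafCostructuredArrow W.obj ≪≫
    NatIso.ofComponents (fun σ => NatIso.ofComponents (fun τ => Equiv.ulift.symm.toIso))

variable (W) in
/-- The canonical map exhibiting `St_W` as an extension of `σ ↦ St_W(σ)` along the inclusion of
the representables into the slice category. -/
def stUnit : stElements W ⟶ CostructuredArrow.toOver yoneda W.obj ⋙ St W :=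
  uliftYoneda.{0}.leftKanExtensionUnit (stElements W) ≫
    Functor.whiskerRight (toOverIsoULiftYoneda W).inv _ ≫ (Functor.associator _ _ _).hom

instance : (St W).IsLeftKanExtension (stUnit W) :=
  (Functor.isLeftKanExtension_iff_postcomp₁ (overEquivPresheafCostructuredArrow W.obj).functor
    (toOverIsoULiftYoneda W) (uliftYoneda.{0}.leftKanExtensionUnit (stElements W))).1 inferInstance

variable (W) in
/-- The straightening functor is isomorphic to the explicit one. -/
def stIso : St W ≅ explicitSt W :=
  Functor.leftKanExtensionUniqueOfIso (St W) (stUnit W) (explicitStElementsIso W).symm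
    (explicitSt W) (𝟙 _)

end KanExtension

/-! ### Enriched adjunctions from compatibility with tensors -/

section TensorAdjunction

open MonoidalRightAction CartesianMonoidalCategory Functor.OplaxRightLinear

universe u₁ u₂

variable {T : Type} [SmallCategory T] {C : Type u₁} [Category.{0} C]
  [MonoidalRightAction (Space T) C] {D : Type u₂} [Category.{0} D]
  [MonoidalRightAction (Space T) D] {L : C ⥤ D} [L.OplaxRightLinear (Space T)]
  [∀ (A : C) (X : Space T), IsIso (δᵣ L A X)]

section leftMap

variable (L) in
/-- The effect on elements of mapping spaces of a functor which commutes with tensors. -/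
def leftMap {A B : C} {d : T × SimplexCategory} (f : A ⊙ᵣ rep d ⟶ B) :
    L.obj A ⊙ᵣ rep d ⟶ L.obj B :=
  inv (δᵣ L A (rep d)) ≫ L.map f

lemma leftMap_naturality {A B : C} {d d' : T × SimplexCategory} (κ : d' ⟶ d)
    (f : A ⊙ᵣ rep d ⟶ B) :
    leftMap L (A ⊴ᵣ yoneda.map κ ≫ f) = L.obj A ⊴ᵣ yoneda.map κ ≫ leftMap L f := by
  rw [leftMap, leftMap, IsIso.inv_comp_eq, ← δᵣ_naturality_right_assoc, IsIso.hom_inv_id_assoc,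
    L.map_comp]

lemma leftMap_constMap {A B : C} (d : T × SimplexCategory) (f : A ⟶ B) :
    leftMap L (constMap d f) = constMap d (L.map f) := by
  rw [leftMap, IsIso.inv_comp_eq, constMap, constMap, ← δᵣ_naturality_right_assoc,
    δᵣ_unitality_hom_assoc]
  simp only [L.map_comp]

/-- A functor commuting with tensors respects the map `A ⊗ F[d] ⟶ B ⊗ F[d]` over `F[d]` given by
`f`, which enters the composition of elements of mapping spaces. -/
lemma map_diag_comp_δᵣ {A B : C} {d : T × SimplexCategory} (f : A ⊙ᵣ rep d ⟶ B) :
    L.map (A ⊴ᵣ lift (𝟙 (rep d)) (𝟙 (rep d)) ≫ (αᵣ A (rep d) (rep d)).hom ≫ f ⊵ᵣ rep d) ≫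
        δᵣ L B (rep d) =
      δᵣ L A (rep d) ≫ L.obj A ⊴ᵣ lift (𝟙 (rep d)) (𝟙 (rep d)) ≫
        (αᵣ (L.obj A) (rep d) (rep d)).hom ≫ leftMap L f ⊵ᵣ rep d := by
  rw [← δᵣ_naturality_right_assoc, δᵣ_associativity_assoc, ← comp_actionHomLeft, leftMap,
    IsIso.hom_inv_id_assoc]
  simp

lemma leftMap_mapSpaceComp {A B E : C} {d : T × SimplexCategory} (f : A ⊙ᵣ rep d ⟶ B)
    (g : B ⊙ᵣ rep d ⟶ E) :
    leftMap L (mapSpaceComp f g) = mapSpaceComp (leftMap L f) (leftMap L g) := by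
  have h := map_diag_comp_δᵣ (L := L) f =≫ (inv (δᵣ L B (rep d)) ≫ L.map g)
  simp only [Category.assoc, IsIso.hom_inv_id_assoc] at h
  have hg : leftMap L g = inv (δᵣ L B (rep d)) ≫ L.map g := rfl
  rw [leftMap, IsIso.inv_comp_eq, mapSpaceComp, mapSpaceComp, hg, ← h]
  simp only [L.map_comp, Category.assoc]

end leftMap

variable {R : D ⥤ C} (adj : L ⊣ R)

/-- The bijection between the elements of the mapping spaces `Map(L A, B)` and `Map(A, R B)`. -/
def mapSpaceEquiv (A : C) (B : D) (d : T × SimplexCategory) :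
    (L.obj A ⊙ᵣ rep d ⟶ B) ≃ (A ⊙ᵣ rep d ⟶ R.obj B) :=
  (asIso (δᵣ L A (rep d))).homFromEquiv.symm.trans (adj.homEquiv (A ⊙ᵣ rep d) B)

section mapSpaceEquiv

variable {A A' : C} {B B' B'' : D} {d d' : T × SimplexCategory}

lemma mapSpaceEquiv_apply (f : L.obj A ⊙ᵣ rep d ⟶ B) :
    mapSpaceEquiv adj A B d f = adj.homEquiv _ _ (δᵣ L A (rep d) ≫ f) := rfl

lemma mapSpaceEquiv_naturality (κ : d' ⟶ d) (f : L.obj A ⊙ᵣ rep d ⟶ B) :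
    mapSpaceEquiv adj A B d' (L.obj A ⊴ᵣ yoneda.map κ ≫ f) =
      A ⊴ᵣ yoneda.map κ ≫ mapSpaceEquiv adj A B d f := by
  rw [mapSpaceEquiv_apply, mapSpaceEquiv_apply, ← δᵣ_naturality_right_assoc,
    adj.homEquiv_naturality_left]

lemma mapSpaceEquiv_constMap (f : L.obj A ⟶ B) :
    mapSpaceEquiv adj A B d (constMap d f) = constMap d (adj.homEquiv A B f) := by
  rw [mapSpaceEquiv_apply, constMap, constMap, ← δᵣ_naturality_right_assoc,
    δᵣ_unitality_hom_assoc, ← adj.homEquiv_naturality_left, ← adj.homEquiv_naturality_left]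

lemma mapSpaceEquiv_leftMap_comp (f : A ⊙ᵣ rep d ⟶ A') (g : L.obj A' ⊙ᵣ rep d ⟶ B) :
    mapSpaceEquiv adj A B d (mapSpaceComp (leftMap L f) g) =
      mapSpaceComp f (mapSpaceEquiv adj A' B d g) := by
  have h := map_diag_comp_δᵣ (L := L) f =≫ g
  simp only [Category.assoc] at h
  rw [mapSpaceEquiv_apply, mapSpaceEquiv_apply, mapSpaceComp, mapSpaceComp, ← h,
    adj.homEquiv_naturality_left]
  simp only [Category.assoc]

/-- The effect of the right adjoint on elements of mapping spaces. -/
def rightMap (f : B ⊙ᵣ rep d ⟶ B') : R.obj B ⊙ᵣ rep d ⟶ R.obj B' :=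
  mapSpaceEquiv adj (R.obj B) B' d (mapSpaceComp (constMap d (adj.counit.app B)) f)

lemma leftMap_mapSpaceEquiv_comp (f : L.obj A ⊙ᵣ rep d ⟶ B) :
    mapSpaceComp (leftMap L (mapSpaceEquiv adj A B d f)) (constMap d (adj.counit.app B)) = f := by
  apply (mapSpaceEquiv adj A B d).injective
  rw [mapSpaceEquiv_leftMap_comp, mapSpaceEquiv_constMap, constMap_comp_right]
  simp [Adjunction.homEquiv_unit]

lemma mapSpaceEquiv_comp (f : L.obj A ⊙ᵣ rep d ⟶ B) (g : B ⊙ᵣ rep d ⟶ B') :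
    mapSpaceEquiv adj A B' d (mapSpaceComp f g) =
      mapSpaceComp (mapSpaceEquiv adj A B d f) (rightMap adj g) := by
  rw [rightMap, ← mapSpaceEquiv_leftMap_comp, ← mapSpaceComp_assoc, leftMap_mapSpaceEquiv_comp]

lemma rightMap_naturality (κ : d' ⟶ d) (f : B ⊙ᵣ rep d ⟶ B') :
    rightMap adj (B ⊴ᵣ yoneda.map κ ≫ f) = R.obj B ⊴ᵣ yoneda.map κ ≫ rightMap adj f := by
  rw [rightMap, rightMap, ← mapSpaceEquiv_naturality, mapSpaceComp_naturality, constMap_naturality]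
  rfl

lemma rightMap_constMap (f : B ⟶ B') :
    rightMap adj (constMap d f) = constMap d (R.map f) := by
  have h : constMap d (adj.counit.app B) ≫ f = constMap d (adj.counit.app B ≫ f) := by
    simp only [constMap, Category.assoc]
  rw [rightMap, constMap_comp_right, h, mapSpaceEquiv_constMap]
  simp [Adjunction.homEquiv_unit]

lemma rightMap_mapSpaceComp (f : B ⊙ᵣ rep d ⟶ B') (g : B' ⊙ᵣ rep d ⟶ B'') :
    rightMap adj (mapSpaceComp f g) = mapSpaceComp (rightMap adj f) (rightMap adj g) := by
  rw [rightMap, ← mapSpaceComp_assoc, mapSpaceEquiv_comp]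
  rfl

end mapSpaceEquiv

variable [HasTerminal T]

attribute [local instance] enrichment

/-- An adjunction whose left adjoint commutes with tensors is enriched. -/
def enrichedAdjunction : EnrichedAdjunction (Space T) adj where
  left :=
    { map A B :=
        { app d := ↾fun f => leftMap L (d := d.unop) f
          naturality d d' κ := by
            ext f
            exact leftMap_naturality κ.unop f }
      map_id A := by
        ext d x
        exact (leftMap_constMap d.unop (𝟙 A)).trans (congrArg (constMap d.unop) (L.map_id A))
      map_comp A B E := by
        ext d x
        exact leftMap_mapSpaceComp (d := d.unop) x.1 x.2
      eHomEquiv_map f := by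
        ext d x
        exact (leftMap_constMap d.unop f).symm }
  right :=
    { map A B :=
        { app d := ↾fun f => rightMap adj (d := d.unop) f
          naturality d d' κ := by
            ext f
            exact rightMap_naturality adj κ.unop f }
      map_id A := by
        ext d x
        exact (rightMap_constMap adj (𝟙 A)).trans (congrArg (constMap d.unop) (R.map_id A))
      map_comp A B E := by
        ext d x
        exact rightMap_mapSpaceComp adj (d := d.unop) x.1 x.2
      eHomEquiv_map f := by
        ext d x
        exact (rightMap_constMap adj f).symm }
  homIso A B := NatIso.ofComponents (fun d => (mapSpaceEquiv adj A B d.unop).toIso) (by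
    intro d d' κ
    ext f
    exact mapSpaceEquiv_naturality adj κ.unop f)
  naturality_left A A' B := by
    ext d x
    exact mapSpaceEquiv_leftMap_comp adj (d := d.unop) x.1 x.2
  naturality_right A B B' := by
    ext d x
    exact mapSpaceEquiv_comp adj (d := d.unop) x.1 x.2
  homEquiv_eq f := by
    ext d x
    exact (mapSpaceEquiv_constMap adj f).symm

end TensorAdjunction

/-! ### Straightening and tensors -/

section Straightening

open MonoidalRightAction Functor.OplaxRightLinear

variable {T : Type} [SmallCategory T] [HasTerminal T] {W : PCat T}

/-- A functor isomorphic to one which is compatible with actions inherits this compatibility. -/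
abbrev oplaxRightLinearOfIso {V C D : Type*} [Category* V] [MonoidalCategory V] [Category* C]
    [Category* D] [MonoidalRightAction V C] [MonoidalRightAction V D] {F G : C ⥤ D} (e : F ≅ G)
    [G.OplaxRightLinear V] : F.OplaxRightLinear V where
  δᵣ A X := e.hom.app (A ⊙ᵣ X) ≫ δᵣ G A X ≫ e.inv.app A ⊵ᵣ X
  δᵣ_naturality_right A X Y f := by
    simp [action_exchange]
  δᵣ_naturality_left f X := by
    simp [← comp_actionHomLeft]
  δᵣ_associativity A X Y := by
    simp only [actionHomLeft_tensor, comp_actionHomLeft, Category.assoc,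
      NatTrans.naturality_assoc, δᵣ_associativity_assoc]
    rw [← comp_actionHomLeft_assoc (e.inv.app (A ⊙ᵣ X)), e.inv_hom_id_app, id_actionHomLeft,
      Category.id_comp, Iso.inv_hom_id, Category.comp_id]
  δᵣ_unitality_inv A := by
    simp

instance : (St W).OplaxRightLinear (Space T) := oplaxRightLinearOfIso (stIso W)

instance (p : Over W.obj) (X : Space T) : IsIso (δᵣ (St W) p X) :=
  inferInstanceAs (IsIso ((stIso W).hom.app (p ⊙ᵣ X) ≫ δᵣ (explicitSt W) p X ≫
    (stIso W).inv.app p ⊵ᵣ X))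

end Straightening

end Straightening

end

theorem proposition3p4 (r : ℕ) (W : PCat (Theta r)) :
    (∃ τ : ∀ (p : Over W.obj) (X : Space (Theta r)),
        (St W).obj (p ⊙ᵣ X) ≅ (St W).obj p ⊙ᵣ X,
      (∀ {p q : Over W.obj} (f : p ⟶ q) (X : Space (Theta r)),
        (St W).map (f ⊵ᵣ X) ≫ (τ q X).hom = (τ p X).hom ≫ (St W).map f ⊵ᵣ X) ∧
      (∀ (p : Over W.obj) {X Y : Space (Theta r)} (g : X ⟶ Y),
        (St W).map (p ⊴ᵣ g) ≫ (τ p Y).hom = (τ p X).hom ≫ (St W).obj p ⊴ᵣ g)) ∧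
    Nonempty (EnrichedAdjunction (Space (Theta r)) (stUnAdj W)) :=
  ⟨⟨fun p X => asIso (Functor.OplaxRightLinear.δᵣ (St W) p X),
    fun f X => Functor.OplaxRightLinear.δᵣ_naturality_left (St W) f X,
    fun p _ _ g => Functor.OplaxRightLinear.δᵣ_naturality_right (St W) p g⟩,
    ⟨enrichedAdjunction (stUnAdj W)⟩⟩
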